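/- The following is a theorem of $\mathsf{ZF}$ (no form of the Axiom of Choice is used); equivalently, it holds in every model of $\mathsf{ZF}$, all notions being interpreted in the model. Here $\mathbb{R}$ is the complete ordered field (which exists in $\mathsf{ZF}$ and is unique up to isomorphism), $\mathbb{C}=\mathbb{R}[i]$, and for a set $X$, $\ell^2(X)$ is the Hilbert space of all functions $\eta\colon X\to\mathbb{C}$ such that the sums $\sum_{x\in F}|\eta(x)|^2$, over finite $F\subseteq X$, are bounded, with inner product $\langle\eta,\zeta\rangle=\sum_{x\in X}\eta(x)\overline{\zeta(x)}$. A set is finite if it is equipotent with a natural number. An infinite set is amorphous if each of its subsets is finite or cofinite; it is strongly amorphous if, moreover, in every partition of it into nonempty subsets all but finitely many cells are singletons. Theorem. Let $X$ be an amorphous set that can be written as $X=\bigsqcup_{z\in Z}X_z$, where $Z$ is strongly amorphous and the $X_z$ are pairwise disjoint two-element sets. Then: (1) $\ell^2(X)$ has a closed subspace $\mathcal{Y}$ that is isomorphic (linearly, preserving the inner product) to $\ell^2(Z)$, and there is no injection from $Z$ into $X$. Moreover, $\mathcal{Y}$ can be chosen such that (2) the orthogonal complement $\mathcal{Y}^\perp$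 of $\mathcal{Y}$ in $\ell^2(X)$ has no orthonormal basis (an orthonormal set whose closed linear span is $\mathcal{Y}^\perp$), and (3) $\mathcal{Y}^\perp$ contains no infinite orthonormal set. -/

import Mathlib

/-!
# Models of ZF and analysis inside them

The result is a theorem of ZF *without* any form of the axiom of choice, so it is stated about an
arbitrary model `(M, ∈)` of ZF (well-founded or not), every notion being interpreted inside the
model.  (In the ambient classical logic of Mathlib there are no amorphous sets at all.)

A piece of Lean data (an element, a pair, a set, a function, ...) built over the elements of `M`
counts as an object of the model exactly if it is coded by an element of `M`; this is the predicate
`Internal`.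
-/

namespace ZFAnalysis

/-! ### Zermelo-Fraenkel set theory -/

/-- The only non-logical symbol of the language of set theory. -/
inductive SetRel : ℕ → Type
  | mem : SetRel 2

/-- The first-order language of set theory: one binary relation symbol. -/
def setLang : FirstOrder.Language.{0, 0} := ⟨fun _ => Empty, SetRel⟩

universe u v w

/-- `(M, ∈)` as a first-order structure. -/
instance setStructure (M : Type u) [Membership M M] : setLang.Structure M where
  funMap := fun f => Empty.elim f
  RelMap := fun r => match r with
    | SetRel.mem => fun v => v 0 ∈ v 1

section Model

variable {M : Type u} [Membership M M]

/-- `I` contains the empty set and is closed under `n ↦ n ∪ {n}`. -/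
def IsInductive (I : M) : Prop :=
  (∃ e ∈ I, ∀ x : M, x ∉ e) ∧ ∀ n ∈ I, ∃ s ∈ I, ∀ x : M, x ∈ s ↔ x ∈ n ∨ x = n

variable (M) in
/-- `(M, ∈)` is a model of the Zermelo-Fraenkel axioms, without choice. The two schemas speak about
all subsets of `M` and all binary relations on `M` that are first-order definable in `(M, ∈)` with
parameters from `M`. -/
class ZFModel : Prop where
  extensionality : ∀ a b : M, (∀ x : M, x ∈ a ↔ x ∈ b) → a = b
  foundation : ∀ a : M, (∃ x : M, x ∈ a) → ∃ x ∈ a, ∀ y ∈ a, y ∉ x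
  pairing : ∀ a b : M, ∃ c : M, ∀ x : M, x ∈ c ↔ x = a ∨ x = b
  union : ∀ a : M, ∃ b : M, ∀ x : M, x ∈ b ↔ ∃ y ∈ a, x ∈ y
  powerset : ∀ a : M, ∃ b : M, ∀ x : M, x ∈ b ↔ ∀ y ∈ x, y ∈ a
  infinity : ∃ I : M, IsInductive I
  separation : ∀ D : Set M, (Set.univ : Set M).Definable₁ setLang D →
    ∀ a : M, ∃ b : M, ∀ x : M, x ∈ b ↔ x ∈ a ∧ x ∈ D
  replacement : ∀ F : Set (M × M), (Set.univ : Set M).Definable₂ setLang F →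
    ∀ a : M, (∀ x ∈ a, ∃! y : M, (x, y) ∈ F) →
      ∃ b : M, ∀ y : M, y ∈ b ↔ ∃ x ∈ a, (x, y) ∈ F

/-- `p` is the unordered pair `{a, b}`. -/
def IsUPair (p a b : M) : Prop := ∀ x : M, x ∈ p ↔ x = a ∨ x = b

/-- `p` is the (Kuratowski) ordered pair `(a, b) = {{a}, {a, b}}`. -/
def IsOPair (p a b : M) : Prop :=
  ∃ s t : M, IsUPair s a a ∧ IsUPair t a b ∧ IsUPair p s t

/-- `n` is a natural number of the model (a member of the `ω` of the model). -/
def IsNat (n : M) : Prop := ∀ I : M, IsInductive I → n ∈ I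

/-- The type of the elements of the set `A` of the model. -/
abbrev El (A : M) : Type u := {x : M // x ∈ A}

end Model

/-! ### Objects of the model -/

/-- `IsCode a m`: the element `m` of `M` is the object `a`. The instances below say what this means
for elements, pairs, complex numbers, sets and functions. In a model of ZF an object has at most one
code, and objects of the same type with the same code are equal. -/
class Coded (M : Type u) (α : Type v) where
  IsCode : α → M → Prop

section Coding

variable {M : Type u} [Membership M M]

/-- An element of `M` codes itself. -/
instance codedSelf : Coded M M where
  IsCode a m := m = a

/-- An element of a subtype (in particular of `El A`) has the code it has in the ambient type. -/
instance codedSubtype {α : Type v} [Coded M α] (p : α → Prop) : Coded M (Subtype p) where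
  IsCode a m := Coded.IsCode (a : α) m

/-- Ordered pairs. -/
instance codedProd {α : Type v} {β : Type w} [Coded M α] [Coded M β] : Coded M (α × β) where
  IsCode a m := ∃ s t : M, Coded.IsCode a.1 s ∧ Coded.IsCode a.2 t ∧ IsOPair m s t

/-- A set `S` is coded by the set of the codes of its elements, all of which must have one. -/
instance codedSet {α : Type v} [Coded M α] : Coded M (Set α) where
  IsCode S m :=
    (∀ a ∈ S, ∃ s ∈ m, Coded.IsCode a s) ∧ (∀ s ∈ m, ∃ a ∈ S, Coded.IsCode a s)

/-- A function is coded by its graph. -/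
instance codedFun {α : Type v} {β : Type w} [Coded M α] [Coded M β] : Coded M (α → β) where
  IsCode f m := Coded.IsCode {p : α × β | p.2 = f p.1} m

/-- Elements `x + iy` of a quadratic extension (used for the complex numbers of the model) are
coded as the ordered pair `(x, y)`. -/
instance codedQuadratic {K : Type v} [Coded M K] (a b : K) :
    Coded M (QuadraticAlgebra K a b) where
  IsCode z m := Coded.IsCode (z.re, z.im) m

variable (M) in
/-- `a` is an object of the model `M`. -/
def Internal {α : Type v} [Coded M α] (a : α) : Prop := ∃ m : M, Coded.IsCode a m

/-! ### Finite, amorphous and strongly amorphous sets -/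

variable (M) in
/-- In the model, `S` is finite: it is in bijection with a natural number. -/
def IsFin {α : Type v} [Coded M α] (S : Set α) : Prop :=
  ∃ n : M, IsNat n ∧ ∃ e : El n → S, Internal M e ∧ Function.Bijective e

/-- In the model, `A` is amorphous: it is infinite, and each of its subsets is finite or
cofinite. -/
def IsAmorphous (A : M) : Prop :=
  ¬ IsFin M (Set.univ : Set (El A)) ∧
    ∀ S : Set (El A), Internal M S → IsFin M S ∨ IsFin M Sᶜ

/-- In the model, `A` is strongly rigid: it is infinite, and in any partition of `A` into nonempty
subsets all but finitely many cells are singletons. -/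
def IsStronglyRigid (A : M) : Prop :=
  ¬ IsFin M (Set.univ : Set (El A)) ∧
    ∀ P : Set (Set (El A)), Internal M P → Setoid.IsPartition P →
      IsFin M {C ∈ P | ¬ ∃ a, C = {a}}

/-- In the model, `A` is strongly amorphous. -/
def IsStronglyAmorphous (A : M) : Prop := IsAmorphous A ∧ IsStronglyRigid A

/-! ### Real and complex numbers of the model -/

/-- The set `R` of the model, with operations and an order that are objects of the model, is a field
of real numbers of the model, that is, in the model it is a (Dedekind) complete ordered field.
ZF proves that there is one and that it is unique up to a unique isomorphism. -/
class RealField (R : M) extends Field (El R), LinearOrder (El R), IsStrictOrderedRing (El R) where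
  internal_add : Internal M (fun p : El R × El R => p.1 + p.2)
  internal_mul : Internal M (fun p : El R × El R => p.1 * p.2)
  internal_le : Internal M {p : El R × El R | p.1 ≤ p.2}
  exists_isLUB : ∀ S : Set (El R), Internal M S → S.Nonempty → BddAbove S → ∃ s, IsLUB S s

/-- The complex numbers `ℝ[i]`, `i² = -1`, of the model. -/
abbrev Cplx (R : M) [RealField R] : Type u := QuadraticAlgebra (El R) (-1) 0

/-! ### Sums -/

section Sums

variable {R : M} [RealField R] {α : Type v} [Coded M α]

/-- `s = ∑_{x ∈ F} f x`, a finite sum in the model. This is the recursive definition: the relation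
between `F` and `s` is the least one in the model with `∑_{x ∈ ∅} f x = 0` and
`∑_{x ∈ F ∪ {a}} f x = ∑_{x ∈ F} f x + f a` for `a ∉ F`. -/
def IsFinSum (f : α → El R) (F : Set α) (s : El R) : Prop :=
  ∀ Q : Set (Set α × El R), Internal M Q → (∅, 0) ∈ Q →
    (∀ G t a, (G, t) ∈ Q → a ∉ G → (insert a G, t + f a) ∈ Q) → (F, s) ∈ Q

/-- In the model, `f` is the limit along the finite sets `F`, directed by inclusion, of the sums
`∑_{x ∈ F} f x`. -/
def HasSumIn (f : α → El R) (s : El R) : Prop :=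
  ∀ ε : El R, 0 < ε → ∃ F₀ : Set α, IsFin M F₀ ∧
    ∀ F : Set α, IsFin M F → F₀ ⊆ F → ∃ t, IsFinSum f F t ∧ |t - s| < ε

end Sums

/-! ### The Hilbert space `ℓ²(X)` of the model -/

section Ell2

variable {R : M} [RealField R] {X Z : M}

variable (R X) in
/-- `ℓ²(X)` in the model: the functions `η : X → ℂ` for which the finite sums
`∑_{x ∈ F} |η x|²` are bounded. -/
def ell2 : Set (El X → Cplx R) :=
  {η | Internal M η ∧ ∃ c : El R, ∀ F : Set (El X), IsFin M F →
    ∃ s, IsFinSum (fun x => (η x).re ^ 2 + (η x).im ^ 2) F s ∧ s ≤ c}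

/-- `⟨η, ζ⟩ = c`, where `⟨η, ζ⟩ = ∑_{x ∈ X} η x * conj (ζ x)`; convergence of the sum in `ℂ` is
expressed by the real and imaginary parts. -/
def HasInner (η ζ : El X → Cplx R) (c : Cplx R) : Prop :=
  HasSumIn (fun x => (η x * star (ζ x)).re) c.re ∧
  HasSumIn (fun x => (η x * star (ζ x)).im) c.im

/-- `‖η‖ < ε` (for `ε > 0`), that is, `⟨η, η⟩ = c` for some `c` with `c < ε²`. -/
def NormLT (η : El X → Cplx R) (ε : El R) : Prop :=
  ∃ c : Cplx R, HasInner η η c ∧ c.re < ε ^ 2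

/-- In the model, `Y` is a closed linear subspace of `ℓ²(X)`. -/
structure IsClosedSubspace (Y : Set (El X → Cplx R)) : Prop where
  internal : Internal M Y
  subset : Y ⊆ ell2 R X
  zero_mem : 0 ∈ Y
  add_mem : ∀ η ∈ Y, ∀ ζ ∈ Y, η + ζ ∈ Y
  smul_mem : ∀ c : Cplx R, ∀ η ∈ Y, c • η ∈ Y
  closed : ∀ η ∈ ell2 R X, (∀ ε : El R, 0 < ε → ∃ ζ ∈ Y, NormLT (η - ζ) ε) → η ∈ Y

/-- In the model, the Hilbert spaces `H ⊆ ℓ²(Z)` and `K ⊆ ℓ²(X)` are isomorphic: there is a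
linear bijection between them that preserves the inner product. -/
def IsIsomorphic (H : Set (El Z → Cplx R)) (K : Set (El X → Cplx R)) : Prop :=
  ∃ T : H → K, Internal M T ∧ Function.Bijective T ∧
    (∀ η ζ θ : H, (θ : El Z → Cplx R) = η + ζ → (T θ : El X → Cplx R) = T η + T ζ) ∧
    (∀ (c : Cplx R) (η θ : H), (θ : El Z → Cplx R) = c • (η : El Z → Cplx R) →
      (T θ : El X → Cplx R) = c • (T η : El X → Cplx R)) ∧
    (∀ (η ζ : H) (c : Cplx R), HasInner (η : El Z → Cplx R) ζ c ↔
      HasInner (T η : El X → Cplx R) (T ζ) c)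

/-- The orthogonal complement of `Y` in `ℓ²(X)`. -/
def orthCompl (Y : Set (El X → Cplx R)) : Set (El X → Cplx R) :=
  {η ∈ ell2 R X | ∀ ζ ∈ Y, HasInner η ζ 0}

/-- In the model, `B` is an orthonormal set. -/
def IsOrthonormal (B : Set (El X → Cplx R)) : Prop :=
  Internal M B ∧ B ⊆ ell2 R X ∧ (∀ η ∈ B, HasInner η η 1) ∧
    ∀ η ∈ B, ∀ ζ ∈ B, η ≠ ζ → HasInner η ζ 0

/-- In the model, `B` is an orthonormal basis of the closed subspace `H` of `ℓ²(X)`: it is an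
orthonormal subset of `H` whose closed linear span, the least closed subspace that contains `B`,
is `H`. -/
def IsOrthonormalBasis (H B : Set (El X → Cplx R)) : Prop :=
  IsOrthonormal B ∧ B ⊆ H ∧ ∀ W, IsClosedSubspace W → B ⊆ W → H ⊆ W

end Ell2

end Coding

end ZFAnalysis

open ZFAnalysis

/-! On an amorphous set `X` every element of `ℓ²(X)` has finite support. The engine is
`false_of_preorder`: an infinite subset of an amorphous set cannot carry a total preorder with
finite initial segments, because taking every second level would give an infinite subset with
infinite complement. Sorting the support of a square summable function by decreasing absolute value
gives such a preorder unless the support is finite (`isFin_support_of_bounded`, `mem_ell2_iff`).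
Hence all inner products are finite sums.

Let `π : X → Z` be the projection and `σ` the involution exchanging the two points of each fibre.
The subspace is the set of functions constant on the fibres. Pulling back along `π` doubles inner
products, so `η ↦ (1 + i)/2 · η ∘ π` is an isometry of `ℓ²(Z)` onto it. Functions in the orthogonal
complement satisfy `η ∘ σ = -η`.

The core is `IsTwoToOne.isFin_of_isOrthonormal`. Let `B` be an orthonormal set in the complement.
Bessel's inequality and `false_of_preorder` show that only finitely many members of `B` are nonzero
at a given point. Join two elements of `Z` if some member of `B` is nonzero on both fibres. This
graph is locally finite, its components are finite (`false_of_preorder` again, with balls around a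
point as initial segments), and so strong amorphousness leaves only finitely many non-isolated
elements of `Z`. Over an isolated element at most one member of `B` lives, since two functions that
change sign on the same pair are proportional. The point of the fibre where its value lies in the
upper half plane is then distinguished. If `B` were infinite, this would select one point from
infinitely many fibres, an infinite and coinfinite subset of `X`.

An orthonormal basis would therefore be finite and would vanish at some point `x`; so would its
closed span, but `e_x - e_{σ x}` lies in the complement. An injection `f : Z → X` partitions `Z` by
`π ∘ f` into cells with at most two elements, almost all of them singletons; so the range of `f`
misses `σ (f z)` for almost all `z`, and is neither finite nor cofinite.

All this takes place inside an arbitrary model `M`, so each auxiliary set must be an element of `M`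
and each induction must concern a definable property. The predicate `Def M f` (definable, and
mapping objects of the model to objects of the model) is closed under logical and algebraic
constructions, and `fun_prop` assembles such proofs. Choices made in the ambient logic are harmless
because whatever is internalised from them does not depend on the choice, and so is definable.

The existence of the real field is proved by building fractions of differences of the natural
numbers of `M`, and then the internal Cauchy sequences modulo null sequences
(`exists_complete_field`). -/

namespace ZFAnalysis

universe u v w

set_option linter.unusedSectionVars false
set_option linter.unusedVariables false

open Coded

/-! ### First-order definable relations -/

section Raw

variable {M : Type u} [Membership M M] {ι κ : Type}

/-- First-order definability with parameters of a relation on `M`. -/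
def RDef (P : (ι → M) → Prop) : Prop := (Set.univ : Set M).Definable setLang {v | P v}

namespace RDef

theorem and {P Q : (ι → M) → Prop} (hP : RDef P) (hQ : RDef Q) : RDef fun v => P v ∧ Q v :=
  Set.Definable.inter hP hQ

theorem not {P : (ι → M) → Prop} (hP : RDef P) : RDef fun v => ¬ P v :=
  Set.Definable.compl hP

theorem congr {P Q : (ι → M) → Prop} (hP : RDef P) (h : ∀ v, P v ↔ Q v) : RDef Q := by
  have : P = Q := funext fun v => propext (h v)
  exact this ▸ hP

theorem or {P Q : (ι → M) → Prop} (hP : RDef P) (hQ : RDef Q) : RDef fun v => P v ∨ Q v :=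
  Set.Definable.union hP hQ

theorem imp {P Q : (ι → M) → Prop} (hP : RDef P) (hQ : RDef Q) : RDef fun v => P v → Q v :=
  (hP.not.or hQ).congr fun _ => imp_iff_not_or.symm

theorem iff {P Q : (ι → M) → Prop} (hP : RDef P) (hQ : RDef Q) : RDef fun v => (P v ↔ Q v) :=
  ((hP.imp hQ).and (hQ.imp hP)).congr fun _ => iff_iff_implies_and_implies.symm

theorem comp {P : (ι → M) → Prop} (hP : RDef P) (f : ι → κ) :
    RDef fun v : κ → M => P fun i => v (f i) :=
  Set.Definable.preimage_comp f hP

/-- Definable sets are closed under projection; the quantified variable is stored at the index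
`none`. -/
theorem ex {P : (ι → M) → M → Prop}
    (h : RDef fun w : Option ι → M => P (fun i => w (some i)) (w none)) :
    RDef fun v => ∃ x, P v x := by
  have h1 : RDef fun w : ι ⊕ Unit → M => P (fun i => w (Sum.inl i)) (w (Sum.inr ())) :=
    h.comp (fun o : Option ι => o.elim (Sum.inr ()) Sum.inl)
  have h2 := Set.Definable.exists_of_finite h1
  refine congr h2 fun v => ?_
  constructor
  · rintro ⟨x, hx⟩
    exact ⟨x (), hx⟩
  · rintro ⟨x, hx⟩
    exact ⟨fun _ => x, hx⟩

theorem all {P : (ι → M) → M → Prop}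
    (h : RDef fun w : Option ι → M => P (fun i => w (some i)) (w none)) :
    RDef fun v => ∀ x, P v x :=
  (ex (P := fun v x => ¬ P v x) h.not).not.congr fun _ => not_exists_not

theorem mem (i j : ι) : RDef fun v : ι → M => v i ∈ v j := by
  refine ⟨(FirstOrder.Language.Relations.formula₂
    (Sum.inl SetRel.mem : (setLang.withConstants (Set.univ : Set M)).Relations 2)
    (FirstOrder.Language.Term.var i) (FirstOrder.Language.Term.var j)), ?_⟩
  ext v
  simp only [Set.mem_ofPred_eq]
  rfl

theorem eq (i j : ι) : RDef fun v : ι → M => v i = v j := by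
  refine ⟨(FirstOrder.Language.Term.var i).equal (FirstOrder.Language.Term.var j), ?_⟩
  ext v
  simp

theorem eq_const (i : ι) (c : M) : RDef fun v : ι → M => v i = c :=
  comp (P := fun v : Fin 1 → M => v 0 ∈ ({c} : Set M))
    (Set.Definable.singleton_of_mem setLang (Set.mem_univ c)) fun _ => i

theorem mem_const (i : ι) (c : M) : RDef fun v : ι → M => v i ∈ c :=
  (ex (P := fun v x => x = c ∧ v i ∈ x) ((eq_const _ _).and (mem _ _))).congr fun v => by simp

theorem rel1 {C : M → Prop} (h : RDef fun v : Fin 1 → M => C (v 0)) (i : ι) :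
    RDef fun v : ι → M => C (v i) :=
  h.comp ![i]

theorem rel2 {C : M → M → Prop} (h : RDef fun v : Fin 2 → M => C (v 0) (v 1)) (i j : ι) :
    RDef fun v : ι → M => C (v i) (v j) :=
  h.comp ![i, j]

theorem upair (i j k : ι) : RDef fun v : ι → M => IsUPair (v i) (v j) (v k) := by
  unfold IsUPair
  exact all ((mem _ _).iff ((eq _ _).or (eq _ _)))

theorem opair (i j k : ι) : RDef fun v : ι → M => IsOPair (v i) (v j) (v k) := by
  unfold IsOPair
  exact ex (ex ((upair _ _ _).and ((upair _ _ _).and (upair _ _ _))))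

end RDef

/-- A definable class. -/
def D1 (C : M → Prop) : Prop := RDef fun v : Fin 1 → M => C (v 0)

/-- A definable class relation. -/
def D2 (C : M → M → Prop) : Prop := RDef fun v : Fin 2 → M => C (v 0) (v 1)

theorem D1.of_iff {C C' : M → Prop} (h : D1 C) (h' : ∀ x, C x ↔ C' x) : D1 C' :=
  RDef.congr h fun _ => h' _

theorem D2.of_iff {C C' : M → M → Prop} (h : D2 C) (h' : ∀ x y, C x y ↔ C' x y) : D2 C' :=
  RDef.congr h fun _ => h' _ _

theorem D1.at {C : M → Prop} (h : D1 C) (i : ι) : RDef fun v : ι → M => C (v i) :=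
  RDef.rel1 h i

theorem D2.at {C : M → M → Prop} (h : D2 C) (i j : ι) : RDef fun v : ι → M => C (v i) (v j) :=
  RDef.rel2 h i j

end Raw

/-! ### Pairs, separation and products in a model of ZF -/

section Pairing

variable {M : Type u} [Membership M M]

theorem IsUPair.inj {p a b c d : M} (h : IsUPair p a b) (h' : IsUPair p c d) :
    (a = c ∧ b = d) ∨ (a = d ∧ b = c) := by
  have ha := (h' a).1 ((h a).2 (Or.inl rfl))
  have hb := (h' b).1 ((h b).2 (Or.inr rfl))
  have hc := (h c).1 ((h' c).2 (Or.inl rfl))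
  have hd := (h d).1 ((h' d).2 (Or.inr rfl))
  grind

theorem IsOPair.inj {p a b c d : M} (h : IsOPair p a b) (h' : IsOPair p c d) :
    a = c ∧ b = d := by
  obtain ⟨s, t, hs, ht, hp⟩ := h
  obtain ⟨s', t', hs', ht', hp'⟩ := h'
  rcases hp.inj hp' with ⟨rfl, rfl⟩ | ⟨rfl, rfl⟩
  · have h1 := hs.inj hs'
    have h2 := ht.inj ht'
    grind
  · have h1 := hs.inj ht'
    have h2 := ht.inj hs'
    grind

end Pairing

section SetTheory

variable {M : Type u} [Membership M M] [ZFModel M]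

theorem sep {C : M → Prop} (h : D1 C) (a : M) : ∃ b : M, ∀ x, x ∈ b ↔ x ∈ a ∧ C x :=
  ZFModel.separation {x | C x} h a

theorem ext' {a b : M} (h : ∀ x : M, x ∈ a ↔ x ∈ b) : a = b := ZFModel.extensionality a b h

theorem exists_upair (a b : M) : ∃ c : M, IsUPair c a b := ZFModel.pairing a b

theorem IsUPair.unique {p q a b : M} (hp : IsUPair p a b) (hq : IsUPair q a b) : p = q :=
  ext' fun x => (hp x).trans (hq x).symm

theorem exists_opair (a b : M) : ∃ c : M, IsOPair c a b := by
  obtain ⟨s, hs⟩ := exists_upair a a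
  obtain ⟨t, ht⟩ := exists_upair a b
  obtain ⟨p, hp⟩ := exists_upair s t
  exact ⟨p, s, t, hs, ht, hp⟩

theorem IsOPair.unique {p q a b : M} (hp : IsOPair p a b) (hq : IsOPair q a b) : p = q := by
  obtain ⟨s, t, hs, ht, hp⟩ := hp
  obtain ⟨s', t', hs', ht', hq⟩ := hq
  obtain rfl := hs.unique hs'
  obtain rfl := ht.unique ht'
  exact hp.unique hq

theorem exists_empty : ∃ e : M, ∀ x, x ∉ e := by
  obtain ⟨I, ⟨e, -, he⟩, -⟩ := ZFModel.infinity (M := M)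
  exact ⟨e, he⟩

/-- A set containing all ordered pairs with components in given sets. -/
theorem exists_prod (a b : M) : ∃ c : M, ∀ p x y, x ∈ a → y ∈ b → IsOPair p x y → p ∈ c := by
  obtain ⟨q, hq⟩ := exists_upair a b
  -- A Kuratowski pair of elements of `a` and `b` lies in the power set of the power set of `a ∪ b`.
  obtain ⟨un, hun⟩ := ZFModel.union q
  obtain ⟨p1, hp1⟩ := ZFModel.powerset un
  obtain ⟨p2, hp2⟩ := ZFModel.powerset p1
  have hx : ∀ x, x ∈ un ↔ x ∈ a ∨ x ∈ b := by
    intro x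
    rw [hun]
    constructor
    · rintro ⟨y, hy, hxy⟩
      rcases (hq y).1 hy with rfl | rfl
      exacts [Or.inl hxy, Or.inr hxy]
    · rintro (h | h)
      exacts [⟨a, (hq a).2 (Or.inl rfl), h⟩, ⟨b, (hq b).2 (Or.inr rfl), h⟩]
  refine ⟨p2, fun p x y hxa hyb hp => (hp2 p).2 fun s hs => (hp1 s).2 fun z hz => (hx z).2 ?_⟩
  obtain ⟨s', t', hs', ht', hp'⟩ := hp
  rcases (hp' s).1 hs with rfl | rfl
  · rcases (hs' z).1 hz with rfl | rfl <;> exact Or.inl hxa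
  · rcases (ht' z).1 hz with rfl | rfl
    exacts [Or.inl hxa, Or.inr hyb]

end SetTheory

/-! ### Faithful codings and definable maps -/

/-- The coding of `α` in `M` is faithful, and the codes form a definable class. -/
class Rep (M : Type u) [Membership M M] (α : Type v) [Coded M α] : Prop where
  unique : ∀ {a : α} {m m' : M}, IsCode a m → IsCode a m' → m = m'
  inj : ∀ {a b : α} {m : M}, IsCode a m → IsCode b m → a = b
  range : D1 fun m : M => ∃ a : α, IsCode a m

/-- All elements of `α` are objects of the model. -/
class Tot (M : Type u) [Membership M M] (α : Type v) [Coded M α] : Prop where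
  internal : ∀ a : α, Internal M a

/-- The objects of type `α` form a set of the model. -/
class Sm (M : Type u) [Membership M M] (α : Type v) [Coded M α] : Prop where
  exists_set : ∃ A : M, ∀ m, m ∈ A ↔ ∃ a : α, IsCode a m

/-- `a` is an object of the model. -/
class IsInt (M : Type u) [Membership M M] {α : Type v} [Coded M α] (a : α) : Prop where
  out : Internal M a

/-- `f` maps objects to objects and is a definable class function. -/
@[fun_prop]
structure Def (M : Type u) [Membership M M] {α : Type v} {β : Type w} [Coded M α] [Coded M β]
    (f : α → β) : Prop where
  internal : ∀ a, Internal M a → Internal M (f a)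
  graph : D2 fun s t : M => ∃ a, IsCode a s ∧ IsCode (f a) t

/-- Falsity is coded by `∅` and truth by `{∅}`. Predicates thereby become maps into `Prop`, and a
single notion `Def` covers functions and relations. -/
instance codedProp {M : Type u} [Membership M M] : Coded M Prop where
  IsCode p m := ∀ x, x ∈ m ↔ p ∧ ∀ y, y ∉ x

section

variable {M : Type u} [Membership M M] {α β γ δ : Type*} [Coded M α] [Coded M β] [Coded M γ]
  [Coded M δ]

theorem Rep.range_at (α : Type*) [Coded M α] [Rep M α] {ι : Type} (i : ι) :
    RDef fun v : ι → M => ∃ a : α, IsCode a (v i) :=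
  (Rep.range (M := M) (α := α)).at i

theorem isCode_prod {p : α × β} {m : M} :
    IsCode p m ↔ ∃ s t : M, IsCode p.1 s ∧ IsCode p.2 t ∧ IsOPair m s t := Iff.rfl

theorem isCode_subtype {p : α → Prop} {a : Subtype p} {m : M} :
    IsCode a m ↔ IsCode a.1 m := Iff.rfl

theorem isCode_self {a m : M} : IsCode a m ↔ m = a := Iff.rfl

theorem isCode_el {A : M} {a : El A} {m : M} : IsCode a m ↔ m = a.1 := Iff.rfl

theorem isCode_set {S : Set α} {m : M} :
    IsCode S m ↔ (∀ a ∈ S, ∃ s ∈ m, IsCode a s) ∧ (∀ s ∈ m, ∃ a ∈ S, IsCode a s) := Iff.rfl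

theorem isCode_fun {f : α → β} {m : M} :
    IsCode f m ↔ IsCode {p : α × β | p.2 = f p.1} m := Iff.rfl

theorem isCode_quadratic {K : Type*} [Coded M K] {a b : K} {z : QuadraticAlgebra K a b} {m : M} :
    IsCode z m ↔ IsCode (z.re, z.im) m := Iff.rfl

theorem isCode_set_iff [Rep M α] {S : Set α} {m : M} :
    IsCode S m ↔ (∀ a ∈ S, Internal M a) ∧ ∀ s, s ∈ m ↔ ∃ a ∈ S, IsCode a s := by
  rw [isCode_set]
  constructor
  · rintro ⟨h1, h2⟩
    refine ⟨fun a ha => ?_, fun s => ⟨h2 s, ?_⟩⟩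
    · obtain ⟨s, -, hs⟩ := h1 a ha
      exact ⟨s, hs⟩
    · rintro ⟨a, ha, has⟩
      obtain ⟨t, ht, hat⟩ := h1 a ha
      rwa [Rep.unique has hat]
  · rintro ⟨h1, h2⟩
    refine ⟨fun a ha => ?_, fun s hs => (h2 s).1 hs⟩
    obtain ⟨s, hs⟩ := h1 a ha
    exact ⟨s, (h2 s).2 ⟨a, ha, hs⟩, hs⟩

theorem mem_iff_of_isCode [Rep M α] {a : α} {S : Set α} {s m : M} (ha : IsCode a s)
    (hS : IsCode S m) : a ∈ S ↔ s ∈ m := by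
  rw [(isCode_set_iff.1 hS).2]
  constructor
  · exact fun h => ⟨a, h, ha⟩
  · rintro ⟨b, hb, hbs⟩
    rwa [Rep.inj ha hbs]

theorem Internal.of_mem [Rep M α] {a : α} {S : Set α} (hS : Internal M S) (ha : a ∈ S) :
    Internal M a := by
  obtain ⟨m, hm⟩ := hS
  exact (isCode_set_iff.1 hm).1 a ha

instance [Tot M α] (a : α) : IsInt M a := ⟨Tot.internal a⟩

theorem internal [Tot M α] (a : α) : Internal M a := Tot.internal a

theorem IsInt.internal (a : α) [IsInt M a] : Internal M a := IsInt.out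

end

/-! ### Codes of products, sets, functions and complex numbers -/

section Instances

variable {M : Type u} [Membership M M]

instance : Tot M M := ⟨fun a => ⟨a, rfl⟩⟩

instance : Rep M M where
  unique h h' := h.trans h'.symm
  inj h h' := h.symm.trans h'
  range := (RDef.eq 0 0).congr fun v => by simp [isCode_self]

instance (A : M) : Tot M (El A) := ⟨fun a => ⟨a.1, rfl⟩⟩

instance (A : M) : Rep M (El A) where
  unique h h' := h.trans h'.symm
  inj h h' := Subtype.ext (h.symm.trans h')
  range := (RDef.mem_const 0 A).congr fun v => by simp [isCode_el]

instance (A : M) : Sm M (El A) := ⟨A, fun m => by simp [isCode_el]⟩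

instance [ZFModel M] : Tot M Prop := by
  refine ⟨fun p => ?_⟩
  obtain ⟨e, he⟩ := exists_empty (M := M)
  by_cases hp : p
  · obtain ⟨s, hs⟩ := exists_upair e e
    refine ⟨s, fun x => ?_⟩
    rw [hs x]
    constructor
    · rintro (rfl | rfl) <;> exact ⟨hp, he⟩
    · rintro ⟨-, h⟩
      exact Or.inl (ext' fun y => ⟨fun hy => (h y hy).elim, fun hy => (he y hy).elim⟩)
  · exact ⟨e, fun x => ⟨fun h => (he x h).elim, fun h => (hp h.1).elim⟩⟩

instance [ZFModel M] : Rep M Prop where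
  unique h h' := ext' fun x => (h x).trans (h' x).symm
  inj {p q m} h h' := by
    obtain ⟨e, he⟩ := exists_empty (M := M)
    have h1 := h e
    have h2 := h' e
    simp only [he, not_false_eq_true, implies_true, and_true] at h1 h2
    exact propext (h1.symm.trans h2)
  range := by
    have : D1 fun m : M => (∀ x, x ∉ m) ∨ ∀ x, x ∈ m ↔ ∀ y, y ∉ x := by
      unfold D1
      exact (RDef.all (RDef.mem _ _).not).or
        (RDef.all ((RDef.mem _ _).iff (RDef.all (RDef.mem _ _).not)))
    refine this.of_iff fun m => ?_
    constructor
    · rintro (h | h)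
      · exact ⟨False, fun x => by simp [h]⟩
      · exact ⟨True, fun x => by simp [h]⟩
    · rintro ⟨p, hp⟩
      by_cases h : p
      · right
        intro x
        have := hp x
        tauto
      · left
        intro x hx
        exact h ((hp x).1 hx).1

variable {α β γ : Type*} [Coded M α] [Coded M β] [Coded M γ]

theorem internal_prodMk [ZFModel M] {a : α} {b : β} (ha : Internal M a) (hb : Internal M b) :
    Internal M (a, b) := by
  obtain ⟨s, hs⟩ := ha
  obtain ⟨t, ht⟩ := hb
  obtain ⟨p, hp⟩ := exists_opair s t
  exact ⟨p, s, t, hs, ht, hp⟩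

theorem Internal.fst {p : α × β} (h : Internal M p) : Internal M p.1 := by
  obtain ⟨m, s, t, hs, ht, -⟩ := h
  exact ⟨s, hs⟩

theorem Internal.snd {p : α × β} (h : Internal M p) : Internal M p.2 := by
  obtain ⟨m, s, t, hs, ht, -⟩ := h
  exact ⟨t, ht⟩

instance [ZFModel M] [Tot M α] [Tot M β] : Tot M (α × β) :=
  ⟨fun p => internal_prodMk (internal p.1) (internal p.2)⟩

instance [ZFModel M] [Rep M α] [Rep M β] : Rep M (α × β) where
  unique := by
    rintro p m m' ⟨s, t, hs, ht, hm⟩ ⟨s', t', hs', ht', hm'⟩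
    rw [Rep.unique hs' hs, Rep.unique ht' ht] at hm'
    exact hm.unique hm'
  inj := by
    rintro p q m ⟨s, t, hs, ht, hm⟩ ⟨s', t', hs', ht', hm'⟩
    obtain ⟨rfl, rfl⟩ := hm.inj hm'
    exact Prod.ext (Rep.inj hs hs') (Rep.inj ht ht')
  range := by
    have : D1 fun m : M => ∃ s t, (∃ a : α, IsCode a s) ∧ (∃ b : β, IsCode b t) ∧ IsOPair m s t := by
      unfold D1
      exact RDef.ex (RDef.ex ((Rep.range_at α _).and ((Rep.range_at β _).and (RDef.opair _ _ _))))
    refine this.of_iff fun m => ?_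
    constructor
    · rintro ⟨s, t, ⟨a, ha⟩, ⟨b, hb⟩, h⟩
      exact ⟨(a, b), s, t, ha, hb, h⟩
    · rintro ⟨p, s, t, ha, hb, h⟩
      exact ⟨s, t, ⟨_, ha⟩, ⟨_, hb⟩, h⟩

/-- A definable class contained in a set is a set. -/
theorem Sm.of_bound [ZFModel M] [Rep M α] (A : M) (h : ∀ (a : α) (m : M), IsCode a m → m ∈ A) :
    Sm M α := by
  obtain ⟨B, hB⟩ := sep (Rep.range (M := M) (α := α)) A
  refine ⟨B, fun m => (hB m).trans (and_iff_right_of_imp ?_)⟩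
  rintro ⟨a, ha⟩
  exact h a m ha

instance [ZFModel M] [Rep M α] [Rep M β] [Sm M α] [Sm M β] : Sm M (α × β) := by
  obtain ⟨A, hA⟩ := Sm.exists_set (M := M) (α := α)
  obtain ⟨B, hB⟩ := Sm.exists_set (M := M) (α := β)
  obtain ⟨C, hC⟩ := exists_prod A B
  refine Sm.of_bound C ?_
  rintro p m ⟨s, t, hs, ht, h⟩
  exact hC m s t ((hA s).2 ⟨_, hs⟩) ((hB t).2 ⟨_, ht⟩) h

instance [ZFModel M] [Rep M α] : Rep M (Set α) where
  unique h h' := ext' fun x => ((isCode_set_iff.1 h).2 x).trans ((isCode_set_iff.1 h').2 x).symm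
  inj {S T m} h h' := by
    ext a
    constructor
    · intro ha
      obtain ⟨s, hs⟩ := (isCode_set_iff.1 h).1 a ha
      exact (mem_iff_of_isCode hs h').2 ((mem_iff_of_isCode hs h).1 ha)
    · intro ha
      obtain ⟨s, hs⟩ := (isCode_set_iff.1 h').1 a ha
      exact (mem_iff_of_isCode hs h).2 ((mem_iff_of_isCode hs h').1 ha)
  range := by
    have : D1 fun m : M => ∀ x, x ∈ m → ∃ a : α, IsCode a x := by
      unfold D1
      exact RDef.all ((RDef.mem _ _).imp (Rep.range_at α _))
    refine this.of_iff fun m => ?_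
    constructor
    · intro h
      refine ⟨{a | ∃ s ∈ m, IsCode a s}, fun a ha => ha, fun s hs => ?_⟩
      obtain ⟨a, ha⟩ := h s hs
      exact ⟨a, ⟨s, hs, ha⟩, ha⟩
    · rintro ⟨S, hS⟩ x hx
      obtain ⟨a, -, ha⟩ := hS.2 x hx
      exact ⟨a, ha⟩

instance [ZFModel M] [Rep M α] [Sm M α] : Sm M (Set α) := by
  obtain ⟨A, hA⟩ := Sm.exists_set (M := M) (α := α)
  obtain ⟨B, hB⟩ := ZFModel.powerset A
  refine Sm.of_bound B fun S m h => (hB m).2 fun s hs => (hA s).2 ?_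
  obtain ⟨a, -, ha⟩ := h.2 s hs
  exact ⟨a, ha⟩

theorem Internal.apply [ZFModel M] [Rep M α] [Rep M β] {f : α → β} (hf : Internal M f) (a : α) :
    Internal M (f a) :=
  (Internal.of_mem (S := {p : α × β | p.2 = f p.1}) hf (a := (a, f a)) rfl).snd

instance [ZFModel M] [Rep M α] [Rep M β] [Tot M α] : Rep M (α → β) where
  unique h h' := Rep.unique (isCode_fun.1 h) (isCode_fun.1 h')
  inj {f g m} h h' := by
    have := Rep.inj (isCode_fun.1 h) (isCode_fun.1 h')
    funext a
    have h1 : (a, f a) ∈ {p : α × β | p.2 = g p.1} := this ▸ rfl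
    exact h1
  range := by
    have : D1 fun m : M => (∃ S : Set (α × β), IsCode S m) ∧
        ∀ s, (∃ a : α, IsCode a s) → ∃ t, (∃ p, IsOPair p s t ∧ p ∈ m) ∧
          ∀ t', (∃ p, IsOPair p s t' ∧ p ∈ m) → t' = t := by
      unfold D1
      exact (Rep.range_at (Set (α × β)) _).and (RDef.all ((Rep.range_at α _).imp (RDef.ex
        ((RDef.ex ((RDef.opair _ _ _).and (RDef.mem _ _))).and (RDef.all
          ((RDef.ex ((RDef.opair _ _ _).and (RDef.mem _ _))).imp (RDef.eq _ _)))))))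
    refine this.of_iff fun m => ?_
    constructor
    -- Every element of `α` has a code, so a coded relation that is total and single-valued on codes
    -- is the graph of an actual function.
    · rintro ⟨⟨S, hS⟩, h⟩
      have key : ∀ a : α, ∃! b : β, (a, b) ∈ S := by
        intro a
        obtain ⟨s, hs⟩ := internal (M := M) a
        obtain ⟨t, ⟨p, hp, hpm⟩, huniq⟩ := h s ⟨a, hs⟩
        obtain ⟨⟨a', b⟩, hab, s', t', hs', ht', hp'⟩ := hS.2 p hpm
        obtain ⟨rfl, rfl⟩ := hp.inj hp'
        obtain rfl := Rep.inj hs hs'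
        refine ⟨b, hab, fun b' hb' => ?_⟩
        obtain ⟨p', hpm', s'', t'', hs'', ht'', hp''⟩ := hS.1 _ hb'
        obtain rfl := Rep.unique hs'' hs
        obtain rfl := huniq t'' ⟨p', hp'', hpm'⟩
        exact Rep.inj ht'' ht'
      choose f hf hu using key
      refine ⟨f, ?_⟩
      rw [isCode_fun]
      convert! hS using 1
      ext ⟨a, b⟩
      exact ⟨fun h => (show b = f a from h) ▸ hf a, fun h => hu a b h⟩
    · rintro ⟨f, hf⟩
      rw [isCode_fun] at hf
      refine ⟨⟨_, hf⟩, ?_⟩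
      rintro s ⟨a, ha⟩
      obtain ⟨p, hpm, s', t, hs, ht, hp⟩ := hf.1 (a, f a) rfl
      obtain rfl := Rep.unique hs ha
      refine ⟨t, ⟨p, hp, hpm⟩, ?_⟩
      rintro t' ⟨p', hp', hpm'⟩
      obtain ⟨⟨a', b⟩, hab, s', t', hs', ht', hp''⟩ := hf.2 p' hpm'
      obtain ⟨rfl, rfl⟩ := hp''.inj hp'
      obtain rfl := Rep.inj hs' hs
      obtain rfl : b = f a' := hab
      exact Rep.unique ht' ht

instance [ZFModel M] [Rep M α] [Rep M β] [Tot M α] [Sm M α] [Sm M β] : Sm M (α → β) := by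
  obtain ⟨A, hA⟩ := Sm.exists_set (M := M) (α := Set (α × β))
  exact Sm.of_bound A fun f m h => (hA m).2 ⟨_, h⟩

instance {K : Type*} [Coded M K] (a b : K) [ZFModel M] [Tot M K] :
    Tot M (QuadraticAlgebra K a b) :=
  ⟨fun z => internal (M := M) (z.re, z.im)⟩

instance {K : Type*} [Coded M K] (a b : K) [ZFModel M] [Rep M K] :
    Rep M (QuadraticAlgebra K a b) where
  unique h h' := Rep.unique (isCode_quadratic.1 h) (isCode_quadratic.1 h')
  inj h h' := by
    have := Rep.inj (isCode_quadratic.1 h) (isCode_quadratic.1 h')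
    exact QuadraticAlgebra.ext (congrArg Prod.fst this) (congrArg Prod.snd this)
  range := (Rep.range (M := M) (α := K × K)).of_iff fun m =>
    ⟨fun ⟨p, hp⟩ => ⟨⟨p.1, p.2⟩, hp⟩, fun ⟨z, hz⟩ => ⟨(z.re, z.im), hz⟩⟩

instance {K : Type*} [Coded M K] (a b : K) [ZFModel M] [Rep M K] [Sm M K] :
    Sm M (QuadraticAlgebra K a b) := by
  obtain ⟨A, hA⟩ := Sm.exists_set (M := M) (α := K × K)
  exact Sm.of_bound A fun f m h => (hA m).2 ⟨_, h⟩

end Instances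

/-! ### Closure properties of definable maps -/

section

variable {M : Type u} [Membership M M] [ZFModel M] {α β γ δ : Type*} [Coded M α] [Coded M β]
  [Coded M γ] [Coded M δ]

namespace Def

theorem graph_at {f : α → β} (hf : Def M f) {ι : Type} (i j : ι) :
    RDef fun v : ι → M => ∃ a, IsCode a (v i) ∧ IsCode (f a) (v j) :=
  hf.graph.at i j

theorem d1 {P : α → Prop} (hP : Def M P) : D1 fun m : M => ∃ a, IsCode a m ∧ P a := by
  have : D1 fun m : M => ∃ t : M, (∃ a, IsCode a m ∧ IsCode (P a) t) ∧ ∃ x : M, x ∈ t := by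
    unfold D1
    exact RDef.ex ((hP.graph_at _ _).and (RDef.ex (RDef.mem _ _)))
  refine this.of_iff fun m => ?_
  constructor
  · rintro ⟨t, ⟨a, ha, hat⟩, x, hx⟩
    exact ⟨a, ha, ((hat x).1 hx).1⟩
  · rintro ⟨a, ha, hPa⟩
    obtain ⟨t, ht⟩ := Tot.internal (M := M) (P a)
    obtain ⟨e, he⟩ := exists_empty (M := M)
    exact ⟨t, ⟨a, ha, ht⟩, e, (ht e).2 ⟨hPa, he⟩⟩

theorem d1_at {P : α → Prop} (hP : Def M P) {ι : Type} (i : ι) :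
    RDef fun v : ι → M => ∃ a, IsCode a (v i) ∧ P a :=
  hP.d1.at i

theorem of_d1 [Rep M α] {P : α → Prop} (h : D1 fun m : M => ∃ a, IsCode a m ∧ P a) : Def M P where
  internal _ _ := Tot.internal _
  graph := by
    have : D2 fun s t : M => (∃ a : α, IsCode a s) ∧
        ∀ x, x ∈ t ↔ (∃ a, IsCode a s ∧ P a) ∧ ∀ y, y ∉ x := by
      unfold D2
      exact (Rep.range_at α _).and (RDef.all ((RDef.mem _ _).iff
        ((D1.at h _).and (RDef.all (RDef.mem _ _).not))))
    refine this.of_iff fun s t => ?_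
    constructor
    · rintro ⟨⟨a, ha⟩, h⟩
      refine ⟨a, ha, fun x => (h x).trans (and_congr_left fun _ => ⟨?_, fun h => ⟨a, ha, h⟩⟩)⟩
      rintro ⟨b, hb, hPb⟩
      rwa [Rep.inj ha hb]
    · rintro ⟨a, ha, h⟩
      refine ⟨⟨a, ha⟩, fun x => ((h x).trans (and_congr_left fun _ => ⟨fun h => ⟨a, ha, h⟩, ?_⟩))⟩
      rintro ⟨b, hb, hPb⟩
      rwa [Rep.inj ha hb]

/-- Definability of a predicate from that of the corresponding class of codes. -/
theorem of_d1' [Rep M α] {P : α → Prop} {C : M → Prop} (h : D1 C)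
    (h' : ∀ a m, IsCode a m → (P a ↔ C m)) : Def M P := by
  refine of_d1 (D1.of_iff (C := fun m => (∃ a : α, IsCode a m) ∧ C m)
    ((Rep.range_at α _).and (h.at _)) fun m => ?_)
  constructor
  · rintro ⟨⟨a, ha⟩, hC⟩
    exact ⟨a, ha, (h' a m ha).2 hC⟩
  · rintro ⟨a, ha, hP⟩
    exact ⟨⟨a, ha⟩, (h' a m ha).1 hP⟩

/-- Definability of a function from that of the corresponding relation between codes. -/
theorem of_d2' [Rep M α] {f : α → β} {G : M → M → Prop} (h : D2 G)
    (hi : ∀ a, Internal M a → Internal M (f a))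
    (h' : ∀ a s t, IsCode a s → (IsCode (f a) t ↔ G s t)) : Def M f := by
  refine ⟨hi, D2.of_iff (C := fun s t => (∃ a : α, IsCode a s) ∧ G s t)
    ((Rep.range_at α _).and (h.at _ _)) fun s t => ?_⟩
  constructor
  · rintro ⟨⟨a, ha⟩, hG⟩
    exact ⟨a, ha, (h' a s t ha).2 hG⟩
  · rintro ⟨a, ha, hf⟩
    exact ⟨⟨a, ha⟩, (h' a s t ha).1 hf⟩

@[fun_prop]
theorem id [Rep M α] : Def M fun a : α => a :=
  of_d2' (G := fun s t => t = s) (RDef.eq _ _) (fun _ h => h) fun a s t hs =>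
    ⟨fun ht => Rep.unique ht hs, fun h => h ▸ hs⟩

@[fun_prop]
theorem const [Rep M α] [Rep M β] (c : β) [IsInt M c] : Def M fun _ : α => c := by
  obtain ⟨m, hm⟩ := IsInt.internal (M := M) c
  exact of_d2' (G := fun s t => t = m) (RDef.eq_const _ _) (fun _ _ => IsInt.internal c)
    fun a s t hs => ⟨fun ht => Rep.unique ht hm, fun h => h ▸ hm⟩

@[fun_prop]
theorem comp [Rep M α] [Rep M β] {g : β → γ} {f : α → β} (hg : Def M g) (hf : Def M f) :
    Def M fun a => g (f a) :=
  of_d2' (G := fun s t => ∃ u, (∃ a, IsCode a s ∧ IsCode (f a) u) ∧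
      ∃ b, IsCode b u ∧ IsCode (g b) t)
    (RDef.ex ((hf.graph_at _ _).and (hg.graph_at _ _)))
    (fun a ha => hg.internal _ (hf.internal _ ha)) fun a s t hs => by
      constructor
      · intro ht
        obtain ⟨u, hu⟩ := hf.internal a ⟨s, hs⟩
        exact ⟨u, ⟨a, hs, hu⟩, f a, hu, ht⟩
      · rintro ⟨u, ⟨a', ha', hu⟩, b, hb, ht⟩
        obtain rfl := Rep.inj hs ha'
        obtain rfl := Rep.inj hu hb
        exact ht

@[fun_prop]
theorem prodMk [Rep M α] {f : α → β} {g : α → γ} (hf : Def M f) (hg : Def M g) :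
    Def M fun a => (f a, g a) :=
  of_d2' (G := fun s t => ∃ u w, (∃ a, IsCode a s ∧ IsCode (f a) u) ∧
      (∃ a, IsCode a s ∧ IsCode (g a) w) ∧ IsOPair t u w)
    (RDef.ex (RDef.ex ((hf.graph_at _ _).and ((hg.graph_at _ _).and (RDef.opair _ _ _)))))
    (fun a ha => internal_prodMk (hf.internal _ ha) (hg.internal _ ha)) fun a s t hs => by
      constructor
      · rintro ⟨u, w, hu, hw, h⟩
        exact ⟨u, w, ⟨a, hs, hu⟩, ⟨a, hs, hw⟩, h⟩
      · rintro ⟨u, w, ⟨a', ha', hu⟩, ⟨a'', ha'', hw⟩, h⟩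
        obtain rfl := Rep.inj hs ha'
        obtain rfl := Rep.inj hs ha''
        exact ⟨u, w, hu, hw, h⟩

theorem fst' [Rep M α] [Rep M β] : Def M (Prod.fst : α × β → α) :=
  of_d2' (G := fun s t => ∃ w, IsOPair s t w) (RDef.ex (RDef.opair _ _ _))
    (fun _ h => h.fst) fun p s t hs => by
      obtain ⟨u, w, hu, hw, h⟩ := hs
      constructor
      · intro ht
        exact ⟨w, Rep.unique hu ht ▸ h⟩
      · rintro ⟨w', h'⟩
        rwa [← (h.inj h').1]

theorem snd' [Rep M α] [Rep M β] : Def M (Prod.snd : α × β → β) :=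
  of_d2' (G := fun s t => ∃ w, IsOPair s w t) (RDef.ex (RDef.opair _ _ _))
    (fun _ h => h.snd) fun p s t hs => by
      obtain ⟨u, w, hu, hw, h⟩ := hs
      constructor
      · intro ht
        exact ⟨u, Rep.unique hw ht ▸ h⟩
      · rintro ⟨w', h'⟩
        rwa [← (h.inj h').2]

@[fun_prop]
theorem fst [Rep M α] [Rep M β] [Rep M γ] {f : α → β × γ} (hf : Def M f) :
    Def M fun a => (f a).1 := fst'.comp hf

@[fun_prop]
theorem snd [Rep M α] [Rep M β] [Rep M γ] {f : α → β × γ} (hf : Def M f) :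
    Def M fun a => (f a).2 := snd'.comp hf

@[fun_prop]
theorem and [Rep M α] {P Q : α → Prop} (hP : Def M P) (hQ : Def M Q) : Def M fun a => P a ∧ Q a :=
  of_d1' (C := fun m => (∃ a, IsCode a m ∧ P a) ∧ ∃ a, IsCode a m ∧ Q a)
    ((hP.d1_at _).and (hQ.d1_at _)) fun a m ha => by
      constructor
      · exact fun h => ⟨⟨a, ha, h.1⟩, a, ha, h.2⟩
      · rintro ⟨⟨b, hb, h⟩, c, hc, h'⟩
        obtain rfl := Rep.inj ha hb
        obtain rfl := Rep.inj ha hc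
        exact ⟨h, h'⟩

@[fun_prop]
theorem not [Rep M α] {P : α → Prop} (hP : Def M P) : Def M fun a => ¬ P a :=
  of_d1' (C := fun m => ¬ ∃ a, IsCode a m ∧ P a) (hP.d1_at _).not fun a m ha => by
    refine not_congr ⟨fun h => ⟨a, ha, h⟩, ?_⟩
    rintro ⟨b, hb, h⟩
    rwa [Rep.inj ha hb]

theorem of_iff {P Q : α → Prop} (hP : Def M P) (h : ∀ a, Q a ↔ P a) : Def M Q := by
  have : P = Q := funext fun a => propext (h a).symm
  exact this ▸ hP

theorem congr {f g : α → β} (hf : Def M f) (h : ∀ a, g a = f a) : Def M g := by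
  have : f = g := funext fun a => (h a).symm
  exact this ▸ hf

@[fun_prop]
theorem or [Rep M α] {P Q : α → Prop} (hP : Def M P) (hQ : Def M Q) : Def M fun a => P a ∨ Q a :=
  (hP.not.and hQ.not).not.of_iff fun _ => or_iff_not_and_not

@[fun_prop]
theorem imp [Rep M α] {P Q : α → Prop} (hP : Def M P) (hQ : Def M Q) : Def M fun a => P a → Q a :=
  (hP.not.or hQ).of_iff fun _ => imp_iff_not_or

@[fun_prop]
theorem iff [Rep M α] {P Q : α → Prop} (hP : Def M P) (hQ : Def M Q) : Def M fun a => (P a ↔ Q a) :=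
  ((hP.imp hQ).and (hQ.imp hP)).of_iff fun _ => iff_iff_implies_and_implies

/-- A quantifier of the model ranges over codes only, so it expresses `∃ b` provided that all
witnesses are objects of the model. -/
theorem exists_of_internal [Rep M α] [Rep M β] {P : α → β → Prop}
    (hP : Def M fun p : α × β => P p.1 p.2) (h : ∀ a b, P a b → Internal M b) :
    Def M fun a => ∃ b, P a b :=
  of_d1' (C := fun m => ∃ p t, IsOPair p m t ∧ ∃ q : α × β, IsCode q p ∧ P q.1 q.2)
    (RDef.ex (RDef.ex ((RDef.opair _ _ _).and (hP.d1_at _)))) fun a m ha => by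
      constructor
      · rintro ⟨b, hb⟩
        obtain ⟨t, ht⟩ := h a b hb
        obtain ⟨p, hp⟩ := exists_opair m t
        exact ⟨p, t, hp, (a, b), ⟨m, t, ha, ht, hp⟩, hb⟩
      · rintro ⟨p, t, hp, ⟨a', b⟩, ⟨m', t', ha', ht', hp'⟩, hb⟩
        obtain ⟨rfl, rfl⟩ := hp.inj hp'
        obtain rfl := Rep.inj ha ha'
        exact ⟨b, hb⟩

@[fun_prop]
theorem exists' [Rep M α] [Rep M β] [Tot M β] {P : α → β → Prop}
    (hP : Def M fun p : α × β => P p.1 p.2) : Def M fun a => ∃ b, P a b :=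
  exists_of_internal hP fun _ b _ => Tot.internal b

@[fun_prop]
theorem forall' [Rep M α] [Rep M β] [Tot M β] {P : α → β → Prop}
    (hP : Def M fun p : α × β => P p.1 p.2) : Def M fun a => ∀ b, P a b :=
  (exists' (P := fun a b => ¬ P a b) hP.not).not.of_iff fun _ => not_exists_not.symm

-- Since `f` preserves objects of the model, the predicate is constantly true on coded arguments.
@[fun_prop]
theorem internal' [Rep M α] [Rep M β] {f : α → β} (hf : Def M f) :
    Def M fun a => Internal M (f a) :=
  of_d1' (C := fun m => m = m) (RDef.eq _ _) fun a m ha => by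
    simp [hf.internal a ⟨m, ha⟩]

@[fun_prop]
theorem exists_internal [Rep M α] [Rep M β] {P : α → β → Prop}
    (hP : Def M fun p : α × β => P p.1 p.2) : Def M fun a => ∃ b, Internal M b ∧ P a b :=
  exists_of_internal (P := fun a b => Internal M b ∧ P a b)
    ((internal' snd').and hP) fun _ _ h => h.1

@[fun_prop]
theorem forall_internal [Rep M α] [Rep M β] {P : α → β → Prop}
    (hP : Def M fun p : α × β => P p.1 p.2) : Def M fun a => ∀ b, Internal M b → P a b :=
  (exists_internal (P := fun a b => ¬ P a b) hP.not).not.of_iff fun _ => by simp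

@[fun_prop]
theorem eq [Rep M α] [Rep M β] {f g : α → β} (hf : Def M f) (hg : Def M g) :
    Def M fun a => f a = g a :=
  of_d1' (C := fun m => ∃ u, (∃ a, IsCode a m ∧ IsCode (f a) u) ∧ (∃ a, IsCode a m ∧ IsCode (g a) u))
    (RDef.ex ((hf.graph_at _ _).and (hg.graph_at _ _))) fun a m ha => by
      constructor
      · intro h
        obtain ⟨u, hu⟩ := hf.internal a ⟨m, ha⟩
        exact ⟨u, ⟨a, ha, hu⟩, a, ha, h ▸ hu⟩
      · rintro ⟨u, ⟨b, hb, hu⟩, c, hc, hu'⟩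
        obtain rfl := Rep.inj ha hb
        obtain rfl := Rep.inj ha hc
        exact Rep.inj hu hu'

@[fun_prop]
theorem ne [Rep M α] [Rep M β] {f g : α → β} (hf : Def M f) (hg : Def M g) :
    Def M fun a => f a ≠ g a := (hf.eq hg).not

@[fun_prop]
theorem mem [Rep M α] [Rep M β] {f : α → β} {g : α → Set β} (hf : Def M f) (hg : Def M g) :
    Def M fun a => f a ∈ g a :=
  of_d1' (C := fun m => ∃ u w, (∃ a, IsCode a m ∧ IsCode (f a) u) ∧
      (∃ a, IsCode a m ∧ IsCode (g a) w) ∧ u ∈ w)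
    (RDef.ex (RDef.ex ((hf.graph_at _ _).and ((hg.graph_at _ _).and (RDef.mem _ _)))))
    fun a m ha => by
      constructor
      · intro h
        obtain ⟨u, hu⟩ := hf.internal a ⟨m, ha⟩
        obtain ⟨w, hw⟩ := hg.internal a ⟨m, ha⟩
        exact ⟨u, w, ⟨a, ha, hu⟩, ⟨a, ha, hw⟩, (mem_iff_of_isCode hu hw).1 h⟩
      · rintro ⟨u, w, ⟨b, hb, hu⟩, ⟨c, hc, hw⟩, huw⟩
        obtain rfl := Rep.inj ha hb
        obtain rfl := Rep.inj ha hc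
        exact (mem_iff_of_isCode hu hw).2 huw

/-- Membership between elements of the model. -/
@[fun_prop]
theorem mem_self [Rep M α] {f g : α → M} (hf : Def M f) (hg : Def M g) :
    Def M fun a => f a ∈ g a :=
  of_d1' (C := fun m => ∃ u w, (∃ a, IsCode a m ∧ IsCode (f a) u) ∧
      (∃ a, IsCode a m ∧ IsCode (g a) w) ∧ u ∈ w)
    (RDef.ex (RDef.ex ((hf.graph_at _ _).and ((hg.graph_at _ _).and (RDef.mem _ _)))))
    fun a m ha => by
      constructor
      · exact fun h => ⟨f a, g a, ⟨a, ha, rfl⟩, ⟨a, ha, rfl⟩, h⟩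
      · rintro ⟨u, w, ⟨b, hb, hu⟩, ⟨c, hc, hw⟩, huw⟩
        obtain rfl := Rep.inj ha hb
        obtain rfl := Rep.inj ha hc
        rw [isCode_self] at hu hw
        rwa [← hu, ← hw]

/-- Definability sees only arguments that have a code, so the equivalence is needed for these alone.
-/
theorem of_iff_internal {P Q : α → Prop} (hP : Def M P) (h : ∀ a, Internal M a → (Q a ↔ P a)) :
    Def M Q := by
  refine ⟨fun a _ => Tot.internal _, hP.graph.of_iff fun s t => exists_congr fun a => ?_⟩
  refine and_congr_right fun ha => ?_
  rw [h a ⟨s, ha⟩]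

@[fun_prop]
theorem exists_mem [Rep M α] [Rep M β] {S : α → Set β} {P : α → β → Prop} (hS : Def M S)
    (hP : Def M fun p : α × β => P p.1 p.2) : Def M fun a => ∃ b, b ∈ S a ∧ P a b :=
  (exists_internal (P := fun a b => b ∈ S a ∧ P a b)
    ((mem snd' (hS.comp fst')).and hP)).of_iff_internal fun a ha =>
      exists_congr fun _ => ⟨fun h => ⟨(hS.internal a ha).of_mem h.1, h⟩, fun h => h.2⟩

@[fun_prop]
theorem forall_mem [Rep M α] [Rep M β] {S : α → Set β} {P : α → β → Prop} (hS : Def M S)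
    (hP : Def M fun p : α × β => P p.1 p.2) : Def M fun a => ∀ b, b ∈ S a → P a b :=
  (exists_mem (P := fun a b => ¬ P a b) hS hP.not).not.of_iff fun _ => by simp

/-- Comprehension with a parameter: the codes of elements of `β` form a set of the model, and
separation cuts out those related to `a`. The members must be internal because a coded set has only
coded elements. -/
theorem ofPred_of_internal [Rep M α] [Rep M β] [Sm M β] {P : α → β → Prop}
    (hP : Def M fun p : α × β => P p.1 p.2)
    (h : ∀ a, Internal M a → ∀ b, P a b → Internal M b) : Def M fun a => {b | P a b} := by
  have key : ∀ (a : α) (s : M), IsCode a s → ∀ (b : β) (u : M), IsCode b u →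
      (P a b ↔ ∃ p, IsOPair p s u ∧ ∃ q : α × β, IsCode q p ∧ P q.1 q.2) := by
    intro a s ha b u hb
    constructor
    · intro h
      obtain ⟨p, hp⟩ := exists_opair s u
      exact ⟨p, hp, (a, b), ⟨s, u, ha, hb, hp⟩, h⟩
    · rintro ⟨p, hp, ⟨a', b'⟩, ⟨s', u', hs', hu', hp'⟩, h⟩
      obtain ⟨rfl, rfl⟩ := hp.inj hp'
      obtain rfl := Rep.inj ha hs'
      obtain rfl := Rep.inj hb hu'
      exact h
  have code : ∀ (a : α) (s t : M), IsCode a s → (IsCode {b | P a b} t ↔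
      ∀ u, u ∈ t ↔ ∃ p, IsOPair p s u ∧ ∃ q : α × β, IsCode q p ∧ P q.1 q.2) := by
    intro a s t ha
    rw [isCode_set_iff]
    have h1 : ∀ u, (∃ b ∈ {b | P a b}, IsCode b u) ↔
        ∃ p, IsOPair p s u ∧ ∃ q : α × β, IsCode q p ∧ P q.1 q.2 := by
      intro u
      constructor
      · rintro ⟨b, hb, hu⟩
        exact (key a s ha b u hu).1 hb
      · rintro ⟨p, hp, ⟨a', b'⟩, ⟨s', u', hs', hu', hp'⟩, h⟩
        obtain ⟨rfl, rfl⟩ := hp.inj hp'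
        obtain rfl := Rep.inj ha hs'
        exact ⟨b', h, hu'⟩
    simp only [h1]
    exact and_iff_right (h a ⟨s, ha⟩)
  refine of_d2' (G := fun s t => ∀ u, u ∈ t ↔
    ∃ p, IsOPair p s u ∧ ∃ q : α × β, IsCode q p ∧ P q.1 q.2)
    (RDef.all ((RDef.mem _ _).iff (RDef.ex ((RDef.opair _ _ _).and (hP.d1_at _))))) ?_ code
  rintro a ⟨s, hs⟩
  obtain ⟨A, hA⟩ := Sm.exists_set (M := M) (α := β)
  -- The parameter `s` enters through an equation with a constant, which turns the binary relation
  -- into a definable class.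
  have hd : D1 fun u : M => ∃ s', s' = s ∧
      ∃ p, IsOPair p s' u ∧ ∃ q : α × β, IsCode q p ∧ P q.1 q.2 :=
    RDef.ex ((RDef.eq_const _ _).and (RDef.ex ((RDef.opair _ _ _).and (hP.d1_at _))))
  obtain ⟨t, ht⟩ := sep hd A
  refine ⟨t, (code a s t hs).2 fun u => (ht u).trans ?_⟩
  simp only [exists_eq_left]
  refine and_iff_right_of_imp ?_
  rintro ⟨p, hp, ⟨a', b'⟩, ⟨s', u', hs', hu', hp'⟩, -⟩
  obtain ⟨rfl, rfl⟩ := hp.inj hp'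
  exact (hA u).2 ⟨b', hu'⟩

@[fun_prop]
theorem ofPred [Rep M α] [Rep M β] [Tot M β] [Sm M β] {P : α → β → Prop}
    (hP : Def M fun p : α × β => P p.1 p.2) : Def M fun a => {b | P a b} :=
  ofPred_of_internal hP fun _ _ b _ => Tot.internal b

@[fun_prop]
theorem ofPred_internal [Rep M α] [Rep M β] [Sm M β] {P : α → β → Prop}
    (hP : Def M fun p : α × β => P p.1 p.2) : Def M fun a => {b | Internal M b ∧ P a b} :=
  ofPred_of_internal (P := fun a b => Internal M b ∧ P a b) (by fun_prop) fun _ _ _ h => h.1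

@[fun_prop]
theorem ofPred_mem [Rep M α] [Rep M β] [Sm M β] {S : α → Set β} {P : α → β → Prop}
    (hS : Def M S) (hP : Def M fun p : α × β => P p.1 p.2) :
    Def M fun a => {b | b ∈ S a ∧ P a b} :=
  ofPred_of_internal (P := fun a b => b ∈ S a ∧ P a b) (by fun_prop)
    fun a ha _ h => (hS.internal a ha).of_mem h.1

@[fun_prop]
theorem insert [Rep M α] [Rep M β] [Sm M β] {f : α → β} {S : α → Set β} (hf : Def M f)
    (hS : Def M S) : Def M fun a => insert (f a) (S a) :=
  ofPred_of_internal (P := fun a b => b = f a ∨ b ∈ S a) (by fun_prop) fun a ha b h => by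
    rcases h with rfl | h
    exacts [hf.internal a ha, (hS.internal a ha).of_mem h]

@[fun_prop]
theorem singleton [Rep M α] [Rep M β] [Sm M β] {f : α → β} (hf : Def M f) :
    Def M fun a => ({f a} : Set β) :=
  ofPred_of_internal (P := fun a b => b = f a) (by fun_prop) fun a ha b h => by
    rw [h]
    exact hf.internal a ha

@[fun_prop]
theorem union [Rep M α] [Rep M β] [Sm M β] {S T : α → Set β} (hS : Def M S) (hT : Def M T) :
    Def M fun a => S a ∪ T a :=
  ofPred_of_internal (P := fun a b => b ∈ S a ∨ b ∈ T a) (by fun_prop) fun a ha b h => by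
    rcases h with h | h
    exacts [(hS.internal a ha).of_mem h, (hT.internal a ha).of_mem h]

@[fun_prop]
theorem inter [Rep M α] [Rep M β] [Sm M β] {S T : α → Set β} (hS : Def M S) (hT : Def M T) :
    Def M fun a => S a ∩ T a :=
  ofPred_mem hS (P := fun a b => b ∈ T a) (by fun_prop)

@[fun_prop]
theorem sdiff [Rep M α] [Rep M β] [Sm M β] {S T : α → Set β} (hS : Def M S) (hT : Def M T) :
    Def M fun a => S a \ T a :=
  ofPred_mem hS (P := fun a b => b ∉ T a) (by fun_prop)

@[fun_prop]
theorem compl [Rep M α] [Rep M β] [Tot M β] [Sm M β] {S : α → Set β} (hS : Def M S) :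
    Def M fun a => (S a)ᶜ :=
  ofPred (P := fun a b => b ∉ S a) (by fun_prop)

@[fun_prop]
theorem subset [Rep M α] [Rep M β] {S T : α → Set β} (hS : Def M S) (hT : Def M T) :
    Def M fun a => S a ⊆ T a :=
  forall_mem hS (P := fun a b => b ∈ T a) (by fun_prop)

theorem isInt_const [Rep M α] [Rep M β] {f : α → β} (hf : Def M f) (a : α) [IsInt M a] :
    IsInt M (f a) := ⟨hf.internal a (IsInt.internal a)⟩

/-- Separation without a parameter: the set is the value of a constant definable map, evaluated at
the dummy argument `True`. -/
theorem isInt_ofPred [Rep M β] [Tot M β] [Sm M β] {P : β → Prop} (hP : Def M P) :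
    IsInt M {b | P b} :=
  isInt_const (f := fun p : Prop => {b | P b}) (ofPred (P := fun _ b => P b) (hP.comp snd')) True

theorem isInt_set [Rep M β] [Tot M β] [Sm M β] {S : Set β} (hS : Def M fun b => b ∈ S) :
    IsInt M S := isInt_ofPred hS

theorem val' [Rep M α] {p : α → Prop} [Rep M (Subtype p)] :
    Def M (Subtype.val : Subtype p → α) :=
  of_d2' (G := fun s t => t = s) (RDef.eq _ _) (fun _ h => h) fun a s t hs =>
    ⟨fun ht => Rep.unique ht (isCode_subtype.1 hs), fun h => h ▸ hs⟩

@[fun_prop]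
theorem val [Rep M α] [Rep M β] {p : β → Prop} [Rep M (Subtype p)] {f : α → Subtype p}
    (hf : Def M f) : Def M fun a => (f a).1 := val'.comp hf

theorem of_val {p : β → Prop} {f : α → Subtype p} (hf : Def M fun a => (f a).1) : Def M f :=
  ⟨hf.internal, hf.graph⟩

theorem lam [Rep M α] [Rep M β] [Tot M β] [Sm M β] [Rep M γ] [Sm M γ] {f : α → β → γ}
    (hf : Def M fun p : α × β => f p.1 p.2) : Def M fun a => fun b => f a b := by
  have h1 : Def M fun a => {p : β × γ | p.2 = f a p.1} :=
    ofPred_of_internal (P := fun a (p : β × γ) => p.2 = f a p.1) (by fun_prop) fun a ha p hp => by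
      have := hf.internal (a, p.1) (internal_prodMk ha (Tot.internal _))
      rw [← hp] at this
      exact internal_prodMk (Tot.internal _) this
  exact ⟨h1.internal, h1.graph⟩

/-- Evaluation when both the function and its argument vary: `t` codes the value exactly if the pair
of the argument's code and `t` belongs to the code of the graph. -/
theorem app [Rep M α] [Rep M β] [Tot M β] [Rep M γ] {f : α → β → γ} {g : α → β} (hf : Def M f)
    (hg : Def M g) : Def M fun a => f a (g a) := by
  have h1 : Def M fun a => {p : β × γ | p.2 = f a p.1} := ⟨hf.internal, hf.graph⟩
  refine of_d2' (G := fun s t => ∃ w, (∃ a, IsCode a s ∧ IsCode {p : β × γ | p.2 = f a p.1} w) ∧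
    ∃ u, (∃ a, IsCode a s ∧ IsCode (g a) u) ∧ ∃ p, IsOPair p u t ∧ p ∈ w)
    (RDef.ex ((h1.graph_at _ _).and (RDef.ex ((hg.graph_at _ _).and (RDef.ex
      ((RDef.opair _ _ _).and (RDef.mem _ _)))))))
    (fun a ha => (hf.internal a ha).apply _) fun a s t hs => ?_
  constructor
  · intro ht
    obtain ⟨w, hw⟩ := h1.internal a ⟨s, hs⟩
    obtain ⟨u, hu⟩ := hg.internal a ⟨s, hs⟩
    obtain ⟨p, hp⟩ := exists_opair u t
    refine ⟨w, ⟨a, hs, hw⟩, u, ⟨a, hs, hu⟩, p, hp, ?_⟩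
    have hc : IsCode (g a, f a (g a)) p := ⟨u, t, hu, ht, hp⟩
    exact (mem_iff_of_isCode hc hw).1 rfl
  · rintro ⟨w, ⟨b, hb, hw⟩, u, ⟨c, hc, hu⟩, p, hp, hpw⟩
    obtain rfl := Rep.inj hs hb
    obtain rfl := Rep.inj hs hc
    obtain ⟨⟨b, d⟩, hbd, u', t', hu', ht', hp'⟩ := hw.2 p hpw
    obtain ⟨rfl, rfl⟩ := hp.inj hp'
    obtain rfl := Rep.inj hu hu'
    obtain rfl : d = f a (g a) := hbd
    exact ht'

@[fun_prop]
theorem fst_app [Rep M α] [Rep M β] [Tot M β] [Rep M γ] [Rep M δ] {f : α → (β → γ) × δ} {g : α → β}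
    (hf : Def M f) (hg : Def M g) : Def M fun a => (f a).1 (g a) := hf.fst.app hg

@[fun_prop]
theorem snd_app [Rep M α] [Rep M β] [Tot M β] [Rep M γ] [Rep M δ] {f : α → δ × (β → γ)} {g : α → β}
    (hf : Def M f) (hg : Def M g) : Def M fun a => (f a).2 (g a) := hf.snd.app hg

@[fun_prop]
theorem val_app [Rep M α] [Rep M β] [Tot M β] [Rep M γ] {p : (β → γ) → Prop} [Rep M (Subtype p)]
    {f : α → Subtype p} {g : α → β}
    (hf : Def M f) (hg : Def M g) : Def M fun a => (f a).1 (g a) := hf.val.app hg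

theorem of_isInt [Rep M α] [Rep M β] [Tot M α] {f : α → β} (hf : IsInt M f) : Def M f :=
  app (const f) id

/-- The converse of `of_isInt` when domain and codomain are sets of the model: the graph is then a
set by separation. -/
theorem isInt [Rep M α] [Rep M β] [Tot M α] [Sm M α] [Sm M β] {f : α → β} (hf : Def M f) :
    IsInt M f :=
  isInt_const (f := fun _ : Prop => f) (lam (f := fun _ b => f b) (hf.comp snd')) True

theorem of_graph [Rep M α] [Rep M β] [Tot M β] {f : α → β}
    (h : Def M fun p : α × β => p.2 = f p.1) : Def M f :=
  of_d2' (G := fun s t => ∃ p, IsOPair p s t ∧ ∃ q : α × β, IsCode q p ∧ q.2 = f q.1)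
    (RDef.ex ((RDef.opair _ _ _).and (h.d1_at _))) (fun _ _ => Tot.internal _) fun a s t hs => by
      constructor
      · intro ht
        obtain ⟨p, hp⟩ := exists_opair s t
        exact ⟨p, hp, (a, f a), ⟨s, t, hs, ht, hp⟩, rfl⟩
      · rintro ⟨p, hp, ⟨a', b⟩, ⟨s', t', hs', ht', hp'⟩, h⟩
        obtain ⟨rfl, rfl⟩ := hp.inj hp'
        obtain rfl := Rep.inj hs hs'
        obtain rfl : b = f a := h
        exact ht'

section Quadratic

variable {K : Type*} [Coded M K] [Rep M K] {a b : K} [Rep M α]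

@[fun_prop]
theorem quadMk {f g : α → K} (hf : Def M f) (hg : Def M g) :
    Def M fun x => (⟨f x, g x⟩ : QuadraticAlgebra K a b) :=
  ⟨(hf.prodMk hg).internal, (hf.prodMk hg).graph⟩

theorem quadPair : Def M fun z : QuadraticAlgebra K a b => (z.re, z.im) :=
  of_d2' (G := fun s t => t = s) (RDef.eq _ _) (fun _ h => h) fun a s t hs =>
    ⟨fun ht => Rep.unique ht (isCode_quadratic.1 hs), fun h => h ▸ hs⟩

@[fun_prop]
theorem re {f : α → QuadraticAlgebra K a b} (hf : Def M f) : Def M fun x => (f x).re :=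
  (quadPair.comp hf).fst

@[fun_prop]
theorem im {f : α → QuadraticAlgebra K a b} (hf : Def M f) : Def M fun x => (f x).im :=
  (quadPair.comp hf).snd

end Quadratic

end Def

theorem rep_subtype [Rep M α] {p : α → Prop} (hp : Def M p) : Rep M (Subtype p) where
  unique h h' := Rep.unique (isCode_subtype.1 h) (isCode_subtype.1 h')
  inj h h' := Subtype.ext (Rep.inj (isCode_subtype.1 h) (isCode_subtype.1 h'))
  range := hp.d1.of_iff fun m =>
    ⟨fun ⟨a, ha, h⟩ => ⟨⟨a, h⟩, ha⟩, fun ⟨a, ha⟩ => ⟨a.1, ha, a.2⟩⟩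

instance [Rep M α] (S : Set α) [IsInt M S] : Rep M S := rep_subtype (by fun_prop)

instance [Rep M α] (S : Set α) [IsInt M S] : Tot M S :=
  ⟨fun a => (IsInt.internal (M := M) S).of_mem a.2⟩

instance [Rep M α] (S : Set α) [IsInt M S] : Sm M S := by
  obtain ⟨m, hm⟩ := IsInt.internal (M := M) S
  refine ⟨m, fun s => ⟨fun hs => ?_, ?_⟩⟩
  · obtain ⟨a, ha, has⟩ := hm.2 s hs
    exact ⟨⟨a, ha⟩, has⟩
  · rintro ⟨a, ha⟩
    exact (mem_iff_of_isCode (isCode_subtype.1 ha) hm).1 a.2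

instance (a : α) (b : β) [IsInt M a] [IsInt M b] : IsInt M (a, b) :=
  ⟨internal_prodMk (IsInt.internal a) (IsInt.internal b)⟩

instance [Rep M α] : IsInt M (∅ : Set α) := by
  obtain ⟨e, he⟩ := exists_empty (M := M)
  exact ⟨e, fun a ha => ha.elim, fun s hs => (he s hs).elim⟩

instance [Rep M α] [Tot M α] [Sm M α] : IsInt M (Set.univ : Set α) :=
  Def.isInt_set ((Def.const True).of_iff fun _ => by simp)

instance [Rep M α] [Sm M α] (S T : Set α) [IsInt M S] [IsInt M T] : IsInt M (S ∩ T) :=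
  Def.isInt_const (f := fun p : Set α × Set α => p.1 ∩ p.2) (a := (S, T)) (by fun_prop)

instance [Rep M α] [Sm M α] (S T : Set α) [IsInt M S] [IsInt M T] : IsInt M (S \ T) :=
  Def.isInt_const (f := fun p : Set α × Set α => p.1 \ p.2) (a := (S, T)) (by fun_prop)

instance [Rep M α] [Tot M α] [Sm M α] (S : Set α) [IsInt M S] : IsInt M Sᶜ :=
  Def.isInt_const (f := fun p : Set α => pᶜ) (a := S) (by fun_prop)

instance [Rep M α] [Sm M α] (a : α) (S : Set α) [IsInt M a] [IsInt M S] : IsInt M (insert a S) :=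
  Def.isInt_const (f := fun p : α × Set α => insert p.1 p.2) (a := (a, S)) (by fun_prop)

instance [Rep M α] [Sm M α] (a : α) [IsInt M a] : IsInt M ({a} : Set α) :=
  Def.isInt_const (f := fun p : α => ({p} : Set α)) (a := a) (by fun_prop)

end

/-! ### Natural numbers of the model: induction and recursion -/

section Naturals

variable {M : Type u} [Membership M M] [ZFModel M]

theorem not_mem_self (a : M) : a ∉ a := by
  obtain ⟨s, hs⟩ := exists_upair a a
  obtain ⟨x, hx, h⟩ := ZFModel.foundation s ⟨a, (hs a).2 (Or.inl rfl)⟩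
  have hxa : x = a := by rcases (hs x).1 hx with h | h <;> exact h
  subst hxa
  exact h x hx

theorem exists_omega : ∃ o : M, ∀ n, n ∈ o ↔ IsNat n := by
  obtain ⟨I, hI⟩ := ZFModel.infinity (M := M)
  -- This is `IsNat` with `IsInductive` written out, so that it is visibly first-order; it is then
  -- separated from any inductive set.
  have hC : D1 fun n : M => ∀ J : M, ((∃ e : M, e ∈ J ∧ ∀ x : M, x ∉ e) ∧
      ∀ n : M, n ∈ J → ∃ s : M, s ∈ J ∧ ∀ x : M, x ∈ s ↔ x ∈ n ∨ x = n) → n ∈ J := by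
    unfold D1
    exact RDef.all (((RDef.ex ((RDef.mem _ _).and (RDef.all (RDef.mem _ _).not))).and
      (RDef.all ((RDef.mem _ _).imp (RDef.ex ((RDef.mem _ _).and (RDef.all ((RDef.mem _ _).iff
        ((RDef.mem _ _).or (RDef.eq _ _))))))))).imp (RDef.mem _ _))
  obtain ⟨o, ho⟩ := sep hC I
  refine ⟨o, fun n => (ho n).trans ⟨fun h => h.2, fun h => ⟨h I hI, h⟩⟩⟩

variable (M) in
/-- The set of natural numbers of the model. -/
noncomputable def omega : M := (exists_omega (M := M)).choose

theorem mem_omega {n : M} : n ∈ omega M ↔ IsNat n := (exists_omega (M := M)).choose_spec n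

variable (M) in
/-- The type of natural numbers of the model. -/
abbrev NN : Type u := El (omega M)

theorem isInductive_omega : IsInductive (omega M) := by
  constructor
  · obtain ⟨I, ⟨e, -, he⟩, -⟩ := ZFModel.infinity (M := M)
    refine ⟨e, mem_omega.2 fun J hJ => ?_, he⟩
    obtain ⟨e', he'J, he'⟩ := hJ.1
    rwa [show e = e' from ext' fun x => ⟨fun h => (he x h).elim, fun h => (he' x h).elim⟩]
  · intro n hn
    obtain ⟨I, hI⟩ := ZFModel.infinity (M := M)
    obtain ⟨s, -, hs⟩ := hI.2 n (mem_omega.1 hn I hI)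
    refine ⟨s, mem_omega.2 fun J hJ => ?_, hs⟩
    obtain ⟨s', hs'J, hs'⟩ := hJ.2 n (mem_omega.1 hn J hJ)
    rwa [show s = s' from ext' fun x => (hs x).trans (hs' x).symm]

namespace NN

/-- The natural number zero. -/
noncomputable def zero : NN M :=
  ⟨(isInductive_omega (M := M)).1.choose, (isInductive_omega (M := M)).1.choose_spec.1⟩

theorem not_mem_zero (x : M) : x ∉ (zero : NN M).1 :=
  (isInductive_omega (M := M)).1.choose_spec.2 x

/-- The successor function. -/
noncomputable def succ (n : NN M) : NN M :=
  ⟨((isInductive_omega (M := M)).2 n.1 n.2).choose,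
    ((isInductive_omega (M := M)).2 n.1 n.2).choose_spec.1⟩

theorem mem_succ {n : NN M} {x : M} : x ∈ (succ n).1 ↔ x ∈ n.1 ∨ x = n.1 :=
  ((isInductive_omega (M := M)).2 n.1 n.2).choose_spec.2 x

/-- Definability is essential: `omega M` may be nonstandard, and only a `C` that cuts out a set of
the model yields an inductive set that contains all of `omega M`. -/
theorem induction {C : NN M → Prop} (hC : Def M C) (h0 : C zero)
    (hs : ∀ n, C n → C (succ n)) (n : NN M) : C n := by
  obtain ⟨I, hI⟩ := sep hC.d1 (omega M)
  have hI' : ∀ n : NN M, n.1 ∈ I ↔ C n := by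
    intro n
    rw [hI]
    constructor
    · rintro ⟨-, a, ha, h⟩
      rwa [Subtype.ext (isCode_el.1 ha)]
    · exact fun h => ⟨n.2, n, rfl, h⟩
  refine (hI' n).1 (mem_omega.1 n.2 I ⟨⟨zero.1, (hI' _).2 h0, not_mem_zero⟩, fun m hm => ?_⟩)
  have hmo := ((hI m).1 hm).1
  exact ⟨(succ ⟨m, hmo⟩).1, (hI' _).2 (hs ⟨m, hmo⟩ ((hI' ⟨m, hmo⟩).1 hm)), fun x => mem_succ⟩

theorem mem_omega_of_mem (n : NN M) (x : M) : x ∈ n.1 → x ∈ omega M := by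
  refine imp_iff_not_or.2 (induction (C := fun n : NN M => ∀ x : M, x ∉ n.1 ∨ x ∈ omega M)
    (by fun_prop) (fun x => Or.inl (not_mem_zero x)) (fun n ih x => ?_) n x)
  rw [mem_succ]
  by_cases h : x = n.1
  · exact Or.inr (h ▸ n.2)
  · simpa [h] using ih x

theorem mem_trans (n : NN M) (y : M) (hy : y ∈ n.1) (x : M) (hx : x ∈ y) : x ∈ n.1 := by
  have key := induction (C := fun n : NN M => ∀ y x : M, (y ∉ n.1 ∨ x ∉ y) ∨ x ∈ n.1)
    (by fun_prop) (fun y x => Or.inl (Or.inl (not_mem_zero y))) (fun n ih y x => ?_) n y x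
  · tauto
  · rw [mem_succ, mem_succ]
    by_cases h : y = n.1
    · subst h
      tauto
    · have := ih y x
      tauto

theorem succ_inj {n m : NN M} (h : succ n = succ m) : n = m := by
  have h1 : n.1 ∈ (succ m).1 := h ▸ mem_succ.2 (Or.inr rfl)
  have h2 : m.1 ∈ (succ n).1 := h ▸ mem_succ.2 (Or.inr rfl)
  rcases mem_succ.1 h1 with h1 | h1
  · rcases mem_succ.1 h2 with h2 | h2
    · exact (not_mem_self _ (mem_trans _ _ h1 _ h2)).elim
    · exact Subtype.ext h2.symm
  · exact Subtype.ext h1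

theorem succ_ne_zero (n : NN M) : succ n ≠ zero := fun h =>
  not_mem_zero n.1 (h ▸ mem_succ.2 (Or.inr rfl))

@[fun_prop]
theorem def_succ {α : Type*} [Coded M α] [Rep M α] {f : α → NN M} (hf : Def M f) :
    Def M fun a => succ (f a) := by
  have : Def M (succ : NN M → NN M) := by
    refine Def.of_graph (Def.of_iff (P := fun p => ∀ x : M, x ∈ p.2.1 ↔ x ∈ p.1.1 ∨ x = p.1.1)
      (by fun_prop) fun p => ?_)
    constructor
    · intro h x
      rw [h, mem_succ]
    · intro h
      exact Subtype.ext (ext' fun x => (h x).trans mem_succ.symm)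
  exact this.comp hf

section Recursion

variable {α β : Type*} [Coded M α] [Coded M β] [Rep M α] [Tot M α] [Rep M β] [Tot M β] [Sm M β]

/-- Definition of functions by recursion, inside the model. -/
theorem exists_rec {a : α → β} {g : α → NN M → β → β} (ha : Def M a)
    (hg : Def M fun p : α × NN M × β => g p.1 p.2.1 p.2.2) :
    ∃ f : α → NN M → β, Def M (fun p : α × NN M => f p.1 p.2) ∧ (∀ x, f x zero = a x) ∧
      ∀ x n, f x (succ n) = g x n (f x n) := by
  -- `R x` is the least internal relation closed under the recursion; it will turn out to be the
  -- graph of the function sought.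
  obtain ⟨R, hRdef⟩ : ∃ R : α → NN M → β → Prop, ∀ x n b, R x n b ↔
      ∀ Q : Set (NN M × β), Internal M Q → (zero, a x) ∈ Q →
        (∀ m y, (m, y) ∈ Q → (succ m, g x m y) ∈ Q) → (n, b) ∈ Q :=
    ⟨_, fun _ _ _ => Iff.rfl⟩
  have hR : Def M fun p : α × NN M × β => R p.1 p.2.1 p.2.2 := by
    simp only [hRdef]
    fun_prop
  have hR0 : ∀ x, R x zero (a x) := fun x => (hRdef _ _ _).2 fun Q _ h _ => h
  have hRs : ∀ x n b, R x n b → R x (succ n) (g x n b) :=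
    fun x n b h => (hRdef _ _ _).2 fun Q hQ h0 hs => hs _ _ ((hRdef _ _ _).1 h Q hQ h0 hs)
  have hu0 : ∀ x b, R x zero b → b = a x := by
    intro x b hb
    have hQ : Internal M {p : NN M × β | p.1 = zero → p.2 = a x} :=
      (Def.isInt_ofPred (by fun_prop)).out
    exact (hRdef _ _ _).1 hb _ hQ (fun _ => rfl) (fun m y _ h => (succ_ne_zero m h).elim) rfl
  have hus : ∀ x n b, R x (succ n) b → ∃ y, R x n y ∧ b = g x n y := by
    intro x n b hb
    -- Inversion by minimality: the pairs of `R x` whose second entry comes from a predecessor, if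
    -- the first entry is `succ n`, already form a closed relation.
    have hQ : Internal M {p : NN M × β | R x p.1 p.2 ∧
        (p.1 = succ n → ∃ y, R x n y ∧ p.2 = g x n y)} :=
      (Def.isInt_ofPred (by fun_prop)).out
    refine ((hRdef _ _ _).1 hb _ hQ ⟨hR0 x, fun h => (succ_ne_zero n h.symm).elim⟩ ?_).2 rfl
    rintro m y ⟨hy, -⟩
    refine ⟨hRs _ _ _ hy, fun h => ?_⟩
    obtain rfl := succ_inj h
    exact ⟨y, hy, rfl⟩
  have key : ∀ x n, ∃! b, R x n b := by
    intro x n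
    refine induction (C := fun n => ∃ b, R x n b ∧ ∀ y, R x n y → y = b) (by fun_prop) ?_ ?_ n
    · exact ⟨a x, hR0 x, hu0 x⟩
    · rintro n ⟨b, hb, hu⟩
      refine ⟨g x n b, hRs _ _ _ hb, fun y hy => ?_⟩
      obtain ⟨z, hz, rfl⟩ := hus _ _ _ hy
      rw [hu z hz]
  choose f hf hu using key
  refine ⟨f, Def.of_graph ?_, fun x => (hu x _ _ (hR0 x)).symm,
    fun x n => (hu x _ _ (hRs _ _ _ (hf x n))).symm⟩
  have : Def M fun p : (α × NN M) × β => R p.1.1 p.1.2 p.2 := by fun_prop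
  exact this.of_iff fun p => ⟨fun h => h ▸ hf _ _, fun h => hu _ _ _ h⟩

end Recursion

end NN

end Naturals

/-! ### Transfer of codes between a set and its ambient type -/

section Codes

variable {M : Type u} [Membership M M] {α β γ : Type*} [Coded M α] [Coded M β] [Coded M γ]

/-- Codes do not remember the type of an object, so a set, or a function into a subtype, may be
viewed in the ambient type without changing its code. -/
theorem isCode_set_congr {S : Set α} {T : Set β} (h : ∀ a ∈ S, ∃ b ∈ T, ∀ m : M, IsCode a m ↔ IsCode b m)
    (h' : ∀ b ∈ T, ∃ a ∈ S, ∀ m : M, IsCode a m ↔ IsCode b m) {m : M} :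
    IsCode S m ↔ IsCode T m := by
  rw [isCode_set, isCode_set]
  constructor
  · rintro ⟨h1, h2⟩
    refine ⟨fun b hb => ?_, fun s hs => ?_⟩
    · obtain ⟨a, ha, hab⟩ := h' b hb
      obtain ⟨s, hs, has⟩ := h1 a ha
      exact ⟨s, hs, (hab s).1 has⟩
    · obtain ⟨a, ha, has⟩ := h2 s hs
      obtain ⟨b, hb, hab⟩ := h a ha
      exact ⟨b, hb, (hab s).1 has⟩
  · rintro ⟨h1, h2⟩
    refine ⟨fun a ha => ?_, fun s hs => ?_⟩
    · obtain ⟨b, hb, hab⟩ := h a ha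
      obtain ⟨s, hs, has⟩ := h1 b hb
      exact ⟨s, hs, (hab s).2 has⟩
    · obtain ⟨b, hb, has⟩ := h2 s hs
      obtain ⟨a, ha, hab⟩ := h' b hb
      exact ⟨a, ha, (hab s).2 has⟩

theorem isCode_fun_congr {f : α → β} {g : α → γ} (h : ∀ a (m : M), IsCode (f a) m ↔ IsCode (g a) m)
    {m : M} : IsCode f m ↔ IsCode g m := by
  rw [isCode_fun, isCode_fun]
  have key : ∀ a (n : M), IsCode (a, f a) n ↔ IsCode (a, g a) n := by
    intro a n
    simp only [isCode_prod, h]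
  refine isCode_set_congr ?_ ?_
  · rintro ⟨a, b⟩ hb
    obtain rfl : b = f a := hb
    exact ⟨(a, g a), rfl, key a⟩
  · rintro ⟨a, b⟩ hb
    obtain rfl : b = g a := hb
    exact ⟨(a, f a), rfl, key a⟩

theorem internal_fun_congr {f : α → β} {g : α → γ}
    (h : ∀ a (m : M), IsCode (f a) m ↔ IsCode (g a) m) : Internal M f ↔ Internal M g :=
  exists_congr fun _ => isCode_fun_congr h

theorem isFin_image_val {p : α → Prop} (T : Set (Subtype p)) :
    IsFin M (Subtype.val '' T) ↔ IsFin M T := by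
  let φ : T ≃ (Subtype.val '' T : Set α) := Equiv.Set.image _ T Subtype.val_injective
  refine exists_congr fun n => and_congr_right fun _ => ?_
  constructor
  · rintro ⟨e, he, hb⟩
    refine ⟨fun i => φ.symm (e i), ?_, φ.symm.bijective.comp hb⟩
    refine (internal_fun_congr fun i m => ?_).1 he
    conv_lhs => rw [← φ.apply_symm_apply (e i)]
    rfl
  · rintro ⟨e, he, hb⟩
    exact ⟨fun i => φ (e i), (internal_fun_congr (f := e) (g := fun i => φ (e i)) fun i m => Iff.rfl).1 he, φ.bijective.comp hb⟩

theorem isFin_univ_coe (S : Set α) : IsFin M (Set.univ : Set S) ↔ IsFin M S := by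
  rw [← isFin_image_val]
  simp

end Codes

/-! ### Finite sets of the model -/

section Finite

variable {M : Type u} [Membership M M] [ZFModel M] {α β γ : Type*} [Coded M α] [Coded M β]
  [Coded M γ] [Rep M α] [Tot M α] [Sm M α] [Rep M β] [Tot M β] [Sm M β]

/-- The bijection in `IsFin` has types depending on `n` and `S`. Replacing it by a relation between
the fixed types `NN M` and `α` makes finiteness definable in `S`. -/
theorem isFin_iff_rel {S : Set α} : IsFin M S ↔ ∃ (n : NN M) (r : Set (NN M × α)), Internal M r ∧
    (∀ i a, (i, a) ∈ r → i.1 ∈ n.1 ∧ a ∈ S) ∧ (∀ i : NN M, i.1 ∈ n.1 → ∃ a, (i, a) ∈ r) ∧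
    (∀ i a b, (i, a) ∈ r → (i, b) ∈ r → a = b) ∧ (∀ i j a, (i, a) ∈ r → (j, a) ∈ r → i = j) ∧
    ∀ a, a ∈ S → ∃ i, (i, a) ∈ r := by
  constructor
  · rintro ⟨n, hn, e, he, hb⟩
    have he' : Internal M fun i => (e i).1 :=
      (internal_fun_congr (f := e) (g := fun i => (e i).1) fun i m => Iff.rfl).1 he
    have hr : Internal M {p : NN M × α | ∃ i : El n, i.1 = p.1.1 ∧ (e i).1 = p.2} := by
      obtain ⟨f, hf⟩ : ∃ f : El n → α, ∀ i, (e i).1 = f i := ⟨_, fun _ => rfl⟩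
      simp only [hf] at he' ⊢
      have hd : Def M f := Def.of_isInt ⟨he'⟩
      exact (Def.isInt_ofPred (by fun_prop)).out
    refine ⟨⟨n, mem_omega.2 hn⟩, _, hr, ?_, ?_, ?_, ?_, ?_⟩
    · rintro i a ⟨j, hj, rfl⟩
      exact ⟨hj ▸ j.2, (e j).2⟩
    · intro i hi
      exact ⟨(e ⟨i.1, hi⟩).1, ⟨i.1, hi⟩, rfl, rfl⟩
    · rintro i a b ⟨j, hj, rfl⟩ ⟨k, hk, rfl⟩
      rw [Subtype.ext (hj.trans hk.symm)]
    · rintro i j a ⟨k, hk, hka⟩ ⟨l, hl, hla⟩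
      have := hb.1 (Subtype.ext (hka.trans hla.symm))
      subst this
      exact Subtype.ext (hk.symm.trans hl)
    · intro a ha
      obtain ⟨i, hi⟩ := hb.2 ⟨a, ha⟩
      exact ⟨⟨i.1, NN.mem_omega_of_mem ⟨n, mem_omega.2 hn⟩ _ i.2⟩, i, rfl, by rw [hi]⟩
  · rintro ⟨n, r, hr, h1, h2, h3, h4, h5⟩
    have key : ∀ i : El n.1, ∃ a, (⟨i.1, NN.mem_omega_of_mem n _ i.2⟩, a) ∈ r := fun i => h2 _ i.2
    choose f hf using key
    refine ⟨n.1, mem_omega.1 n.2, fun i => ⟨f i, (h1 _ _ (hf i)).2⟩, ?_, ?_, ?_⟩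
    · obtain ⟨m, hm⟩ := hr
      refine ⟨m, (isCode_set_congr ?_ ?_).1 hm⟩
      · rintro ⟨i, a⟩ hia
        have hi := (h1 _ _ hia).1
        refine ⟨(⟨i.1, hi⟩, ⟨f ⟨i.1, hi⟩, (h1 _ _ (hf _)).2⟩), rfl, ?_⟩
        rw [h3 i a _ hia (hf ⟨i.1, hi⟩)]
        exact fun m => Iff.rfl
      · rintro ⟨i, a⟩ ha
        replace ha : a = ⟨f i, (h1 _ _ (hf i)).2⟩ := ha
        rw [ha]
        exact ⟨_, hf i, fun m => Iff.rfl⟩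
    · intro i j hij
      have hij' : f i = f j := congrArg Subtype.val hij
      have hj := hf j
      rw [← hij'] at hj
      have := h4 _ _ _ (hf i) hj
      exact Subtype.ext (congrArg (fun x : NN M => x.1) this)
    · rintro ⟨a, ha⟩
      obtain ⟨i, hi⟩ := h5 a ha
      refine ⟨⟨i.1, (h1 _ _ hi).1⟩, Subtype.ext ?_⟩
      exact h3 i _ _ (hf ⟨i.1, (h1 _ _ hi).1⟩) hi

@[fun_prop]
theorem Def.isFin [Rep M γ] {S : γ → Set α} (hS : Def M S) : Def M fun x => IsFin M (S x) := by
  simp only [isFin_iff_rel]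
  fun_prop

theorem IsFin.internal {S : Set α} (h : IsFin M S) : Internal M S := by
  obtain ⟨n, r, hr, h1, h2, h3, h4, h5⟩ := isFin_iff_rel.1 h
  have : IsInt M r := ⟨hr⟩
  refine (Def.isInt_set (Def.of_iff (P := fun a => ∃ i, (i, a) ∈ r) (by fun_prop) fun a => ?_)).out
  exact ⟨h5 a, fun ⟨i, hi⟩ => (h1 _ _ hi).2⟩

theorem isFin_empty : IsFin M (∅ : Set α) := by
  refine isFin_iff_rel.2 ⟨NN.zero, ∅, IsInt.internal _, by simp, ?_, by simp, by simp, by simp⟩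
  exact fun i hi => (NN.not_mem_zero _ hi).elim

theorem IsFin.insert {S : Set α} (h : IsFin M S) (a : α) : IsFin M (insert a S) := by
  by_cases ha : a ∈ S
  · rwa [Set.insert_eq_of_mem ha]
  obtain ⟨n, r, hr, h1, h2, h3, h4, h5⟩ := isFin_iff_rel.1 h
  have : IsInt M r := ⟨hr⟩
  refine isFin_iff_rel.2 ⟨n.succ, Insert.insert (n, a) r, IsInt.internal _, ?_, ?_, ?_, ?_, ?_⟩
  · intro i b hib
    rw [NN.mem_succ]
    rcases hib with h | h
    · obtain ⟨rfl, rfl⟩ := Prod.ext_iff.1 h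
      exact ⟨Or.inr rfl, Or.inl rfl⟩
    · exact ⟨Or.inl (h1 _ _ h).1, Or.inr (h1 _ _ h).2⟩
  · intro i hi
    rcases NN.mem_succ.1 hi with hi | hi
    · obtain ⟨b, hb⟩ := h2 i hi
      exact ⟨b, Or.inr hb⟩
    · exact ⟨a, Or.inl (Prod.ext (Subtype.ext hi) rfl)⟩
  · have hna : ∀ b, (n, b) ∉ r := fun b hb => not_mem_self _ (h1 _ _ hb).1
    intro i b c hb hc
    rcases hb with hb | hb <;> rcases hc with hc | hc
    · exact (congrArg Prod.snd hb).trans (congrArg Prod.snd hc).symm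
    · obtain rfl : i = n := congrArg Prod.fst hb
      exact (hna _ hc).elim
    · obtain rfl : i = n := congrArg Prod.fst hc
      exact (hna _ hb).elim
    · exact h3 _ _ _ hb hc
  · intro i j b hi hj
    rcases hi with hi | hi <;> rcases hj with hj | hj
    · exact (congrArg Prod.fst hi).trans (congrArg Prod.fst hj).symm
    · obtain rfl : b = a := congrArg Prod.snd hi
      exact (ha (h1 _ _ hj).2).elim
    · obtain rfl : b = a := congrArg Prod.snd hj
      exact (ha (h1 _ _ hi).2).elim
    · exact h4 _ _ _ hi hj
  · rintro b (rfl | hb)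
    · exact ⟨n, Or.inl rfl⟩
    · obtain ⟨i, hi⟩ := h5 b hb
      exact ⟨i, Or.inr hi⟩

theorem isFin_singleton (a : α) : IsFin M ({a} : Set α) := by
  simpa using (isFin_empty (M := M) (α := α)).insert a

/-- Induction on finite sets, inside the model. -/
theorem IsFin.induction {C : Set α → Prop} (hC : Def M C) (h0 : C ∅)
    (hi : ∀ G a, IsFin M G → a ∉ G → C G → C (Insert.insert a G)) {S : Set α} (hS : IsFin M S) :
    C S := by
  obtain ⟨n, hn, e, he, hb⟩ := hS
  obtain ⟨f, hf⟩ : ∃ f : El n → α, ∀ i, (e i).1 = f i := ⟨_, fun _ => rfl⟩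
  have hd : Def M f := Def.of_isInt ⟨(internal_fun_congr fun i m => by
    rw [← hf i]; exact Iff.rfl).1 he⟩
  have hinj : ∀ i j, f i = f j → i = j := fun i j h => hb.1 (Subtype.ext (by rwa [hf, hf]))
  let n' : NN M := ⟨n, mem_omega.2 hn⟩
  -- Induction on `k`, for the image of the first `k` indices. The first alternative says that `k`
  -- exceeds `n`; it is excluded at the end, where `k = n`.
  have key : ∀ k : NN M, (k.1 ∉ n ∧ k ≠ n') ∨
      (IsFin M {a | ∃ i : El n, i.1 ∈ k.1 ∧ f i = a} ∧ C {a | ∃ i : El n, i.1 ∈ k.1 ∧ f i = a}) := by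
    intro k
    refine NN.induction (C := fun k : NN M => (k.1 ∉ n ∧ k ≠ n') ∨
      (IsFin M {a | ∃ i : El n, i.1 ∈ k.1 ∧ f i = a} ∧ C {a | ∃ i : El n, i.1 ∈ k.1 ∧ f i = a}))
      (by fun_prop) ?_ ?_ k
    · right
      have : {a | ∃ i : El n, i.1 ∈ (NN.zero : NN M).1 ∧ f i = a} = ∅ := by
        ext a
        simp [NN.not_mem_zero]
      rw [this]
      exact ⟨isFin_empty, h0⟩
    · intro k ih
      by_cases hk : k.1 ∈ n
      · obtain ⟨h1, h2⟩ := ih.resolve_left fun h => h.1 hk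
        right
        have : {a | ∃ i : El n, i.1 ∈ k.succ.1 ∧ f i = a} =
            Insert.insert (f ⟨k.1, hk⟩) {a | ∃ i : El n, i.1 ∈ k.1 ∧ f i = a} := by
          ext a
          simp only [NN.mem_succ, Set.mem_ofPred_eq, Set.mem_insert_iff]
          constructor
          · rintro ⟨i, hi | hi, rfl⟩
            · exact Or.inr ⟨i, hi, rfl⟩
            · obtain rfl : i = ⟨k.1, hk⟩ := Subtype.ext hi
              exact Or.inl rfl
          · rintro (rfl | ⟨i, hi, rfl⟩)
            · exact ⟨⟨k.1, hk⟩, Or.inr rfl, rfl⟩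
            · exact ⟨i, Or.inl hi, rfl⟩
        rw [this]
        refine ⟨h1.insert _, hi _ _ h1 ?_ h2⟩
        rintro ⟨i, hik, hi⟩
        rw [hinj _ _ hi] at hik
        exact not_mem_self _ hik
      · left
        constructor
        · intro h
          exact hk (NN.mem_trans n' _ h _ (NN.mem_succ.2 (Or.inr rfl)))
        · intro h
          have : k.1 ∈ n'.1 := h ▸ NN.mem_succ.2 (Or.inr rfl)
          exact hk this
  have h1 := ((key n').resolve_left fun h => h.2 rfl).2
  have : {a | ∃ i : El n, i.1 ∈ n ∧ f i = a} = S := by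
    ext a
    constructor
    · rintro ⟨i, -, rfl⟩
      exact hf i ▸ (e i).2
    · intro ha
      obtain ⟨i, hi⟩ := hb.2 ⟨a, ha⟩
      exact ⟨i, i.2, by rw [← hf, hi]⟩
  rwa [← this]

/-- Induction on `S` for all internal `T` at once: removing the new point from `T` leads back to the
smaller set. -/
theorem IsFin.subset {S T : Set α} (hS : IsFin M S) (hT : Internal M T) (h : T ⊆ S) :
    IsFin M T := by
  refine IsFin.induction (C := fun S => ∀ T : Set α, Internal M T → T ⊆ S → IsFin M T)
    (by fun_prop) ?_ ?_ hS T hT h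
  · intro T _ h
    rw [Set.subset_empty_iff.1 h]
    exact isFin_empty
  · intro G a _ ha ih T hT hTG
    have : IsInt M T := ⟨hT⟩
    have h1 := ih (T \ {a}) (IsInt.internal _) (by
      rintro x ⟨hx, hxa⟩
      exact (hTG hx).resolve_left hxa)
    by_cases haT : a ∈ T
    · have := h1.insert a
      rwa [Set.insert_sdiff_singleton, Set.insert_eq_of_mem haT] at this
    · rwa [Set.sdiff_singleton_eq_self haT] at h1

theorem IsFin.union {S T : Set α} (hS : IsFin M S) (hT : IsFin M T) : IsFin M (S ∪ T) := by
  have : IsInt M T := ⟨hT.internal⟩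
  refine IsFin.induction (C := fun S => IsFin M (S ∪ T)) (by fun_prop) ?_ ?_ hS
  · simpa using hT
  · intro G a _ _ ih
    rw [Set.insert_union]
    exact ih.insert a

/-- A finite union of finite sets is finite. -/
theorem IsFin.biUnion {F : Set β} (hF : IsFin M F) {r : β → α → Prop}
    (hr : Def M fun p : β × α => r p.1 p.2) (h : ∀ b ∈ F, IsFin M {a | r b a}) :
    IsFin M {a | ∃ b ∈ F, r b a} := by
  refine IsFin.induction (C := fun F : Set β => (∀ b, b ∈ F → IsFin M {a | r b a}) →
    IsFin M {a | ∃ b, b ∈ F ∧ r b a}) (by fun_prop) ?_ ?_ hF h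
  · intro _
    simpa using isFin_empty
  · intro G b _ _ ih h
    have h1 := (h b (Or.inl rfl)).union (ih fun c hc => h c (Or.inr hc))
    convert! h1 using 1
    ext a
    simp

theorem IsFin.preimage {F : Set β} (hF : IsFin M F) {f : α → β} (hf : Def M f)
    (h : ∀ b ∈ F, IsFin M {a | f a = b}) : IsFin M {a | f a ∈ F} := by
  have := hF.biUnion (r := fun b a => f a = b) (by fun_prop) h
  simpa using this

theorem IsFin.image {F : Set α} (hF : IsFin M F) {f : α → β} (hf : Def M f) :
    IsFin M (f '' F) :=
  hF.biUnion (r := fun a b => f a = b) (by fun_prop) fun a _ => by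
    have : {b | f a = b} = {f a} := by ext; simp [eq_comm]
    rw [this]
    exact isFin_singleton _

theorem IsFin.preimage_inj {F : Set β} (hF : IsFin M F) {f : α → β} (hf : Def M f)
    (hi : Function.Injective f) : IsFin M {a | f a ∈ F} := by
  refine hF.preimage hf fun b _ => ?_
  by_cases h : ∃ a, f a = b
  · obtain ⟨a, rfl⟩ := h
    have : {a' | f a' = f a} = {a} := by ext; simp [hi.eq_iff]
    rw [this]
    exact isFin_singleton _
  · have : {a' | f a' = b} = ∅ := by
      ext x
      exact ⟨fun hx => h ⟨x, hx⟩, fun hx => hx.elim⟩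
    rw [this]
    exact isFin_empty

/-- A nonempty finite set has a greatest element for any total preorder. -/
theorem IsFin.exists_max {S : Set α} (hS : IsFin M S) {r : α → α → Prop}
    (hr : Def M fun p : α × α => r p.1 p.2) (ht : ∀ a b, r a b ∨ r b a)
    (htr : ∀ a b c, r a b → r b c → r a c) (hne : S.Nonempty) : ∃ m ∈ S, ∀ a ∈ S, r a m := by
  have key : S = ∅ ∨ ∃ m, m ∈ S ∧ ∀ a, a ∈ S → r a m := by
    refine IsFin.induction (C := fun S : Set α => S = ∅ ∨ ∃ m, m ∈ S ∧ ∀ a, a ∈ S → r a m)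
      (by fun_prop) (Or.inl rfl) ?_ hS
    intro G b _ _ ih
    right
    have hrefl : ∀ a, r a a := fun a => (ht a a).elim _root_.id _root_.id
    rcases ih with rfl | ⟨m, hm, hmax⟩
    · refine ⟨b, Or.inl rfl, ?_⟩
      rintro a (rfl | h)
      exacts [hrefl a, h.elim]
    · rcases ht m b with h | h
      · refine ⟨b, Or.inl rfl, ?_⟩
        rintro a (rfl | ha)
        exacts [hrefl a, htr _ _ _ (hmax a ha) h]
      · refine ⟨m, Or.inr hm, ?_⟩
        rintro a (rfl | ha)
        exacts [h, hmax a ha]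
  rcases key with rfl | h
  · exact (hne.ne_empty rfl).elim
  · exact h

end Finite

/-! ### Definability of the field operations; finite sums -/

/-- The field operations and the order of `K` are definable. -/
class DefField (M : Type u) [Membership M M] (K : Type v) [Coded M K] [Field K] [LinearOrder K] :
    Prop where
  def_add : Def M fun p : K × K => p.1 + p.2
  def_mul : Def M fun p : K × K => p.1 * p.2
  def_le : Def M fun p : K × K => p.1 ≤ p.2

section Real

variable {M : Type u} [Membership M M] [ZFModel M] {R : M} [RealField R] {α β γ : Type*}
  [Coded M α] [Coded M β] [Coded M γ] [Rep M α] [Rep M β] [Rep M γ]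

instance : DefField M (El R) where
  def_add := Def.of_isInt ⟨RealField.internal_add (R := R)⟩
  def_mul := Def.of_isInt ⟨RealField.internal_mul (R := R)⟩
  def_le := by
    have : IsInt M {p : El R × El R | p.1 ≤ p.2} := ⟨RealField.internal_le⟩
    have h : Def M fun p : El R × El R => p ∈ {p : El R × El R | p.1 ≤ p.2} := by fun_prop
    exact h

namespace Def

section Field

variable {K : Type*} [Coded M K] [Rep M K] [Tot M K] [Field K] [LinearOrder K]
  [IsStrictOrderedRing K] [DefField M K]

@[fun_prop]
theorem radd {f g : γ → K} (hf : Def M f) (hg : Def M g) : Def M fun x => f x + g x :=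
  DefField.def_add.comp (hf.prodMk hg)

@[fun_prop]
theorem rmul {f g : γ → K} (hf : Def M f) (hg : Def M g) : Def M fun x => f x * g x :=
  DefField.def_mul.comp (hf.prodMk hg)

@[fun_prop]
theorem rle {f g : γ → K} (hf : Def M f) (hg : Def M g) : Def M fun x => f x ≤ g x :=
  DefField.def_le.comp (hf.prodMk hg)

@[fun_prop]
theorem rlt {f g : γ → K} (hf : Def M f) (hg : Def M g) : Def M fun x => f x < g x :=
  (hg.rle hf).not.of_iff fun _ => not_le.symm

@[fun_prop]
theorem rneg {f : γ → K} (hf : Def M f) : Def M fun x => - f x := by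
  have : Def M fun x : K => -x :=
    of_graph (Def.of_iff (P := fun p : K × K => p.2 + p.1 = 0) (by fun_prop) fun p =>
      eq_neg_iff_add_eq_zero)
  exact this.comp hf

@[fun_prop]
theorem rsub {f g : γ → K} (hf : Def M f) (hg : Def M g) : Def M fun x => f x - g x :=
  (hf.radd hg.rneg).congr fun _ => sub_eq_add_neg _ _

@[fun_prop]
theorem rinv {f : γ → K} (hf : Def M f) : Def M fun x => (f x)⁻¹ := by
  have : Def M fun x : K => x⁻¹ :=
    of_graph (Def.of_iff (P := fun p : K × K => (p.1 = 0 ∧ p.2 = 0) ∨ p.2 * p.1 = 1)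
      (by fun_prop) fun p => by
        by_cases h : p.1 = 0
        · simp [h]
        · simp only [h, false_and, false_or]
          exact ⟨fun h' => by rw [h', inv_mul_cancel₀ h], eq_inv_of_mul_eq_one_left⟩)
  exact this.comp hf

@[fun_prop]
theorem rpow {f : γ → K} (hf : Def M f) (n : ℕ) : Def M fun x => f x ^ n := by
  induction n with
  | zero => simpa using Def.const (1 : K)
  | succ n ih => simpa [pow_succ] using ih.rmul hf

@[fun_prop]
theorem rabs {f : γ → K} (hf : Def M f) : Def M fun x => |f x| := by
  have : Def M fun x : K => |x| :=
    of_graph (Def.of_iff (P := fun p : K × K => (0 ≤ p.1 ∧ p.2 = p.1) ∨ (p.1 ≤ 0 ∧ p.2 = -p.1))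
      (by fun_prop) fun p => by
        rcases le_total 0 p.1 with h | h
        · rw [abs_of_nonneg h]
          constructor
          · exact fun h' => Or.inl ⟨h, h'⟩
          · rintro (h' | h')
            · exact h'.2
            · rw [h'.2, le_antisymm h'.1 h, neg_zero]
        · rw [abs_of_nonpos h]
          constructor
          · exact fun h' => Or.inr ⟨h, h'⟩
          · rintro (h' | h')
            · rw [h'.2, le_antisymm h h'.1, neg_zero]
            · exact h'.2)
  exact this.comp hf

end Field

@[fun_prop]
theorem cadd {f g : γ → Cplx R} (hf : Def M f) (hg : Def M g) : Def M fun x => f x + g x :=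
  congr (f := fun x => (⟨(f x).re + (g x).re, (f x).im + (g x).im⟩ : Cplx R)) (by fun_prop)
    fun _ => by ext <;> simp

@[fun_prop]
theorem cmul {f g : γ → Cplx R} (hf : Def M f) (hg : Def M g) : Def M fun x => f x * g x :=
  congr (f := fun x => (⟨(f x).re * (g x).re + -1 * ((f x).im * (g x).im),
      (f x).re * (g x).im + (f x).im * (g x).re⟩ : Cplx R)) (by fun_prop)
    fun _ => by ext <;> simp

@[fun_prop]
theorem cstar {f : γ → Cplx R} (hf : Def M f) : Def M fun x => star (f x) :=
  congr (f := fun x => (⟨(f x).re, -(f x).im⟩ : Cplx R)) (by fun_prop)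
    fun _ => by ext <;> simp

end Def

section Sums

variable [Tot M α] [Sm M α] [Tot M β] [Sm M β]

/-- The closure condition may be restricted to internal `G`, since members of the internal `Q` are
internal. In this form it is definable. -/
theorem isFinSum_iff {f : α → El R} {F : Set α} {s : El R} : IsFinSum f F s ↔
    ∀ Q : Set (Set α × El R), Internal M Q → (∅, 0) ∈ Q →
      (∀ G : Set α, Internal M G → ∀ t a, (G, t) ∈ Q → a ∉ G → (insert a G, t + f a) ∈ Q) →
      (F, s) ∈ Q :=
  forall_congr' fun Q => imp_congr_right fun hQ => imp_congr_right fun h0 =>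
    imp_congr_left ⟨fun h G _ t a => h G t a, fun h G t a hG => h G (hQ.of_mem hG).fst t a hG⟩

@[fun_prop]
theorem Def.isFinSum {f : γ → α → El R} {F : γ → Set α} {s : γ → El R}
    (hf : Def M fun p : γ × α => f p.1 p.2) (hF : Def M F) (hs : Def M s) :
    Def M fun x => IsFinSum (f x) (F x) (s x) := by
  simp only [isFinSum_iff]
  fun_prop

variable {f g : α → El R} {F G : Set α}

theorem isFinSum_empty : IsFinSum f ∅ 0 := fun Q _ h0 _ => h0

theorem IsFinSum.insert {s : El R} (h : IsFinSum f F s) {a : α} (ha : a ∉ F) :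
    IsFinSum f (insert a F) (s + f a) :=
  fun Q hQ h0 hs => hs _ _ _ (h Q hQ h0 hs) ha

theorem IsFinSum.of_empty {s : El R} (h : IsFinSum f ∅ s) : s = 0 := by
  have hQ : IsInt M {p : Set α × El R | Internal M p ∧ (p.1 = ∅ → p.2 = 0)} :=
    Def.isInt_const (f := fun _ : Prop => {p : Set α × El R | Internal M p ∧ (p.1 = ∅ → p.2 = 0)})
      (by fun_prop) True
  refine (isFinSum_iff.1 h _ hQ.out ⟨IsInt.internal _, fun _ => rfl⟩ ?_).2 rfl
  intro G hG t a _ _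
  have : IsInt M G := ⟨hG⟩
  exact ⟨IsInt.internal _, fun h => ((Set.insert_nonempty _ _).ne_empty h).elim⟩

/-- Recursion only adds elements in some order; this inversion shows that any element may be the
last one, which gives uniqueness of sums. The least relation is tested against the pairs that are
sums and remain sums after any one element is removed. -/
theorem IsFinSum.diff (hf : Def M f) {s : El R} (h : IsFinSum f F s) {a : α} (ha : a ∈ F) :
    IsFinSum f (F \ {a}) (s - f a) := by
  have hQ : IsInt M {p : Set α × El R | Internal M p ∧ (IsFinSum f p.1 p.2 ∧
      ∀ a : α, a ∈ p.1 → IsFinSum f (p.1 \ {a}) (p.2 - f a))} :=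
    Def.isInt_const (f := fun _ : Prop => {p : Set α × El R | Internal M p ∧ (IsFinSum f p.1 p.2 ∧
      ∀ a : α, a ∈ p.1 → IsFinSum f (p.1 \ {a}) (p.2 - f a))}) (by fun_prop) True
  refine (isFinSum_iff.1 h _ hQ.out ⟨IsInt.internal _, isFinSum_empty, fun a ha => ha.elim⟩ ?_).2.2 a ha
  rintro G hG t b ⟨-, h1, h2⟩ hb
  have : IsInt M G := ⟨hG⟩
  refine ⟨IsInt.internal _, h1.insert hb, fun c hc => ?_⟩
  dsimp only at hc ⊢
  by_cases hbc : c = b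
  · subst hbc
    simpa [hb] using h1
  · have hcG : c ∈ G := hc.resolve_left hbc
    have h3 := (h2 c hcG).insert (a := b) (fun h => hb h.1)
    rw [← Set.insert_sdiff_singleton_comm (Ne.symm hbc)]
    convert h3 using 1
    ring

theorem existsUnique_isFinSum (hf : Def M f) (hF : IsFin M F) :
    ∃ s, IsFinSum f F s ∧ ∀ t, IsFinSum f F t → t = s := by
  refine IsFin.induction (C := fun F => ∃ s, IsFinSum f F s ∧ ∀ t, IsFinSum f F t → t = s)
    (by fun_prop) ⟨0, isFinSum_empty, fun t ht => ht.of_empty⟩ ?_ hF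
  rintro G a _ ha ⟨s, hs, hu⟩
  refine ⟨s + f a, hs.insert ha, fun t ht => ?_⟩
  have := ht.diff hf (Or.inl rfl : a ∈ insert a G)
  rw [← hu (t - f a) (by simpa [ha] using this)]
  ring

open Classical in
/-- The sum of `f` over the finite set `F` of the model. -/
noncomputable def fsum (f : α → El R) (F : Set α) : El R :=
  if h : IsFin M F ∧ ∃ s, IsFinSum f F s then h.2.choose else 0

theorem isFinSum_fsum (hf : Def M f) (hF : IsFin M F) : IsFinSum f F (fsum f F) := by
  obtain ⟨s, hs, hu⟩ := existsUnique_isFinSum hf hF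
  have h : IsFin M F ∧ ∃ s, IsFinSum f F s := ⟨hF, s, hs⟩
  rw [fsum, dif_pos h]
  exact h.2.choose_spec

theorem isFinSum_iff_eq (hf : Def M f) (hF : IsFin M F) {s : El R} :
    IsFinSum f F s ↔ s = fsum f F := by
  obtain ⟨s', hs', hu⟩ := existsUnique_isFinSum hf hF
  constructor
  · intro h
    rw [hu _ h, hu _ (isFinSum_fsum hf hF)]
  · rintro rfl
    exact isFinSum_fsum hf hF

@[fun_prop]
theorem Def.fsum {f : γ → α → El R} {F : γ → Set α}
    (hf : Def M fun p : γ × α => f p.1 p.2) (hF : Def M F) :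
    Def M fun x => fsum (f x) (F x) := by
  refine of_graph (Def.of_iff_internal (P := fun p : γ × El R => (IsFin M (F p.1) ∧
    IsFinSum (f p.1) (F p.1) p.2) ∨ (¬ IsFin M (F p.1) ∧ p.2 = 0)) (by fun_prop) fun p hp => ?_)
  by_cases h : IsFin M (F p.1)
  · have : IsInt M p.1 := ⟨hp.fst⟩
    have hfp : Def M (f p.1) := by fun_prop
    simp [h, isFinSum_iff_eq hfp h]
  · simp [h, ZFAnalysis.fsum]

theorem fsum_empty (hf : Def M f) : fsum f (∅ : Set α) = 0 :=
  ((isFinSum_iff_eq hf isFin_empty).1 isFinSum_empty).symm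

theorem fsum_insert (hf : Def M f) (hF : IsFin M F) {a : α} (ha : a ∉ F) :
    fsum f (insert a F) = fsum f F + f a :=
  ((isFinSum_iff_eq hf (hF.insert a)).1 ((isFinSum_fsum hf hF).insert ha)).symm

theorem fsum_singleton (hf : Def M f) (a : α) : fsum f {a} = f a := by
  rw [← insert_empty_eq, fsum_insert hf isFin_empty (fun h => h.elim), fsum_empty hf, zero_add]

theorem fsum_congr (hf : Def M f) (hg : Def M g) (hF : IsFin M F) (h : ∀ a ∈ F, f a = g a) :
    fsum f F = fsum g F := by
  refine IsFin.induction (C := fun F => (∀ a, a ∈ F → f a = g a) → fsum f F = fsum g F)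
    (by fun_prop) (fun _ => by rw [fsum_empty hf, fsum_empty hg]) ?_ hF h
  intro G a hG ha ih h
  rw [fsum_insert hf hG ha, fsum_insert hg hG ha, ih fun b hb => h b (Or.inr hb), h a (Or.inl rfl)]

theorem fsum_le (hf : Def M f) (hg : Def M g) (hF : IsFin M F) (h : ∀ a ∈ F, f a ≤ g a) :
    fsum f F ≤ fsum g F := by
  refine IsFin.induction (C := fun F => (∀ a, a ∈ F → f a ≤ g a) → fsum f F ≤ fsum g F)
    (by fun_prop) (fun _ => by rw [fsum_empty hf, fsum_empty hg]) ?_ hF h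
  intro G a hG ha ih h
  rw [fsum_insert hf hG ha, fsum_insert hg hG ha]
  exact add_le_add (ih fun b hb => h b (Or.inr hb)) (h a (Or.inl rfl))

theorem fsum_add (hf : Def M f) (hg : Def M g) (hF : IsFin M F) :
    fsum (fun a => f a + g a) F = fsum f F + fsum g F := by
  refine IsFin.induction (C := fun F => fsum (fun a => f a + g a) F = fsum f F + fsum g F)
    (by fun_prop) (by rw [fsum_empty hf, fsum_empty hg, fsum_empty (by fun_prop), add_zero]) ?_ hF
  intro G a hG ha ih
  rw [fsum_insert hf hG ha, fsum_insert hg hG ha, fsum_insert (by fun_prop) hG ha, ih]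
  ring

theorem fsum_mul_left (hf : Def M f) (hF : IsFin M F) (c : El R) :
    fsum (fun a => c * f a) F = c * fsum f F := by
  refine IsFin.induction (C := fun F => fsum (fun a => c * f a) F = c * fsum f F)
    (by fun_prop) (by rw [fsum_empty hf, fsum_empty (by fun_prop), mul_zero]) ?_ hF
  intro G a hG ha ih
  rw [fsum_insert hf hG ha, fsum_insert (by fun_prop) hG ha, ih]
  ring

theorem fsum_zero (hF : IsFin M F) : fsum (fun _ : α => (0 : El R)) F = 0 := by
  have := fsum_mul_left (f := fun _ : α => (0 : El R)) (by fun_prop) hF 0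
  simpa using this

theorem fsum_sub (hf : Def M f) (hg : Def M g) (hF : IsFin M F) :
    fsum (fun a => f a - g a) F = fsum f F - fsum g F := by
  have h := fsum_add (f := fun a => f a - g a) (g := g) (by fun_prop) hg hF
  simp only [sub_add_cancel] at h
  exact eq_sub_of_add_eq h.symm

theorem fsum_nonneg (hf : Def M f) (hF : IsFin M F) (h : ∀ a ∈ F, 0 ≤ f a) : 0 ≤ fsum f F := by
  rw [← fsum_zero hF (R := R)]
  exact fsum_le (by fun_prop) hf hF h

theorem fsum_inter (hf : Def M f) (hF : IsFin M F) [IsInt M G] (h : ∀ a ∈ F, a ∉ G → f a = 0) :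
    fsum f (F ∩ G) = fsum f F := by
  refine IsFin.induction (C := fun F => (∀ a, a ∈ F → a ∉ G → f a = 0) → fsum f (F ∩ G) = fsum f F)
    (by fun_prop) (fun _ => by rw [Set.empty_inter]) ?_ hF h
  intro F a hF ha ih h
  have hFi : IsInt M F := ⟨hF.internal⟩
  by_cases haG : a ∈ G
  · rw [Set.insert_inter_of_mem haG, fsum_insert hf hF ha, fsum_insert hf
      (hF.subset (IsInt.internal _) Set.inter_subset_left) (fun h => ha h.1),
      ih fun b hb => h b (Or.inr hb)]
  · rw [Set.insert_inter_of_notMem haG, fsum_insert hf hF ha, h a (Or.inl rfl) haG, add_zero,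
      ih fun b hb => h b (Or.inr hb)]

theorem fsum_subset (hf : Def M f) (hF : IsFin M F) (hG : IsFin M G) (hFG : F ⊆ G)
    (h : ∀ a ∈ G, a ∉ F → f a = 0) : fsum f F = fsum f G := by
  have : IsInt M F := ⟨hF.internal⟩
  rw [← fsum_inter hf hG h, Set.inter_eq_right.2 hFG]

theorem fsum_mono (hf : Def M f) (hF : IsFin M F) (hG : IsFin M G) (hFG : F ⊆ G)
    (h : ∀ a, 0 ≤ f a) : fsum f F ≤ fsum f G := by
  have hFi : IsInt M F := ⟨hF.internal⟩
  have key : fsum f (G ∩ F) ≤ fsum f G := by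
    refine IsFin.induction (C := fun G => fsum f (G ∩ F) ≤ fsum f G)
      (by fun_prop) (by rw [Set.empty_inter]) ?_ hG
    intro G a hG ha ih
    have hGi : IsInt M G := ⟨hG.internal⟩
    by_cases haG : a ∈ F
    · rw [Set.insert_inter_of_mem haG, fsum_insert hf hG ha, fsum_insert hf
        (hG.subset (IsInt.internal _) Set.inter_subset_left) (fun h => ha h.1)]
      gcongr
    · rw [Set.insert_inter_of_notMem haG, fsum_insert hf hG ha]
      exact le_add_of_le_of_nonneg ih (h a)
  rwa [Set.inter_eq_right.2 hFG] at key

theorem le_fsum (hf : Def M f) (hF : IsFin M F) (h : ∀ a, 0 ≤ f a) {a : α} (ha : a ∈ F) :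
    f a ≤ fsum f F := by
  rw [← fsum_singleton hf a]
  exact fsum_mono hf (isFin_singleton a) hF (Set.singleton_subset_iff.2 ha) h

theorem fsum_comm {f : α → β → El R} (hf : Def M fun p : α × β => f p.1 p.2) (hF : IsFin M F)
    {H : Set β} (hH : IsFin M H) :
    fsum (fun a => fsum (f a) H) F = fsum (fun b => fsum (fun a => f a b) F) H := by
  have hHi : IsInt M H := ⟨hH.internal⟩
  have h1 : ∀ b, Def M fun a => f a b := fun b => by fun_prop
  have h2 : ∀ a, Def M (f a) := fun a => by fun_prop
  refine IsFin.induction (C := fun F : Set α =>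
    fsum (fun a => fsum (f a) H) F = fsum (fun b => fsum (fun a => f a b) F) H) (by fun_prop) ?_ ?_ hF
  · rw [fsum_empty (by fun_prop), ← fsum_zero hH]
    exact fsum_congr (by fun_prop) (by fun_prop) hH fun b _ => (fsum_empty (h1 b)).symm
  · intro G a hG ha ih
    have hGi : IsInt M G := ⟨hG.internal⟩
    have hi : IsInt M (insert a G) := inferInstance
    rw [fsum_insert (by fun_prop) hG ha, ih, ← fsum_add (by fun_prop) (h2 a) hH]
    exact fsum_congr (by fun_prop) (by fun_prop) hH fun b _ => (fsum_insert (h1 b) hG ha).symm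

/-- A set on which a function with bounded finite sums is bounded away from `0` is finite. -/
theorem isFin_of_bounded (hf : Def M f) {T : Set α} [IsInt M T] {ε : El R} (hε : 0 < ε)
    (hT : ∀ a ∈ T, ε ≤ f a) {c : El R} (hc : ∀ F, IsFin M F → F ⊆ T → fsum f F ≤ c) :
    IsFin M T := by
  by_contra hinf
  -- Let `s` be the supremum of the sums over finite subsets of `T`. If `T` is infinite, a finite
  -- sum above `s - ε` can be enlarged by one more element, exceeding `s`.
  have hS : IsInt M {r : El R | ∃ F : Set α, Internal M F ∧ (IsFin M F ∧ F ⊆ T ∧ r = fsum f F)} :=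
    Def.isInt_ofPred (by fun_prop)
  obtain ⟨s, hs⟩ := RealField.exists_isLUB _ hS.out
    ⟨_, ∅, IsInt.internal _, isFin_empty, Set.empty_subset _, rfl⟩
    ⟨c, by rintro r ⟨F, -, hF, hFT, rfl⟩; exact hc F hF hFT⟩
  obtain ⟨r, ⟨F, hFi, hF, hFT, rfl⟩, hr⟩ := (lt_isLUB_iff hs).1 (sub_lt_self s hε)
  obtain ⟨a, haT, haF⟩ : ∃ a ∈ T, a ∉ F := by
    by_contra! h
    exact hinf (hF.subset (IsInt.internal _) h)
  have h1 := hs.1 ⟨_, (hF.insert a).internal, hF.insert a, Set.insert_subset haT hFT, rfl⟩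
  rw [fsum_insert hf hF haF] at h1
  have := hT a haT
  linarith

end Sums

end Real

/-! ### Preorders on amorphous sets -/

section Amorphous

variable {M : Type u} [Membership M M] [ZFModel M] {α : Type*} [Coded M α] [Rep M α] [Tot M α]
  [Sm M α]

/-- An infinite subset of an amorphous set carries no total preorder with finite initial segments. -/
theorem false_of_preorder (hA : ∀ S : Set α, Internal M S → IsFin M S ∨ IsFin M Sᶜ) {T : Set α}
    [IsInt M T] (hT : ¬ IsFin M T) {r : α → α → Prop} (hr : Def M fun p : α × α => r p.1 p.2)
    (ht : ∀ a b, r a b ∨ r b a) (htr : ∀ a b c, r a b → r b c → r a c)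
    (hfin : ∀ s ∈ T, IsFin M {t | t ∈ T ∧ r t s}) : False := by
  have hmin : ∀ S : Set α, IsFin M S → S.Nonempty → ∃ m ∈ S, ∀ a ∈ S, r m a := fun S hS hne =>
    hS.exists_max (r := fun a b => r b a) (by fun_prop) (fun a b => (ht a b).symm)
      (fun a b c h h' => htr _ _ _ h' h) hne
  -- `r` sorts `T` into levels of equivalent elements; `Nx s t` says that the level of `t` comes
  -- immediately after that of `s`.
  obtain ⟨Nx, hNx⟩ : ∃ Nx : α → α → Prop, ∀ s t, Nx s t ↔
      s ∈ T ∧ t ∈ T ∧ ¬ r t s ∧ ∀ u, u ∈ T → r u s ∨ r t u := ⟨_, fun _ _ => Iff.rfl⟩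
  have hNxD : Def M fun p : α × α => Nx p.1 p.2 := by
    simp only [hNx]
    fun_prop
  have hnext : ∀ s ∈ T, ∃ t, Nx s t := by
    intro s hs
    obtain ⟨t₀, ht₀, hst₀⟩ : ∃ t₀ ∈ T, ¬ r t₀ s := by
      by_contra! h
      refine hT ?_
      convert! hfin s hs using 1
      ext t
      exact ⟨fun h' => ⟨h', h t h'⟩, fun h' => h'.1⟩
    have hG : IsFin M {t | t ∈ T ∧ (r t t₀ ∧ ¬ r t s)} :=
      (hfin t₀ ht₀).subset (Def.isInt_ofPred (by fun_prop)).out fun t h => ⟨h.1, h.2.1⟩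
    obtain ⟨m, ⟨hm, hm1, hm2⟩, hmm⟩ := hmin _ hG
      ⟨t₀, ht₀, (ht t₀ t₀).elim _root_.id _root_.id, hst₀⟩
    refine ⟨m, (hNx _ _).2 ⟨hs, hm, hm2, fun u hu => ?_⟩⟩
    by_cases h : r u s
    · exact Or.inl h
    · right
      rcases ht u t₀ with h' | h'
      · exact hmm u ⟨hu, h', h⟩
      · exact htr _ _ _ hm1 h'
  obtain ⟨a₀, ha₀T, ha₀⟩ : ∃ a ∈ T, ∀ t, t ∈ T → r a t := by
    obtain ⟨s, hs⟩ : T.Nonempty := by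
      rw [Set.nonempty_iff_ne_empty]
      rintro rfl
      exact hT isFin_empty
    obtain ⟨m, ⟨hm, hms⟩, hmm⟩ := hmin _ (hfin s hs) ⟨s, hs, (ht s s).elim _root_.id _root_.id⟩
    refine ⟨m, hm, fun t htT => ?_⟩
    rcases ht t s with h | h
    · exact hmm t ⟨htT, h⟩
    · exact htr _ _ _ hms h
  -- `E` consists of the even levels: the least set that contains the lowest level and is closed
  -- under going up two levels.
  obtain ⟨E, hE⟩ : ∃ E : Set α, ∀ a, a ∈ E ↔ ∀ D : Set α, Internal M D →
      (∀ a, a ∈ T → (∀ t, t ∈ T → r a t) → a ∈ D) →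
      (∀ s, s ∈ D → ∀ t u, Nx s t → Nx t u → u ∈ D) → a ∈ D := ⟨{a | _}, fun _ => Iff.rfl⟩
  have hEi : IsInt M E := by
    refine Def.isInt_set ?_
    simp only [hE]
    fun_prop
  have hE1 : ∀ a, a ∈ T → (∀ t, t ∈ T → r a t) → a ∈ E := fun a ha ham =>
    (hE a).2 fun D _ h _ => h a ha ham
  have hE2 : ∀ s, s ∈ E → ∀ t u, Nx s t → Nx t u → u ∈ E := fun s hs t u hst htu =>
    (hE u).2 fun D hD h1 h2 => h2 s ((hE s).1 hs D hD h1 h2) t u hst htu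
  have hE3 : ∀ D : Set α, IsInt M D → (∀ a, a ∈ T → (∀ t, t ∈ T → r a t) → a ∈ D) →
      (∀ s, s ∈ D → ∀ t u, Nx s t → Nx t u → u ∈ D) → ∀ a ∈ E, a ∈ D := fun D hD h1 h2 a ha =>
    (hE a).1 ha D hD.out h1 h2
  have hET : ∀ a ∈ E, a ∈ T := hE3 T inferInstance (fun a ha _ => ha)
    fun s _ t u _ htu => ((hNx _ _).1 htu).2.1
  have hlt : ∀ s t, Nx s t → ¬ r t s := fun s t h => ((hNx _ _).1 h).2.2.1
  have hbt : ∀ s t, Nx s t → ∀ u ∈ T, r u s ∨ r t u := fun s t h => ((hNx _ _).1 h).2.2.2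
  have hl : ∀ s t, Nx s t → s ∈ T := fun s t h => ((hNx _ _).1 h).1
  have hr' : ∀ s t, Nx s t → t ∈ T := fun s t h => ((hNx _ _).1 h).2.1
  -- The level after an even one is not even. In both cases of this induction, a second use of the
  -- minimality of `E` shows that `E` without the level of `t` is still closed.
  have hdisj : ∀ s ∈ E, s ∈ {s | s ∈ E ∧ ∀ t, Nx s t → t ∉ E} := by
    refine hE3 _ (Def.isInt_ofPred (by fun_prop)) ?_ ?_
    · intro a haT ha
      refine ⟨hE1 a haT ha, fun t hat htE => ?_⟩
      have := hE3 {v | v ∈ E ∧ ¬ (r v t ∧ r t v)} (Def.isInt_ofPred (by fun_prop)) ?_ ?_ t htE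
      · exact this.2 ⟨(ht t t).elim _root_.id _root_.id, (ht t t).elim _root_.id _root_.id⟩
      · intro b hbT hb
        exact ⟨hE1 b hbT hb, fun h => hlt _ _ hat (htr _ _ _ h.2 (hb a haT))⟩
      · rintro v ⟨hv, -⟩ w u hvw hwu
        refine ⟨hE2 v hv w u hvw hwu, fun h => ?_⟩
        rcases hbt _ _ hat w (hl _ _ hwu) with h1 | h1
        · exact hlt _ _ hvw (htr _ _ _ h1 (ha v (hl _ _ hvw)))
        · exact hlt _ _ hwu (htr _ _ _ h.1 h1)
    · rintro s ⟨hs, hsE⟩ t₁ u hst htu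
      refine ⟨hE2 s hs _ _ hst htu, fun t hut htE => ?_⟩
      have := hE3 {v | v ∈ E ∧ ¬ (r v t ∧ r t v)} (Def.isInt_ofPred (by fun_prop)) ?_ ?_ t htE
      · exact this.2 ⟨(ht t t).elim _root_.id _root_.id, (ht t t).elim _root_.id _root_.id⟩
      · intro b hbT hb
        exact ⟨hE1 b hbT hb, fun h => hlt _ _ hut (htr _ _ _ h.2 (hb u (hl _ _ hut)))⟩
      · rintro v ⟨hv, -⟩ w x hvw hwx
        refine ⟨hE2 v hv w x hvw hwx, fun h => ?_⟩
        have hwu : r w u := (hbt _ _ hut w (hl _ _ hwx)).resolve_right fun h1 =>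
          hlt _ _ hwx (htr _ _ _ h.1 h1)
        have huw : r u w := (hbt _ _ hwx u (hl _ _ hut)).resolve_right fun h1 =>
          hlt _ _ hut (htr _ _ _ h.2 h1)
        have hvt : r v t₁ := (hbt _ _ htu v (hl _ _ hvw)).resolve_right fun h1 =>
          hlt _ _ hvw (htr _ _ _ hwu h1)
        have htv : r t₁ v := (hbt _ _ hvw t₁ (hl _ _ htu)).resolve_right fun h1 =>
          hlt _ _ htu (htr _ _ _ huw h1)
        -- If going up two levels from `v ∈ E` reaches the level of `t`, then `v` is on the level of
        -- `t₁`, so it is a successor of `s` in `E`, contrary to the induction hypothesis.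
        refine hsE v ((hNx _ _).2 ⟨hl _ _ hst, hl _ _ hvw, fun h1 => ?_, fun y hy => ?_⟩) hv
        · exact hlt _ _ hst (htr _ _ _ htv h1)
        · exact (hbt _ _ hst y hy).imp_right fun h1 => htr _ _ _ hvt h1
  have hle : ∀ s t, Nx s t → r s t := fun s t h => (ht s t).resolve_right (hlt s t h)
  have hE0 : a₀ ∈ E := hE1 a₀ ha₀T ha₀
  rcases hA E hEi.out with hf | hf
  -- A finite `E` has a greatest element, but the element two levels higher is also in `E`.
  · obtain ⟨e, he, hmax⟩ := hf.exists_max hr ht htr ⟨a₀, hE0⟩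
    obtain ⟨t, het⟩ := hnext e (hET e he)
    obtain ⟨u, htu⟩ := hnext t (hr' _ _ het)
    exact hlt _ _ het (htr _ _ _ (hle _ _ htu) (hmax u (hE2 e he t u het htu)))
  -- If the complement of `E` is finite, so are the odd levels, and their greatest element is
  -- exceeded in the same way.
  · have hO : IsFin M {t | ∃ s, s ∈ E ∧ Nx s t} :=
      hf.subset (Def.isInt_ofPred (by fun_prop)).out fun t ⟨s, hs, hst⟩ => (hdisj s hs).2 t hst
    obtain ⟨b, hb⟩ := hnext a₀ ha₀T
    obtain ⟨o, ⟨s, hs, hso⟩, hmax⟩ := hO.exists_max hr ht htr ⟨b, a₀, hE0, hb⟩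
    obtain ⟨u, hou⟩ := hnext o (hr' _ _ hso)
    obtain ⟨p, hup⟩ := hnext u (hr' _ _ hou)
    exact hlt _ _ hup (htr _ _ _ (hmax p ⟨u, hE2 s hs o u hso hou, hup⟩) (hle _ _ hou))

variable {R : M} [RealField R]

/-- A nonnegative summable function on an amorphous set has finite support. -/
theorem isFin_support_of_bounded (hA : ∀ S : Set α, Internal M S → IsFin M S ∨ IsFin M Sᶜ)
    {g : α → El R} (hg : Def M g) (h0 : ∀ a, 0 ≤ g a) {c : El R}
    (hc : ∀ F, IsFin M F → fsum g F ≤ c) : IsFin M {a | g a ≠ 0} := by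
  have hi : IsInt M {a | g a ≠ 0} := Def.isInt_ofPred (by fun_prop)
  by_contra hinf
  -- Larger values come first, so the initial segment of `s` consists of the points where `g` is at
  -- least `g s > 0`; boundedness of the sums makes it finite.
  refine false_of_preorder hA hinf (r := fun a b => g b ≤ g a) (by fun_prop)
    (fun a b => le_total _ _) (fun a b c h h' => h'.trans h) fun s hs => ?_
  have : IsInt M {t | t ∈ {a | g a ≠ 0} ∧ g s ≤ g t} := Def.isInt_ofPred (by fun_prop)
  exact isFin_of_bounded hg (lt_of_le_of_ne (h0 s) (Ne.symm hs)) (fun a ha => ha.2)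
    fun F hF _ => hc F hF

end Amorphous

/-! ### The space `ℓ²` over an amorphous set -/

section Ell2

variable {M : Type u} [Membership M M] [ZFModel M] {R : M} [RealField R] {X : M}

/-- The square of the absolute value. -/
def nsq (z : Cplx R) : El R := z.re ^ 2 + z.im ^ 2

theorem nsq_nonneg (z : Cplx R) : 0 ≤ nsq z := by
  unfold nsq
  positivity

theorem nsq_eq_zero {z : Cplx R} : nsq z = 0 ↔ z = 0 := by
  unfold nsq
  constructor
  · intro h
    have h1 := sq_nonneg z.re
    have h2 := sq_nonneg z.im
    have h3 : z.re ^ 2 = 0 := by linarith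
    have h4 : z.im ^ 2 = 0 := by linarith
    exact QuadraticAlgebra.ext (by simpa using h3) (by simpa using h4)
  · rintro rfl
    simp

@[fun_prop]
theorem Def.nsq {γ : Type*} [Coded M γ] [Rep M γ] {f : γ → Cplx R} (hf : Def M f) :
    Def M fun x => nsq (f x) := by
  unfold ZFAnalysis.nsq
  fun_prop

/-- On an amorphous set, the square summable functions are those of finite support. -/
theorem mem_ell2_iff (hX : IsAmorphous X) {η : El X → Cplx R} :
    η ∈ ell2 R X ↔ Internal M η ∧ IsFin M {x | η x ≠ 0} := by
  constructor
  · rintro ⟨hη, c, hc⟩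
    have hd : Def M η := Def.of_isInt ⟨hη⟩
    refine ⟨hη, ?_⟩
    have := isFin_support_of_bounded hX.2 (g := fun x => nsq (η x)) (by fun_prop)
      (fun x => nsq_nonneg _) (c := c) fun F hF => by
        obtain ⟨s, hs, hsc⟩ := hc F hF
        rwa [← (isFinSum_iff_eq (f := fun x => nsq (η x)) (by fun_prop) hF).1 hs]
    simpa only [ne_eq, nsq_eq_zero] using this
  · rintro ⟨hη, hfin⟩
    have hd : Def M η := Def.of_isInt ⟨hη⟩
    have hi : IsInt M {x | η x ≠ 0} := Def.isInt_ofPred (by fun_prop)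
    refine ⟨hη, fsum (fun x => nsq (η x)) {x | η x ≠ 0}, fun F hF => ⟨fsum (fun x => nsq (η x)) F,
      isFinSum_fsum (by fun_prop) hF, ?_⟩⟩
    have hFi : IsInt M F := ⟨hF.internal⟩
    rw [← fsum_inter (G := {x | η x ≠ 0}) (by fun_prop) hF fun x _ hx => ?_]
    · exact fsum_mono (by fun_prop) (hfin.subset (IsInt.internal _) Set.inter_subset_right) hfin
        Set.inter_subset_right fun x => nsq_nonneg _
    · rw [nsq_eq_zero]
      simpa using hx

/-- The net of finite sums is constant from `T` on, so convergence needs no analysis. -/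
theorem hasSumIn_iff {f : El X → El R} (hf : Def M f) {T : Set (El X)} (hT : IsFin M T)
    (h0 : ∀ x, x ∉ T → f x = 0) {s : El R} : HasSumIn f s ↔ s = fsum f T := by
  have hTi : IsInt M T := ⟨hT.internal⟩
  constructor
  · intro h
    by_contra hne
    obtain ⟨F₀, hF₀, hF⟩ := h |fsum f T - s| (abs_pos.2 (sub_ne_zero.2 (Ne.symm hne)))
    obtain ⟨t, ht, hlt⟩ := hF (F₀ ∪ T) (hF₀.union hT) Set.subset_union_left
    rw [(isFinSum_iff_eq hf (hF₀.union hT)).1 ht, ← fsum_subset hf hT (hF₀.union hT)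
      Set.subset_union_right fun a _ ha => h0 a ha] at hlt
    exact lt_irrefl _ hlt
  · rintro rfl ε hε
    refine ⟨T, hT, fun F hF hTF => ⟨fsum f F, isFinSum_fsum hf hF, ?_⟩⟩
    rw [fsum_subset hf hT hF hTF fun a _ ha => h0 a ha, sub_self, abs_zero]
    exact hε

end Ell2

section Ell2

variable {M : Type u} [Membership M M] [ZFModel M] {R : M} [RealField R] {X Z : M}

/-- The form of separation for sets of sets or of functions, where elements outside the model must
first be discarded. -/
theorem isInt_ofPred_internal {β : Type*} [Coded M β] [Rep M β] [Sm M β] {P : β → Prop}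
    (hP : Def M P) : IsInt M {b | Internal M b ∧ P b} :=
  Def.isInt_const (f := fun _ : Prop => {b : β | Internal M b ∧ P b}) (by fun_prop) True

theorem ell2_eq (hX : IsAmorphous X) :
    ell2 R X = {η | Internal M η ∧ IsFin M {x | η x ≠ 0}} := by
  ext η
  exact mem_ell2_iff hX

theorem isInt_ell2 (hX : IsAmorphous X) : IsInt M (ell2 R X) := by
  rw [ell2_eq hX]
  exact isInt_ofPred_internal (by fun_prop)

theorem ell2.def {η : El X → Cplx R} (h : η ∈ ell2 R X) : Def M η := Def.of_isInt ⟨h.1⟩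

/-- A function vanishing outside a finite set is square summable. -/
theorem mem_ell2_of_isFin (hX : IsAmorphous X) {η : El X → Cplx R} (hη : Def M η) {T : Set (El X)}
    (hT : IsFin M T) (h0 : ∀ x, x ∉ T → η x = 0) : η ∈ ell2 R X :=
  (mem_ell2_iff hX).2 ⟨hη.isInt.out, hT.subset (Def.isInt_ofPred (by fun_prop)).out
    fun x hx => by_contra fun h => hx (h0 x h)⟩

theorem ell2.isFin (hX : IsAmorphous X) {η : El X → Cplx R} (h : η ∈ ell2 R X) :
    IsFin M {x | η x ≠ 0} := ((mem_ell2_iff hX).1 h).2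

theorem zero_mem_ell2 (hX : IsAmorphous X) : (0 : El X → Cplx R) ∈ ell2 R X :=
  mem_ell2_of_isFin hX (Def.const (0 : Cplx R)) isFin_empty fun _ _ => rfl

theorem add_mem_ell2 (hX : IsAmorphous X) {η ζ : El X → Cplx R} (hη : η ∈ ell2 R X)
    (hζ : ζ ∈ ell2 R X) : η + ζ ∈ ell2 R X :=
  mem_ell2_of_isFin hX ((ell2.def hη).cadd (ell2.def hζ))
    ((ell2.isFin hX hη).union (ell2.isFin hX hζ)) fun x hx => by
      simp only [Set.mem_union, Set.mem_ofPred_eq, not_or, not_not] at hx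
      simp [hx]

theorem smul_mem_ell2 (hX : IsAmorphous X) (c : Cplx R) {η : El X → Cplx R} (hη : η ∈ ell2 R X) :
    c • η ∈ ell2 R X :=
  mem_ell2_of_isFin hX ((Def.const c).cmul (ell2.def hη)) (ell2.isFin hX hη) fun x hx => by
    simp only [Set.mem_ofPred_eq, not_not] at hx
    simp [hx]

theorem sub_mem_ell2 (hX : IsAmorphous X) {η ζ : El X → Cplx R} (hη : η ∈ ell2 R X)
    (hζ : ζ ∈ ell2 R X) : η - ζ ∈ ell2 R X := by
  have := add_mem_ell2 hX hη (smul_mem_ell2 hX (-1) hζ)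
  rwa [neg_one_smul, ← sub_eq_add_neg] at this

theorem re_mul_star (a b : Cplx R) : (a * star b).re = a.re * b.re + a.im * b.im := by
  simp

theorem im_mul_star (a b : Cplx R) : (a * star b).im = a.im * b.re - a.re * b.im := by
  simp
  ring

theorem hasInner_iff {η ζ : El X → Cplx R} (hη : Def M η) (hζ : Def M ζ) {T : Set (El X)}
    (hT : IsFin M T) (h0 : ∀ x, x ∉ T → η x = 0 ∨ ζ x = 0) {c : Cplx R} : HasInner η ζ c ↔
      c.re = fsum (fun x => (η x).re * (ζ x).re + (η x).im * (ζ x).im) T ∧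
      c.im = fsum (fun x => (η x).im * (ζ x).re - (η x).re * (ζ x).im) T := by
  unfold HasInner
  simp only [re_mul_star, im_mul_star]
  rw [hasSumIn_iff (by fun_prop) hT, hasSumIn_iff (by fun_prop) hT]
  · intro x hx
    rcases h0 x hx with h | h <;> simp [h]
  · intro x hx
    rcases h0 x hx with h | h <;> simp [h]

theorem hasInner_self_iff (hX : IsAmorphous X) {η : El X → Cplx R} (hη : η ∈ ell2 R X)
    {c : Cplx R} : HasInner η η c ↔
      c.re = fsum (fun x => nsq (η x)) {x | η x ≠ 0} ∧ c.im = 0 := by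
  have hd := ell2.def hη
  rw [hasInner_iff hd hd (ell2.isFin hX hη) fun x hx => Or.inl (by simpa using hx)]
  have h1 : (fun x => (η x).re * (η x).re + (η x).im * (η x).im) = fun x => nsq (η x) := by
    funext x
    simp only [nsq]
    ring
  have h2 : (fun x => (η x).im * (η x).re - (η x).re * (η x).im) = fun x => 0 := by
    funext x
    ring
  rw [h1, h2, fsum_zero (ell2.isFin hX hη)]

/-- The norm dominates each coordinate. Closedness of the subspaces below uses norm approximation
only through this pointwise bound. -/
theorem NormLT.nsq_lt (hX : IsAmorphous X) {η : El X → Cplx R} (hη : η ∈ ell2 R X) {ε : El R}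
    (h : NormLT η ε) (x : El X) : nsq (η x) < ε ^ 2 := by
  obtain ⟨c, hc, hlt⟩ := h
  rw [((hasInner_self_iff hX hη).1 hc).1] at hlt
  have hd := ell2.def hη
  by_cases hx : η x = 0
  · rw [hx, nsq_eq_zero.2 rfl]
    exact (fsum_nonneg (by fun_prop) (ell2.isFin hX hη) fun x _ => nsq_nonneg _).trans_lt hlt
  · exact (le_fsum (f := fun x => nsq (η x)) (by fun_prop) (ell2.isFin hX hη)
      (fun x => nsq_nonneg _) hx).trans_lt hlt

theorem nonpos_of_forall_sq {v : El R} (h : ∀ ε : El R, 0 < ε → v ≤ 4 * ε ^ 2) : v ≤ 0 := by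
  by_contra! hv
  -- With this `ε` one has `4 ε² ≤ 4 · (1/2) · (v/4) = v/2 < v`.
  have h1 := h (min (1 / 2) (v / 4)) (by positivity)
  have h2 : min (1 / 2) (v / 4) ≤ (1 / 2 : El R) := min_le_left _ _
  have h3 : min (1 / 2) (v / 4) ≤ v / 4 := min_le_right _ _
  have h4 : 0 < min (1 / 2) (v / 4) := by positivity
  nlinarith

theorem nsq_sub_le (a b c : Cplx R) : nsq (a - b) ≤ 2 * (nsq (a - c) + nsq (b - c)) := by
  simp only [nsq, QuadraticAlgebra.re_sub, QuadraticAlgebra.im_sub]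
  nlinarith [sq_nonneg (a.re - c.re + (b.re - c.re)), sq_nonneg (a.im - c.im + (b.im - c.im))]

/-- The square summable functions invariant under a map of the model form a closed subspace. -/
theorem isClosedSubspace_of_forall (hX : IsAmorphous X) {S : Set (El X → Cplx R)} {σ : El X → El X}
    (hσ : Def M σ) (hS : ∀ η, η ∈ S ↔ η ∈ ell2 R X ∧ ∀ x, η (σ x) = η x) :
    IsClosedSubspace S where
  internal := by
    have := isInt_ell2 (R := R) hX
    have h1 : S = {η | Internal M η ∧ (η ∈ ell2 R X ∧ ∀ x, η (σ x) = η x)} := by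
      ext η
      rw [hS]
      exact ⟨fun h => ⟨h.1.1, h⟩, fun h => h.2⟩
    rw [h1]
    exact (isInt_ofPred_internal (by fun_prop)).out
  subset := fun η h => ((hS η).1 h).1
  zero_mem := (hS 0).2 ⟨zero_mem_ell2 hX, fun x => rfl⟩
  add_mem := fun η hη ζ hζ => (hS _).2 ⟨add_mem_ell2 hX ((hS _).1 hη).1 ((hS _).1 hζ).1, fun x => by
    simp [((hS _).1 hη).2, ((hS _).1 hζ).2]⟩
  smul_mem := fun c η hη => (hS _).2 ⟨smul_mem_ell2 hX c ((hS _).1 hη).1, fun x => by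
    simp [((hS _).1 hη).2]⟩
  closed := by
    intro η hη h
    refine (hS _).2 ⟨hη, fun x => ?_⟩
    -- Both values of `η` are within `ε` of the common value `ζ (σ x) = ζ x`, whence the bound `2
    -- (ε² + ε²)`.
    have : nsq (η (σ x) - η x) ≤ 0 := nonpos_of_forall_sq fun ε hε => by
      obtain ⟨ζ, hζ, hlt⟩ := h ε hε
      have hm := sub_mem_ell2 hX hη ((hS _).1 hζ).1
      have h1 := hlt.nsq_lt hX hm (σ x)
      have h2 := hlt.nsq_lt hX hm x
      have h3 := nsq_sub_le (η (σ x)) (η x) (ζ x)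
      simp only [Pi.sub_apply] at h1 h2
      rw [((hS _).1 hζ).2] at h1
      linarith
    exact sub_eq_zero.1 (nsq_eq_zero.1 (le_antisymm this (nsq_nonneg _)))

/-- A closed hyperplane, used to show that an orthonormal set vanishing at `x` does not span the
orthogonal complement. -/
theorem isClosedSubspace_vanishing (hX : IsAmorphous X) (x : El X) :
    IsClosedSubspace {η | η ∈ ell2 R X ∧ η x = 0} where
  internal := by
    have := isInt_ell2 (R := R) hX
    have h1 : {η | η ∈ ell2 R X ∧ η x = 0} =
        {η | Internal M η ∧ (η ∈ ell2 R X ∧ ∀ y, y = x → η y = 0)} := by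
      ext η
      exact ⟨fun h => ⟨h.1.1, h.1, fun y hy => hy ▸ h.2⟩, fun h => ⟨h.2.1, h.2.2 x rfl⟩⟩
    rw [h1]
    exact (isInt_ofPred_internal (by fun_prop)).out
  subset := fun η h => h.1
  zero_mem := ⟨zero_mem_ell2 hX, rfl⟩
  add_mem := fun η hη ζ hζ => ⟨add_mem_ell2 hX hη.1 hζ.1, by simp [hη.2, hζ.2]⟩
  smul_mem := fun c η hη => ⟨smul_mem_ell2 hX c hη.1, by simp [hη.2]⟩
  closed := by
    intro η hη h
    refine ⟨hη, ?_⟩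
    have : nsq (η x) ≤ 0 := nonpos_of_forall_sq fun ε hε => by
      obtain ⟨ζ, hζ, hlt⟩ := h ε hε
      have h1 := hlt.nsq_lt hX (sub_mem_ell2 hX hη hζ.1) x
      simp only [Pi.sub_apply, hζ.2, sub_zero] at h1
      have := sq_nonneg ε
      linarith
    exact nsq_eq_zero.1 (le_antisymm this (nsq_nonneg _))

end Ell2

/-! ### Two-to-one maps and the symmetric subspace -/

section Pairs

variable {M : Type u} [Membership M M] [ZFModel M] {R : M} [RealField R] {X Z : M}

/-- A map `π` of the model all of whose fibres are two-element sets `{x, σ x}`. -/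
structure IsTwoToOne (π : El X → El Z) (σ : El X → El X) : Prop where
  def_proj : Def M π
  def_swap : Def M σ
  proj_swap : ∀ x, π (σ x) = π x
  swap_ne : ∀ x, σ x ≠ x
  eq_or : ∀ x y, π y = π x → y = x ∨ y = σ x
  surj : ∀ z, ∃ x, π x = z

namespace IsTwoToOne

variable {π : El X → El Z} {σ : El X → El X}

theorem swap_swap (h : IsTwoToOne π σ) (x : El X) : σ (σ x) = x := by
  rcases h.eq_or x (σ (σ x)) (by rw [h.proj_swap, h.proj_swap]) with h' | h'
  · exact h'
  · exact (h.swap_ne _ h').elim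

theorem fibre_eq (h : IsTwoToOne π σ) (x : El X) : {y | π y = π x} = {x, σ x} := by
  ext y
  constructor
  · exact fun hy => h.eq_or x y hy
  · rintro (rfl | rfl)
    exacts [rfl, h.proj_swap x]

theorem isFin_pair (x y : El X) : IsFin M ({x, y} : Set (El X)) := (isFin_singleton y).insert x

theorem isFin_preimage (h : IsTwoToOne π σ) {F : Set (El Z)} (hF : IsFin M F) :
    IsFin M {x | π x ∈ F} := by
  refine hF.preimage h.def_proj fun z _ => ?_
  obtain ⟨x, rfl⟩ := h.surj z
  rw [h.fibre_eq]
  exact isFin_pair _ _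

theorem fsum_pair {f : El X → El R} (hf : Def M f) {x y : El X} (hxy : x ≠ y) :
    fsum f {x, y} = f x + f y := by
  rw [fsum_insert hf (isFin_singleton y) hxy, fsum_singleton hf, add_comm]

/-- Each fibre contributes its two points; this is the factor that the isometry has to compensate.
-/
theorem fsum_preimage (h : IsTwoToOne π σ) {F : Set (El Z)} (hF : IsFin M F) {f : El Z → El R}
    (hf : Def M f) : fsum (fun x => f (π x)) {x | π x ∈ F} = 2 * fsum f F := by
  have hπ := h.def_proj
  refine IsFin.induction (C := fun F : Set (El Z) =>
    fsum (fun x => f (π x)) {x | π x ∈ F} = 2 * fsum f F) (by fun_prop) ?_ ?_ hF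
  · have : {x | π x ∈ (∅ : Set (El Z))} = ∅ := rfl
    rw [this, fsum_empty (by fun_prop), fsum_empty hf, mul_zero]
  · intro G z hG hz ih
    obtain ⟨x, rfl⟩ := h.surj z
    have h1 : {y | π y ∈ insert (π x) G} = insert x (insert (σ x) {y | π y ∈ G}) := by
      ext y
      constructor
      · rintro (hy | hy)
        · rcases h.eq_or x y hy with rfl | rfl
          exacts [Or.inl rfl, Or.inr (Or.inl rfl)]
        · exact Or.inr (Or.inr hy)
      · rintro (rfl | rfl | hy)
        · exact Or.inl rfl
        · exact Or.inl (h.proj_swap x)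
        · exact Or.inr hy
    rw [h1, fsum_insert (by fun_prop) ((h.isFin_preimage hG).insert _), fsum_insert (by fun_prop)
      (h.isFin_preimage hG), fsum_insert hf hG hz, ih, h.proj_swap]
    · ring
    · intro hx
      rw [Set.mem_ofPred_eq, h.proj_swap] at hx
      exact hz hx
    · rintro (hx | hx)
      · exact h.swap_ne x hx.symm
      · exact hz hx

variable (R) in
/-- The square summable functions that are constant on the fibres. -/
def symm (σ : El X → El X) : Set (El X → Cplx R) := {η | η ∈ ell2 R X ∧ ∀ x, η (σ x) = η x}

theorem isClosedSubspace_symm (h : IsTwoToOne π σ) (hX : IsAmorphous X) :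
    IsClosedSubspace (symm R σ) :=
  isClosedSubspace_of_forall hX h.def_swap fun _ => Iff.rfl

variable (R) in
/-- A complex number of absolute value `1 / √2`. -/
def halfUnit : Cplx R := ⟨1 / 2, 1 / 2⟩

/-- The number `(1 + i)/2` has squared absolute value `1/2` and inverse `1 - i`, so that no square
root of `2` has to be constructed in the model. -/
theorem halfUnit_mul : halfUnit R * ⟨1, -1⟩ = 1 := by
  refine QuadraticAlgebra.ext ?_ ?_
  · rw [QuadraticAlgebra.re_one]
    simp [halfUnit]
    norm_num
  · rw [QuadraticAlgebra.im_one]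
    simp [halfUnit]

theorem lift_mem (h : IsTwoToOne π σ) (hX : IsAmorphous X) (hZ : IsAmorphous Z)
    {η : El Z → Cplx R} (hη : η ∈ ell2 R Z) :
    (fun x => halfUnit R * η (π x)) ∈ symm R σ := by
  have hπ := h.def_proj
  have hd := ell2.def hη
  refine ⟨mem_ell2_of_isFin hX (by fun_prop) (h.isFin_preimage (ell2.isFin hZ hη)) fun x hx => ?_,
    fun x => by simp only [h.proj_swap]⟩
  simp only [Set.mem_ofPred_eq, not_not] at hx
  simp [hx]

/-- Pulling back along `π` doubles inner products and the scalar `halfUnit` halves them.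
Surjectivity holds because a symmetric function descends to `Z`. -/
theorem isIsomorphic (h : IsTwoToOne π σ) (hX : IsAmorphous X) (hZ : IsAmorphous Z) :
    IsIsomorphic (ell2 R Z) (symm R σ) := by
  have hπ := h.def_proj
  have hi1 := isInt_ell2 (R := R) hZ
  have hi2 : IsInt M (symm R σ) := ⟨(h.isClosedSubspace_symm (R := R) hX).internal⟩
  refine ⟨fun η => ⟨fun x => halfUnit R * η.1 (π x), h.lift_mem hX hZ η.2⟩, ?_, ⟨?_, ?_⟩, ?_, ?_, ?_⟩
  · refine (Def.isInt (Def.of_val (Def.lam (f := fun (η : ell2 R Z) x => halfUnit R * η.1 (π x)) ?_))).out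
    fun_prop
  · intro η ζ hηζ
    refine Subtype.ext (funext fun z => ?_)
    obtain ⟨x, rfl⟩ := h.surj z
    have := congrFun (congrArg Subtype.val hηζ) x
    have h2 := congrArg (fun w => ⟨1, -1⟩ * w) this
    simp only [← mul_assoc] at h2
    rw [mul_comm _ (halfUnit R), halfUnit_mul, one_mul, one_mul] at h2
    exact h2
  · rintro ⟨ξ, hξ, hs⟩
    -- The section `s` exists only in the ambient logic and need not belong to the model. The
    -- symmetric function `ξ` does not notice the choice, so `ξ ∘ s` has a definable graph.
    choose s hs' using h.surj
    have hd := ell2.def hξ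
    have hval : ∀ x, ξ (s (π x)) = ξ x := by
      intro x
      rcases h.eq_or x (s (π x)) (hs' _) with h' | h'
      · rw [h']
      · rw [h', hs]
    have hdef : Def M fun z => (⟨1, -1⟩ : Cplx R) * ξ (s z) := by
      refine Def.of_graph (Def.of_iff (P := fun p : El Z × Cplx R =>
        ∃ x, π x = p.1 ∧ p.2 = (⟨1, -1⟩ : Cplx R) * ξ x) (by fun_prop) fun p => ?_)
      constructor
      · exact fun h' => ⟨s p.1, hs' _, h'⟩
      · rintro ⟨x, hx, h'⟩
        rw [h', ← hx, hval]
    refine ⟨⟨fun z => (⟨1, -1⟩ : Cplx R) * ξ (s z), mem_ell2_of_isFin hZ hdef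
      ((ell2.isFin hX hξ).image hπ) fun z hz => ?_⟩, Subtype.ext (funext fun x => ?_)⟩
    · have : ξ (s z) = 0 := by
        by_contra h'
        exact hz ⟨s z, h', hs' z⟩
      rw [this, mul_zero]
    · dsimp only
      rw [← mul_assoc, halfUnit_mul, one_mul, hval]
  · intro η ζ θ hθ
    funext x
    simp only [Pi.add_apply, hθ, mul_add]
  · intro c η θ hθ
    funext x
    simp only [Pi.smul_apply, hθ, smul_eq_mul]
    ring
  · intro η ζ c
    have hη := ell2.def η.2
    have hζ := ell2.def ζ.2
    have hfin := ell2.isFin hZ η.2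
    dsimp only
    rw [hasInner_iff hη hζ hfin fun z hz => Or.inl (by simpa using hz),
      hasInner_iff (by fun_prop) (by fun_prop) (h.isFin_preimage hfin) fun z hz =>
        Or.inl (by simp only [Set.mem_ofPred_eq, not_not] at hz; simp [hz])]
    -- Here `f` is the summand for `η`, `ζ` and `g` the one for their multiples by `halfUnit`; it is
    -- applied to real and imaginary parts.
    have key : ∀ f g : El Z → El R, Def M f → Def M g → (∀ z, f z = 2 * g z) →
        fsum (fun x => g (π x)) {x | π x ∈ {z | η.1 z ≠ 0}} = fsum f {z | η.1 z ≠ 0} := by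
      intro f g hf hg hfg
      rw [h.fsum_preimage hfin hg, ← fsum_mul_left hg hfin]
      exact fsum_congr (by fun_prop) hf hfin fun z _ => (hfg z).symm
    have e1 := key (fun z => (η.1 z).re * (ζ.1 z).re + (η.1 z).im * (ζ.1 z).im)
      (fun z => (halfUnit R * η.1 z).re * (halfUnit R * ζ.1 z).re +
        (halfUnit R * η.1 z).im * (halfUnit R * ζ.1 z).im) (by fun_prop) (by fun_prop) fun z => by
          simp [halfUnit]
          ring
    have e2 := key (fun z => (η.1 z).im * (ζ.1 z).re - (η.1 z).re * (ζ.1 z).im)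
      (fun z => (halfUnit R * η.1 z).im * (halfUnit R * ζ.1 z).re -
        (halfUnit R * η.1 z).re * (halfUnit R * ζ.1 z).im) (by fun_prop) (by fun_prop) fun z => by
          simp [halfUnit]
          ring
    rw [e1, e2]

end IsTwoToOne

end Pairs

/-! ### Graphs and injections on strongly amorphous sets -/

section Rigid

variable {M : Type u} [Membership M M] [ZFModel M] {Z : M}

/-- On a strongly rigid set, an equivalence relation with finite classes has only finitely many
elements in classes that are not singletons. -/
theorem IsStronglyRigid.isFin (hZ : IsStronglyRigid Z) {e : El Z → El Z → Prop}
    (he : Def M fun p : El Z × El Z => e p.1 p.2) (heq : Equivalence e)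
    (hfin : ∀ z, IsFin M {w | e z w}) : IsFin M {z | ∃ w, w ≠ z ∧ e z w} := by
  have hPi : IsInt M {C : Set (El Z) | Internal M C ∧ ∃ z, C = {w | e z w}} :=
    isInt_ofPred_internal (by fun_prop)
  have hcls : ∀ z, {w | e z w} ∈ {C : Set (El Z) | Internal M C ∧ ∃ z, C = {w | e z w}} :=
    fun z => ⟨(hfin z).internal, z, rfl⟩
  have hP : Setoid.IsPartition {C : Set (El Z) | Internal M C ∧ ∃ z, C = {w | e z w}} := by
    refine ⟨?_, fun z => ⟨{w | e z w}, ⟨hcls z, heq.refl z⟩, ?_⟩⟩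
    · rintro ⟨-, z, hz⟩
      have : z ∈ (∅ : Set (El Z)) := hz ▸ heq.refl z
      exact this
    · rintro C ⟨⟨-, y, rfl⟩, hz⟩
      ext w
      exact ⟨fun hw => heq.trans (heq.symm hz) hw, fun hw => heq.trans hz hw⟩
  have h1 := hZ.2 _ hPi.out hP
  have hDi : IsInt M {C ∈ {C : Set (El Z) | Internal M C ∧ ∃ z, C = {w | e z w}} |
      ¬ ∃ a, C = {a}} := by
    have := isInt_ofPred_internal (M := M) (β := Set (El Z))
      (P := fun C => C ∈ {C : Set (El Z) | Internal M C ∧ ∃ z, C = {w | e z w}} ∧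
        ¬ ∃ a, C = {a}) (by fun_prop)
    convert! this using 1
    ext C
    exact ⟨fun h => ⟨h.1.1, h⟩, fun h => h.2⟩
  rw [← isFin_univ_coe] at h1
  have h2 := h1.biUnion (r := fun C z => z ∈ C.1) (by fun_prop) fun C _ => by
    obtain ⟨C, ⟨⟨-, z, rfl⟩, -⟩⟩ := C
    exact hfin z
  refine h2.subset (Def.isInt_ofPred (by fun_prop)).out ?_
  rintro z ⟨w, hwz, hzw⟩
  refine ⟨⟨{w | e z w}, hcls z, ?_⟩, trivial, heq.refl z⟩
  rintro ⟨a, ha⟩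
  have h3 : w ∈ ({a} : Set (El Z)) := ha ▸ hzw
  have h4 : z ∈ ({a} : Set (El Z)) := ha ▸ heq.refl z
  exact hwz (h3.trans h4.symm)

/-- A locally finite graph on a strongly amorphous set has only finitely many edges that are not
loops. -/
theorem IsStronglyAmorphous.isFin (hZ : IsStronglyAmorphous Z) {E : El Z → El Z → Prop}
    (hE : Def M fun p : El Z × El Z => E p.1 p.2) (hsymm : ∀ z w, E z w → E w z)
    (hfin : ∀ z, IsFin M {w | E z w}) : IsFin M {z | ∃ w, w ≠ z ∧ E z w} := by
  -- Connectedness in the graph, expressed by internal sets closed under adjacency instead of paths.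
  obtain ⟨e, he⟩ : ∃ e : El Z → El Z → Prop, ∀ z w, e z w ↔ ∀ D : Set (El Z), Internal M D →
      z ∈ D → (∀ s, s ∈ D → ∀ t, E s t → t ∈ D) → w ∈ D := ⟨_, fun _ _ => Iff.rfl⟩
  have hed : Def M fun p : El Z × El Z => e p.1 p.2 := by
    simp only [he]
    fun_prop
  have heE : ∀ z w, E z w → e z w := fun z w h => (he z w).2 fun D _ hz hD => hD z hz w h
  have heq : Equivalence e := by
    refine ⟨fun z => (he _ _).2 fun D _ hz _ => hz, fun {z w} h => ?_, fun {x y z} h h' => ?_⟩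
    · refine (he _ _).2 fun D hDi hw hD => ?_
      -- As `E` is symmetric, the complement of a set closed under adjacency is closed too.
      by_contra hz
      have : IsInt M D := ⟨hDi⟩
      exact (he _ _).1 h Dᶜ (IsInt.internal _) hz
        (fun s hs t hst ht => hs (hD t ht s (hsymm _ _ hst))) hw
    · exact (he _ _).2 fun D hDi hx hD => (he _ _).1 h' D hDi ((he _ _).1 h D hDi hx hD) hD
  have hcls : ∀ z, IsFin M {w | e z w} := by
    intro z
    -- `φ` adds all neighbours. The family `B` below, generated from `{z}` by `φ`, consists of the
    -- balls around `z`.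
    obtain ⟨φ, hφ⟩ : ∃ φ : Set (El Z) → Set (El Z), ∀ S t, t ∈ φ S ↔ t ∈ S ∨ ∃ s, s ∈ S ∧ E s t :=
      ⟨fun S => {t | _}, fun _ _ => Iff.rfl⟩
    have hφd : Def M φ := by
      have : φ = fun S => {t | t ∈ S ∨ ∃ s, s ∈ S ∧ E s t} := by
        funext S
        ext t
        exact hφ S t
      rw [this]
      fun_prop
    have hφm : ∀ S T, S ⊆ T → φ S ⊆ φ T := fun S T h t ht =>
      (hφ _ _).2 (((hφ _ _).1 ht).imp (@h t) fun ⟨s, hs, hst⟩ => ⟨s, h hs, hst⟩)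
    have hφs : ∀ S, S ⊆ φ S := fun S t ht => (hφ _ _).2 (Or.inl ht)
    obtain ⟨B, hB⟩ : ∃ B : Set (Set (El Z)), ∀ S, S ∈ B ↔ Internal M S ∧
        ∀ Q : Set (Set (El Z)), Internal M Q → {z} ∈ Q → (∀ S, S ∈ Q → φ S ∈ Q) → S ∈ Q :=
      ⟨{S | _}, fun _ => Iff.rfl⟩
    have hBi : IsInt M B := by
      have : B = {S | Internal M S ∧ ∀ Q : Set (Set (El Z)), Internal M Q → {z} ∈ Q →
          (∀ S, S ∈ Q → φ S ∈ Q) → S ∈ Q} := by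
        ext S
        exact hB S
      rw [this]
      exact isInt_ofPred_internal (by fun_prop)
    have hB0 : {z} ∈ B := (hB _).2 ⟨IsInt.internal _, fun Q _ h _ => h⟩
    have hB1 : ∀ S, S ∈ B → φ S ∈ B := fun S hS => (hB _).2 ⟨hφd.internal _ ((hB _).1 hS).1,
      fun Q hQ h0 h1 => h1 S (((hB _).1 hS).2 Q hQ h0 h1)⟩
    have hind : ∀ P : Set (El Z) → Prop, Def M P → P {z} → (∀ S, S ∈ B → P S → P (φ S)) →
        ∀ S, S ∈ B → P S := by
      intro P hP h0 h1 S hS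
      have hQ : IsInt M {S | Internal M S ∧ (S ∈ B ∧ P S)} := isInt_ofPred_internal (by fun_prop)
      exact (((hB S).1 hS).2 _ hQ.out ⟨IsInt.internal _, hB0, h0⟩ fun S hS =>
        ⟨((hB _).1 (hB1 S hS.2.1)).1, hB1 S hS.2.1, h1 S hS.2.1 hS.2.2⟩).2.2
    have hBfin : ∀ S, S ∈ B → IsFin M S := by
      refine hind (fun S => IsFin M S) (by fun_prop) (isFin_singleton z) fun S _ hS => ?_
      have h1 := hS.union (hS.biUnion (r := fun s t => E s t) hE fun s _ => hfin s)
      convert! h1 using 1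
      ext t
      exact hφ S t
    have hBz : ∀ S, S ∈ B → z ∈ S :=
      hind (fun S => z ∈ S) (by fun_prop) rfl fun S _ hS => hφs S hS
    -- Balls form a chain, by double induction: comparability of `S` and `T` passes to `φ S` and `φ
    -- T` by monotonicity.
    have hcomp : ∀ S, S ∈ B → ∀ T, T ∈ B → S ⊆ T ∨ T ⊆ S := by
      refine hind (fun S => ∀ T, T ∈ B → S ⊆ T ∨ T ⊆ S) (by fun_prop)
        (fun T hT => Or.inl (Set.singleton_subset_iff.2 (hBz T hT))) fun S hSB hS T hT => ?_
      have hSi : IsInt M (φ S) := ⟨((hB _).1 (hB1 S hSB)).1⟩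
      refine hind (fun T => φ S ⊆ T ∨ T ⊆ φ S) (by fun_prop)
        (Or.inr (Set.singleton_subset_iff.2 (hφs _ (hBz S hSB)))) (fun T hT _ => ?_) T hT
      exact (hS T hT).imp (hφm _ _) (hφm _ _)
    have hUi : IsInt M {t | ∃ S, S ∈ B ∧ t ∈ S} := Def.isInt_ofPred (by fun_prop)
    have hU : IsFin M {t | ∃ S, S ∈ B ∧ t ∈ S} := by
      by_contra hinf
      -- Points are compared by distance from `z`: `a` precedes `b` if every ball around `b`
      -- contains `a`, where the balls are those in `B`. An initial segment lies in one ball, which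
      -- is finite.
      refine false_of_preorder hZ.1.2 hinf (r := fun a b => ∀ S, S ∈ B → b ∈ S → a ∈ S)
        (by fun_prop) (fun a b => ?_) (fun a b c h h' S hS hc => h S hS (h' S hS hc)) ?_
      · by_contra! h
        obtain ⟨⟨S, hS, hbS, haS⟩, T, hT, haT, hbT⟩ := h
        rcases hcomp S hS T hT with h | h
        exacts [hbT (h hbS), haS (h haT)]
      · rintro s ⟨S, hS, hs⟩
        exact (hBfin S hS).subset (Def.isInt_ofPred (by fun_prop)).out fun t ht => ht.2 S hS hs
    refine hU.subset (Def.isInt_ofPred (by fun_prop)).out fun w hw => (he _ _).1 hw _ hUi.out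
      ⟨_, hB0, rfl⟩ ?_
    rintro s ⟨S, hS, hs⟩ t hst
    exact ⟨φ S, hB1 S hS, (hφ _ _).2 (Or.inr ⟨s, hs, hst⟩)⟩
  refine (hZ.2.isFin hed heq hcls).subset (Def.isInt_ofPred (by fun_prop)).out ?_
  rintro z ⟨w, hwz, hzw⟩
  exact ⟨w, hwz, heE _ _ hzw⟩

/-- The fibres of `π ∘ f` have at most two elements, so almost all are singletons. Hence `σ (f z)`
is outside the range of `f` for almost all `z`; but `X` is amorphous, so the range would have to be
finite or cofinite. -/
theorem IsTwoToOne.not_exists_injective {X : M} {π : El X → El Z} {σ : El X → El X}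
    (h : IsTwoToOne π σ) (hX : IsAmorphous X) (hZ : IsStronglyAmorphous Z) {f : El Z → El X}
    (hf : Def M f) (hinj : Function.Injective f) : False := by
  have hπ := h.def_proj
  have hσ := h.def_swap
  have hcell : ∀ z, IsFin M {w | π (f z) = π (f w)} := by
    intro z
    refine ((IsTwoToOne.isFin_pair (f z) (σ (f z))).preimage_inj hf hinj).subset
      (Def.isInt_ofPred (by fun_prop)).out fun w hw => h.eq_or _ _ hw.symm
  have h1 := hZ.2.isFin (e := fun z w => π (f z) = π (f w)) (by fun_prop)
    ⟨fun _ => rfl, fun h => h.symm, fun h h' => h.trans h'⟩ hcell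
  have hri : IsInt M {x | ∃ z, f z = x} := Def.isInt_ofPred (by fun_prop)
  rcases hX.2 _ hri.out with h2 | h2
  · refine hZ.1.1 ((h2.preimage_inj hf hinj).subset (IsInt.internal _) fun z _ => ⟨z, rfl⟩)
  · have h3 := (h2.preimage_inj (hσ.comp hf) (fun z w hzw => hinj (by
      simpa [h.swap_swap] using congrArg σ hzw)) : IsFin M {z | σ (f z) ∈ _})
    refine hZ.1.1 ((h1.union h3).subset (IsInt.internal _) fun z _ => ?_)
    -- If `σ (f z) = f w`, then `z` and `w` share a cell; there are finitely many such `z`. For the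
    -- other `z` the point `σ (f z)` lies in the finite complement of the range.
    by_cases hz : ∃ w, f w = σ (f z)
    · left
      obtain ⟨w, hw⟩ := hz
      refine ⟨w, ?_, by rw [hw, h.proj_swap]⟩
      rintro rfl
      exact h.swap_ne _ hw.symm
    · exact Or.inr hz

end Rigid

/-! ### Inner products as finite sums -/

section Inner

variable {M : Type u} [Membership M M] [ZFModel M] {R : M} [RealField R] {X Z : M}

@[fun_prop]
theorem Def.ite {α β : Type*} [Coded M α] [Coded M β] [Rep M α] [Rep M β] [Tot M β] {P : α → Prop}
    [∀ x, Decidable (P x)] {f g : α → β} (hP : Def M P) (hf : Def M f) (hg : Def M g) :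
    Def M fun x => if P x then f x else g x := by
  refine of_graph (Def.of_iff (P := fun p : α × β => (P p.1 ∧ p.2 = f p.1) ∨ (¬ P p.1 ∧ p.2 = g p.1))
    (by fun_prop) fun p => ?_)
  by_cases h : P p.1 <;> simp [h]

/-- The inner product of two functions the first of which has finite support. -/
noncomputable def ip (η ζ : El X → Cplx R) : Cplx R :=
  ⟨fsum (fun x => (η x).re * (ζ x).re + (η x).im * (ζ x).im) {x | η x ≠ 0},
    fsum (fun x => (η x).im * (ζ x).re - (η x).re * (ζ x).im) {x | η x ≠ 0}⟩

@[fun_prop]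
theorem Def.ip {γ : Type*} [Coded M γ] [Rep M γ] {f g : γ → El X → Cplx R}
    (hf : Def M fun p : γ × El X => f p.1 p.2) (hg : Def M fun p : γ × El X => g p.1 p.2) :
    Def M fun c => ip (f c) (g c) := by
  unfold ZFAnalysis.ip
  fun_prop

theorem hasInner_iff_ip (hX : IsAmorphous X) {η ζ : El X → Cplx R} (hη : η ∈ ell2 R X)
    (hζ : ζ ∈ ell2 R X) {c : Cplx R} : HasInner η ζ c ↔ c = ip η ζ := by
  rw [hasInner_iff (ell2.def hη) (ell2.def hζ) (ell2.isFin hX hη)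
    fun x hx => Or.inl (by simpa using hx)]
  exact ⟨fun h => QuadraticAlgebra.ext h.1 h.2, fun h => h ▸ ⟨rfl, rfl⟩⟩

theorem ip_eq (hX : IsAmorphous X) {η ζ : El X → Cplx R} (hη : η ∈ ell2 R X)
    (hζ : ζ ∈ ell2 R X) {T : Set (El X)} (hT : IsFin M T) (h0 : ∀ x, x ∉ T → η x = 0 ∨ ζ x = 0) :
    ip η ζ = ⟨fsum (fun x => (η x).re * (ζ x).re + (η x).im * (ζ x).im) T,
      fsum (fun x => (η x).im * (ζ x).re - (η x).re * (ζ x).im) T⟩ :=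
  ((hasInner_iff_ip hX hη hζ).1
    ((hasInner_iff (ell2.def hη) (ell2.def hζ) hT h0).2 ⟨rfl, rfl⟩)).symm

/-- The form of linearity needed for one Gram–Schmidt step, computed in real and imaginary parts
over a common finite support because `fsum` is real-valued. -/
theorem ip_sub_smul (hX : IsAmorphous X) {η η' ζ : El X → Cplx R} (hη : η ∈ ell2 R X)
    (hη' : η' ∈ ell2 R X) (hζ : ζ ∈ ell2 R X) (c : Cplx R) :
    ip (η - c • η') ζ = ip η ζ - c * ip η' ζ := by
  have hT := (ell2.isFin hX hη).union (ell2.isFin hX hη')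
  have h1 : ∀ x, x ∉ {x | η x ≠ 0} ∪ {x | η' x ≠ 0} → η x = 0 ∧ η' x = 0 := by
    intro x hx
    simpa only [Set.mem_union, Set.mem_ofPred_eq, not_or, not_not] using hx
  have d1 := ell2.def hη
  have d2 := ell2.def hη'
  have d3 := ell2.def hζ
  have d4 := ell2.def (sub_mem_ell2 hX hη (smul_mem_ell2 hX c hη'))
  rw [ip_eq hX (sub_mem_ell2 hX hη (smul_mem_ell2 hX c hη')) hζ hT fun x hx => Or.inl (by
      simp [h1 x hx]), ip_eq hX hη hζ hT fun x hx => Or.inl (h1 x hx).1,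
    ip_eq hX hη' hζ hT fun x hx => Or.inl (h1 x hx).2]
  refine QuadraticAlgebra.ext ?_ ?_
  · have e : fsum (fun x => ((η - c • η') x).re * (ζ x).re + ((η - c • η') x).im * (ζ x).im)
        ({x | η x ≠ 0} ∪ {x | η' x ≠ 0}) =
        fsum (fun x => ((η x).re * (ζ x).re + (η x).im * (ζ x).im) -
          (c.re * ((η' x).re * (ζ x).re + (η' x).im * (ζ x).im) -
            c.im * ((η' x).im * (ζ x).re - (η' x).re * (ζ x).im)))
          ({x | η x ≠ 0} ∪ {x | η' x ≠ 0}) :=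
      fsum_congr (by fun_prop) (by fun_prop) hT fun x _ => by
        simp
        ring
    rw [e, fsum_sub (by fun_prop) (by fun_prop) hT, fsum_sub (by fun_prop) (by fun_prop) hT,
      fsum_mul_left (by fun_prop) hT, fsum_mul_left (by fun_prop) hT]
    simp
    ring
  · have e : fsum (fun x => ((η - c • η') x).im * (ζ x).re - ((η - c • η') x).re * (ζ x).im)
        ({x | η x ≠ 0} ∪ {x | η' x ≠ 0}) =
        fsum (fun x => ((η x).im * (ζ x).re - (η x).re * (ζ x).im) -
          (c.re * ((η' x).im * (ζ x).re - (η' x).re * (ζ x).im) +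
            c.im * ((η' x).re * (ζ x).re + (η' x).im * (ζ x).im)))
          ({x | η x ≠ 0} ∪ {x | η' x ≠ 0}) :=
      fsum_congr (by fun_prop) (by fun_prop) hT fun x _ => by
        simp
        ring
    rw [e, fsum_sub (by fun_prop) (by fun_prop) hT,
      fsum_add (f := fun x => c.re * ((η' x).im * (ζ x).re - (η' x).re * (ζ x).im))
        (by fun_prop) (by fun_prop) hT,
      fsum_mul_left (by fun_prop) hT, fsum_mul_left (by fun_prop) hT]
    simp

theorem ip_star (hX : IsAmorphous X) {η ζ : El X → Cplx R} (hη : η ∈ ell2 R X)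
    (hζ : ζ ∈ ell2 R X) : ip ζ η = star (ip η ζ) := by
  have d1 := ell2.def hη
  have d2 := ell2.def hζ
  have hT := ell2.isFin hX hη
  rw [ip_eq hX hη hζ hT fun x hx => Or.inl (by simpa using hx),
    ip_eq hX hζ hη hT fun x hx => Or.inr (by simpa using hx)]
  refine QuadraticAlgebra.ext ?_ ?_
  · simp [mul_comm]
  · have := fsum_mul_left (f := fun x => (η x).im * (ζ x).re - (η x).re * (ζ x).im)
      (by fun_prop) hT (-1)
    simp only [neg_one_mul, neg_sub] at this
    simp only [QuadraticAlgebra.im_star]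
    rw [← this]
    exact fsum_congr (by fun_prop) (by fun_prop) hT fun x _ => by ring

theorem ip_self_nonneg (hX : IsAmorphous X) {η : El X → Cplx R} (hη : η ∈ ell2 R X) :
    0 ≤ (ip η η).re := by
  have d := ell2.def hη
  exact fsum_nonneg (by fun_prop) (ell2.isFin hX hη) fun x _ =>
    add_nonneg (mul_self_nonneg _) (mul_self_nonneg _)

open Classical in
/-- The unit vector supported at `x`. -/
noncomputable def single (R : M) [RealField R] (x : El X) : El X → Cplx R :=
  fun y => if y = x then 1 else 0

@[fun_prop]
theorem Def.single (x : El X) : Def M (single R x) := by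
  classical
  have : Def M fun y : El X => if y = x then (1 : Cplx R) else 0 := by fun_prop
  convert! this using 1

theorem single_mem (hX : IsAmorphous X) (x : El X) : single R x ∈ ell2 R X :=
  mem_ell2_of_isFin hX (Def.single x) (isFin_singleton x)
    fun y hy => if_neg hy

theorem ip_single (hX : IsAmorphous X) (x : El X) {ζ : El X → Cplx R} (hζ : ζ ∈ ell2 R X) :
    ip (single R x) ζ = star (ζ x) := by
  have d1 := ell2.def (single_mem (R := R) hX x)
  have d2 := ell2.def hζ
  rw [ip_eq hX (single_mem hX x) hζ (isFin_singleton x) fun y hy => Or.inl (if_neg hy),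
    fsum_singleton (by fun_prop), fsum_singleton (by fun_prop)]
  refine QuadraticAlgebra.ext ?_ ?_ <;>
  simp [single, QuadraticAlgebra.re_one, QuadraticAlgebra.im_one]

end Inner

/-! ### Orthonormal sets: Bessel's inequality and local finiteness -/

section Orthonormal

variable {M : Type u} [Membership M M] [ZFModel M] {R : M} [RealField R] {X Z : M}

theorem IsOrthonormal.ip_self (hX : IsAmorphous X) {B : Set (El X → Cplx R)} (hB : IsOrthonormal B)
    (b : B) : ip b.1 b.1 = 1 :=
  ((hasInner_iff_ip hX (hB.2.1 b.2) (hB.2.1 b.2)).1 (hB.2.2.1 _ b.2)).symm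

theorem IsOrthonormal.ip_ne (hX : IsAmorphous X) {B : Set (El X → Cplx R)} (hB : IsOrthonormal B)
    {b b' : B} (h : b ≠ b') : ip b.1 b'.1 = 0 :=
  ((hasInner_iff_ip hX (hB.2.1 b.2) (hB.2.1 b'.2)).1
    (hB.2.2.2 _ b.2 _ b'.2 fun h' => h (Subtype.ext h'))).symm

theorem nsq_eq_mul_star (c : Cplx R) : (c * star c).re = nsq c := by
  rw [re_mul_star, nsq]
  ring

/-- Bessel's inequality for a unit vector at a point. -/
theorem IsOrthonormal.bessel (hX : IsAmorphous X) {B : Set (El X → Cplx R)} [IsInt M B]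
    (hB : IsOrthonormal B) (x : El X) {F : Set B} (hF : IsFin M F) :
    fsum (fun b : B => nsq (b.1 x)) F ≤ 1 := by
  have hd : Def M fun b : B => b.1 x := by fun_prop
  have hell := isInt_ell2 (R := R) hX
  -- The witness is the remainder of `e_x` after subtracting its components along `F`. Stating only
  -- that it exists, with its norm and its inner products with the remaining members, avoids sums of
  -- vectors.
  have key : ∃ η : El X → Cplx R, Internal M η ∧ (η ∈ ell2 R X ∧
      (ip η η).re = 1 - fsum (fun b : B => nsq (b.1 x)) F ∧
      ∀ b : B, b ∉ F → ip η b.1 = star (b.1 x)) := by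
    refine IsFin.induction (C := fun F : Set B => ∃ η : El X → Cplx R, Internal M η ∧
      (η ∈ ell2 R X ∧ (ip η η).re = 1 - fsum (fun b : B => nsq (b.1 x)) F ∧
        ∀ b : B, b ∉ F → ip η b.1 = star (b.1 x))) (by fun_prop) ?_ ?_ hF
    · have hs := single_mem (R := R) hX x
      refine ⟨_, hs.1, hs, ?_, fun b _ => ip_single hX x (hB.2.1 b.2)⟩
      rw [ip_single hX x hs, fsum_empty (by fun_prop)]
      simp [single, QuadraticAlgebra.re_one]
    · rintro G b hG hb ⟨η, -, hη, h1, h2⟩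
      have hbm := hB.2.1 b.2
      have hm := sub_mem_ell2 hX hη (smul_mem_ell2 hX (star (b.1 x)) hbm)
      have e1 : ip b.1 (η - star (b.1 x) • b.1) = 0 := by
        rw [ip_star hX hm hbm, ip_sub_smul hX hη hbm hbm, h2 b hb, hB.ip_self hX, mul_one, sub_self,
          star_zero]
      have e2 : ip b.1 η = b.1 x := by rw [ip_star hX hη hbm, h2 b hb, star_star]
      refine ⟨_, hm.1, hm, ?_, fun b' hb' => ?_⟩
      · rw [ip_sub_smul hX hη hbm hm, e1, mul_zero, sub_zero, ip_star hX hm hη,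
          ip_sub_smul hX hη hbm hη, e2, fsum_insert (by fun_prop) hG hb]
        rw [QuadraticAlgebra.re_star, mul_comm]
        simp only [QuadraticAlgebra.re_sub, QuadraticAlgebra.im_sub, nsq_eq_mul_star, h1]
        ring
      · have hb'G : b' ∉ G := fun h => hb' (Or.inr h)
        have hne : b ≠ b' := fun h => hb' (Or.inl h.symm)
        rw [ip_sub_smul hX hη hbm (hB.2.1 b'.2), h2 b' hb'G, hB.ip_ne hX hne, mul_zero, sub_zero]
  obtain ⟨η, -, hη, h, -⟩ := key
  have := ip_self_nonneg hX hη
  linarith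

/-- Only finitely many elements of an orthonormal set are supported in a given finite set. -/
theorem IsOrthonormal.isFin_of_support (hX : IsAmorphous X) {B : Set (El X → Cplx R)} [IsInt M B]
    (hB : IsOrthonormal B) {K : Set (El X)} (hK : IsFin M K) :
    IsFin M {b : B | ∀ x, x ∉ K → b.1 x = 0} := by
  have hKi : IsInt M K := ⟨hK.internal⟩
  have hi : IsInt M {b : B | ∀ x, x ∉ K → b.1 x = 0} := Def.isInt_ofPred (by fun_prop)
  -- Counting replaces dimension theory: the number of vectors is the sum of their squared norms,
  -- which after interchanging the sums is at most the number of points of `K` by Bessel's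
  -- inequality.
  refine isFin_of_bounded (R := R) (f := fun _ => 1) (by fun_prop) one_pos (fun _ _ => le_rfl)
    (c := fsum (fun _ => 1) K) fun F hF hFT => ?_
  have hFi : IsInt M F := ⟨hF.internal⟩
  have h1 : fsum (fun b : B => (1 : El R)) F =
      fsum (fun b : B => fsum (fun x => nsq (b.1 x)) K) F := by
    refine fsum_congr (by fun_prop) (by fun_prop) hF fun b hb => ?_
    have hbd := ell2.def (hB.2.1 b.2)
    have := congrArg QuadraticAlgebra.re (hB.ip_self hX b)
    rw [ip_eq hX (hB.2.1 b.2) (hB.2.1 b.2) hK fun x hx => Or.inl (hFT hb x hx),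
      QuadraticAlgebra.re_one] at this
    rw [← this]
    exact fsum_congr (by fun_prop) (by fun_prop) hK fun x _ => by
      simp only [nsq]
      ring
  rw [h1, fsum_comm (f := fun (b : B) x => nsq (b.1 x)) (by fun_prop) hF hK]
  exact fsum_le (by fun_prop) (by fun_prop) hK fun x _ => hB.bessel hX x hF

/-- Only finitely many elements of an orthonormal set are nonzero at a given point. -/
theorem IsOrthonormal.isFin_ne_zero (hX : IsAmorphous X) {B : Set (El X → Cplx R)} [IsInt M B]
    (hB : IsOrthonormal B) (x : El X) : IsFin M {b : B | b.1 x ≠ 0} := by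
  have hsupp : ∀ b : B, IsFin M {y | b.1 y ≠ 0} := fun b => ell2.isFin hX (hB.2.1 b.2)
  have hUi : IsInt M {y | ∃ b : B, b.1 x ≠ 0 ∧ b.1 y ≠ 0} := Def.isInt_ofPred (by fun_prop)
  by_cases hU : IsFin M {y | ∃ b : B, b.1 x ≠ 0 ∧ b.1 y ≠ 0}
  · refine (hB.isFin_of_support hX hU).subset (Def.isInt_ofPred (by fun_prop)).out fun b hb y hy => ?_
    by_contra h
    exact hy ⟨b, hb, h⟩
  · exfalso
    -- A point comes early if some `b` that is nonzero there has `|b x|` large. The initial segment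
    -- of `s` is covered by the supports of those `b'` with `|b' x| ≥ |b x|`, for one `b` nonzero at
    -- `s`; by Bessel's inequality there are finitely many.
    refine false_of_preorder hX.2 hU (r := fun t s => ∀ b : B, b.1 x ≠ 0 → b.1 s ≠ 0 →
      ∃ b' : B, b'.1 x ≠ 0 ∧ b'.1 t ≠ 0 ∧ nsq (b.1 x) ≤ nsq (b'.1 x)) (by fun_prop) ?_ ?_ ?_
    · intro t s
      by_contra! h
      obtain ⟨⟨b, h1, h2, h3⟩, b', h1', h2', h3'⟩ := h
      exact lt_asymm (h3 b' h1' h2') (h3' b h1 h2)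
    · intro a b c hab hbc β h1 h2
      obtain ⟨β', h1', h2', h3'⟩ := hbc β h1 h2
      obtain ⟨β'', h1'', h2'', h3''⟩ := hab β' h1' h2'
      exact ⟨β'', h1'', h2'', h3'.trans h3''⟩
    · rintro s ⟨b, hbx, hbs⟩
      have hGi : IsInt M {b' : B | nsq (b.1 x) ≤ nsq (b'.1 x)} := Def.isInt_ofPred (by fun_prop)
      have hG : IsFin M {b' : B | nsq (b.1 x) ≤ nsq (b'.1 x)} :=
        isFin_of_bounded (f := fun b' : B => nsq (b'.1 x)) (by fun_prop)
          (lt_of_le_of_ne (nsq_nonneg _) fun h => hbx (nsq_eq_zero.1 h.symm)) (fun b' hb' => hb')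
          fun F hF _ => hB.bessel hX x hF
      refine (hG.biUnion (r := fun b' t => b'.1 t ≠ 0) (by fun_prop) fun b' _ => hsupp b').subset
        (Def.isInt_ofPred (by fun_prop)).out ?_
      rintro t ⟨-, ht⟩
      obtain ⟨b', h1, h2, h3⟩ := ht b hbx hbs
      exact ⟨b', h3, h2⟩

end Orthonormal

/-! ### Orthonormal sets in the orthogonal complement -/

section Antisymmetric

variable {M : Type u} [Membership M M] [ZFModel M] {R : M} [RealField R] {X Z : M}

namespace IsTwoToOne

variable {π : El X → El Z} {σ : El X → El X}

theorem single_swap (h : IsTwoToOne π σ) (x y : El X) : single R x (σ y) = single R (σ x) y := by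
  have : σ y = x ↔ y = σ x :=
    ⟨fun h' => by rw [← h', h.swap_swap], fun h' => by rw [h', h.swap_swap]⟩
  by_cases h' : y = σ x
  · rw [single, single, if_pos h', if_pos (this.2 h')]
  · rw [single, single, if_neg h', if_neg (mt this.1 h')]

/-- The functions orthogonal to those constant on the fibres change sign on each fibre. -/
theorem eq_neg_of_mem_orthCompl (h : IsTwoToOne π σ) (hX : IsAmorphous X) {η : El X → Cplx R}
    (hη : η ∈ orthCompl (symm R σ)) (x : El X) : η (σ x) = -η x := by
  have hs := single_mem (R := R) hX x
  have hs' := single_mem (R := R) hX (σ x)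
  have hm := sub_mem_ell2 hX hs (smul_mem_ell2 hX (-1) hs')
  -- The test vector `e_x + e_{σ x}` is symmetric.
  have h0 := (hasInner_iff_ip hX hη.1 hm).1 (hη.2 _ ⟨hm, fun y => by
    simp only [Pi.sub_apply, Pi.smul_apply, h.single_swap, h.swap_swap]
    simp [add_comm]⟩)
  have h1 := ip_star hX hm hη.1
  rw [← h0, ip_sub_smul hX hs hs' hη.1, ip_single hX _ hη.1, ip_single hX _ hη.1] at h1
  have h2 := congrArg star h1
  simp only [star_zero, star_star, neg_one_mul, sub_neg_eq_add, ← star_add] at h2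
  exact eq_neg_of_add_eq_zero_right (star_eq_zero.1 h2.symm)

/-- This supplies, for any prescribed point `x`, an element of the complement that does not vanish
there. -/
theorem single_sub_mem_orthCompl (h : IsTwoToOne π σ) (hX : IsAmorphous X) (x : El X) :
    single R x - (1 : Cplx R) • single R (σ x) ∈ orthCompl (symm R σ) := by
  have hs := single_mem (R := R) hX x
  have hs' := single_mem (R := R) hX (σ x)
  have hm := sub_mem_ell2 hX hs (smul_mem_ell2 hX 1 hs')
  refine ⟨hm, fun ζ hζ => (hasInner_iff_ip hX hm hζ.1).2 ?_⟩
  rw [ip_sub_smul hX hs hs' hζ.1, ip_single hX _ hζ.1, ip_single hX _ hζ.1, hζ.2, one_mul, sub_self]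

/-- The upper half of the punctured complex plane. -/
def IsUpper (w : Cplx R) : Prop := 0 < w.re ∨ (w.re = 0 ∧ 0 < w.im)

theorem IsUpper.ne_zero {w : Cplx R} (h : IsUpper w) : w ≠ 0 := by
  rintro rfl
  simp [IsUpper] at h

theorem IsUpper.not_neg {w : Cplx R} (h : IsUpper w) : ¬ IsUpper (-w) := by
  simp only [IsUpper, QuadraticAlgebra.re_neg, QuadraticAlgebra.im_neg] at h ⊢
  rcases h with h | ⟨h, h'⟩ <;> rintro (h1 | ⟨h1, h2⟩) <;> linarith

/-- Together with `IsUpper.not_neg`, exactly one of `w` and `-w` is upper. So a function changing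
sign on a fibre, and nonzero there, singles out one of its two points without any choice. -/
theorem isUpper_or {w : Cplx R} (h : w ≠ 0) : IsUpper w ∨ IsUpper (-w) := by
  simp only [IsUpper, QuadraticAlgebra.re_neg, QuadraticAlgebra.im_neg, neg_eq_zero]
  by_contra! h'
  obtain ⟨⟨h1, h2⟩, h3, h4⟩ := h'
  have h5 : w.re = 0 := by linarith
  exact h (QuadraticAlgebra.ext h5 (le_antisymm (h2 h5) (neg_nonpos.1 (h4 h5))))

/-- An orthonormal set of functions that change sign on each fibre is finite. -/
theorem isFin_of_isOrthonormal (h : IsTwoToOne π σ) (hX : IsAmorphous X)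
    (hZ : IsStronglyAmorphous Z) {B : Set (El X → Cplx R)} (hB : IsOrthonormal B)
    (hBY : B ⊆ orthCompl (symm R σ)) : IsFin M B := by
  have hBi : IsInt M B := ⟨hB.1⟩
  have hπ := h.def_proj
  have hσ := h.def_swap
  have hanti : ∀ (b : B) x, b.1 (σ x) = -b.1 x := fun b x =>
    h.eq_neg_of_mem_orthCompl hX (hBY b.2) x
  have hfib : ∀ (b : B) x y, π y = π x → b.1 y ≠ 0 → b.1 x ≠ 0 := by
    intro b x y hxy hy
    rcases h.eq_or x y hxy with rfl | rfl
    · exact hy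
    · rw [hanti] at hy
      exact neg_ne_zero.1 hy
  by_contra hinf
  -- Two elements of `Z` are joined if some member of `B` is nonzero on both fibres. Local
  -- finiteness holds because finitely many members are nonzero at a point, each with finite
  -- support.
  have hE : IsFin M {z | ∃ w, w ≠ z ∧ ∃ b : B, ∃ x y, π x = z ∧ π y = w ∧ b.1 x ≠ 0 ∧ b.1 y ≠ 0} := by
    refine hZ.isFin (E := fun z w => ∃ b : B, ∃ x y, π x = z ∧ π y = w ∧ b.1 x ≠ 0 ∧ b.1 y ≠ 0)
      (by fun_prop) (fun z w ⟨b, x, y, h1, h2, h3, h4⟩ => ⟨b, y, x, h2, h1, h4, h3⟩) fun z => ?_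
    obtain ⟨x, rfl⟩ := h.surj z
    have h1 := (hB.isFin_ne_zero hX x).biUnion (r := fun (b : B) y => b.1 y ≠ 0) (by fun_prop)
      fun b _ => ell2.isFin hX (hB.2.1 b.2)
    refine (h1.image hπ).subset (Def.isInt_ofPred (by fun_prop)).out ?_
    rintro w ⟨b, x', y, hx', rfl, hbx, hby⟩
    exact ⟨y, ⟨b, hfib b x x' hx' hbx, hby⟩, rfl⟩
  have hZ0i : IsInt M {z | ∃ b : B, ∃ x, π x = z ∧ b.1 x ≠ 0} := Def.isInt_ofPred (by fun_prop)
  -- If `B` lived over finitely many fibres, all its members would be supported in one finite set,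
  -- so `B` would be finite.
  have hZ0 : ¬ IsFin M {z | ∃ b : B, ∃ x, π x = z ∧ b.1 x ≠ 0} := fun hf =>
    hinf ((isFin_univ_coe B).1 ((hB.isFin_of_support hX (h.isFin_preimage hf)).subset
      (IsInt.internal _) fun b _ x hx => by_contra fun hb => hx ⟨b, x, rfl, hb⟩))
  -- Over an isolated element the support of `b` is just the fibre, so the inner product of `b` and
  -- `b'` is twice `b x` times the conjugate of `b' x`. This is nonzero, and orthogonality fails
  -- unless `b = b'`.
  have huniq : ∀ (b b' : B) x, (¬ ∃ w, w ≠ π x ∧ ∃ b : B, ∃ x' y, π x' = π x ∧ π y = w ∧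
      b.1 x' ≠ 0 ∧ b.1 y ≠ 0) → b.1 x ≠ 0 → b'.1 x ≠ 0 → b = b' := by
    intro b b' x hx hb hb'
    by_contra hne
    have h1 := hB.ip_ne hX hne
    have d1 := ell2.def (hB.2.1 b.2)
    have d2 := ell2.def (hB.2.1 b'.2)
    rw [ip_eq hX (hB.2.1 b.2) (hB.2.1 b'.2) (isFin_pair x (σ x)) fun y hy => Or.inl (by
        by_contra hby
        refine hx ⟨π y, fun hxy => hy ?_, b, x, y, rfl, rfl, hb, hby⟩
        exact h.eq_or x y hxy),
      fsum_pair (by fun_prop) (h.swap_ne x).symm, fsum_pair (by fun_prop) (h.swap_ne x).symm] at h1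
    have h2 := congrArg QuadraticAlgebra.re h1
    have h3 := congrArg QuadraticAlgebra.im h1
    simp only [hanti, QuadraticAlgebra.re_neg, QuadraticAlgebra.im_neg, QuadraticAlgebra.re_zero,
      QuadraticAlgebra.im_zero] at h2 h3
    have h4 : nsq (b.1 x) * nsq (b'.1 x) = 0 := by
      have h2' : (b.1 x).re * (b'.1 x).re + (b.1 x).im * (b'.1 x).im = 0 := by linarith
      have h3' : (b.1 x).im * (b'.1 x).re - (b.1 x).re * (b'.1 x).im = 0 := by linarith
      calc nsq (b.1 x) * nsq (b'.1 x) =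
          ((b.1 x).re * (b'.1 x).re + (b.1 x).im * (b'.1 x).im) ^ 2 +
          ((b.1 x).im * (b'.1 x).re - (b.1 x).re * (b'.1 x).im) ^ 2 := by
            simp only [nsq]
            ring
        _ = 0 := by rw [h2', h3']; ring
    rcases mul_eq_zero.1 h4 with h5 | h5
    exacts [hb (nsq_eq_zero.1 h5), hb' (nsq_eq_zero.1 h5)]
  have hS : IsInt M {x | ∃ b : B, IsUpper (b.1 x)} := by
    simp only [IsUpper]
    exact Def.isInt_ofPred (by fun_prop)
  -- Over each isolated element met by `B`, exactly one of the two points lies in the set of points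
  -- with an upper value.
  have hsel : ∀ z, (∃ b : B, ∃ x, π x = z ∧ b.1 x ≠ 0) →
      (¬ ∃ w, w ≠ z ∧ ∃ b : B, ∃ x y, π x = z ∧ π y = w ∧ b.1 x ≠ 0 ∧ b.1 y ≠ 0) →
      ∃ y, π y = z ∧ (∃ b : B, IsUpper (b.1 y)) ∧ ¬ ∃ b : B, IsUpper (b.1 (σ y)) := by
    rintro z ⟨b, x, rfl, hbx⟩ hz
    have h1 : ∃ y, π y = π x ∧ IsUpper (b.1 y) := by
      rcases isUpper_or hbx with h' | h'
      · exact ⟨x, rfl, h'⟩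
      · exact ⟨σ x, h.proj_swap x, by rwa [hanti]⟩
    obtain ⟨y, hy, hby⟩ := h1
    refine ⟨y, hy, ⟨b, hby⟩, ?_⟩
    rintro ⟨b', hb'⟩
    rw [← hy] at hz
    have := huniq b b' y hz hby.ne_zero (hfib b' y (σ y) (h.proj_swap y) hb'.ne_zero)
    rw [← this, hanti] at hb'
    exact hby.not_neg hb'
  -- Both the selected set and its complement meet almost all of the infinitely many fibres
  -- concerned, so neither can be finite.
  rcases hX.2 _ hS.out with hf | hf
  · refine hZ0 ((hE.union (hf.image hπ)).subset hZ0i.out fun z hz => ?_)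
    by_cases hz1 : ∃ w, w ≠ z ∧ ∃ b : B, ∃ x y, π x = z ∧ π y = w ∧ b.1 x ≠ 0 ∧ b.1 y ≠ 0
    · exact Or.inl hz1
    · obtain ⟨y, hy, h1, -⟩ := hsel z hz hz1
      exact Or.inr ⟨y, h1, hy⟩
  · refine hZ0 ((hE.union (hf.image hπ)).subset hZ0i.out fun z hz => ?_)
    by_cases hz1 : ∃ w, w ≠ z ∧ ∃ b : B, ∃ x y, π x = z ∧ π y = w ∧ b.1 x ≠ 0 ∧ b.1 y ≠ 0
    · exact Or.inl hz1
    · obtain ⟨y, hy, -, h1⟩ := hsel z hz hz1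
      exact Or.inr ⟨σ y, h1, (h.proj_swap y).trans hy⟩

/-- A basis would be finite, so all its members would vanish at some `x`. The functions vanishing at
`x` form a closed subspace that misses `e_x - e_{σ x}`. -/
theorem not_exists_isOrthonormalBasis (h : IsTwoToOne π σ) (hX : IsAmorphous X)
    (hZ : IsStronglyAmorphous Z) : ¬ ∃ B, IsOrthonormalBasis (orthCompl (symm R σ)) B := by
  rintro ⟨B, hB, hBY, hspan⟩
  have hf := h.isFin_of_isOrthonormal hX hZ hB hBY
  have hBi : IsInt M B := ⟨hB.1⟩
  have h1 : IsFin M {x | ∃ b ∈ (Set.univ : Set B), b.1 x ≠ 0} :=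
    ((isFin_univ_coe B).2 hf).biUnion (r := fun (b : B) x => b.1 x ≠ 0) (by fun_prop)
      fun b _ => ell2.isFin hX (hB.2.1 b.2)
  obtain ⟨x, hx⟩ : ∃ x, x ∉ {x | ∃ b ∈ (Set.univ : Set B), b.1 x ≠ 0} := by
    by_contra! h'
    exact hX.1 (h1.subset (IsInt.internal _) fun x _ => h' x)
  have h2 := hspan _ (isClosedSubspace_vanishing hX x) (fun b hb => ⟨hB.2.1 hb, by
    by_contra h'
    exact hx ⟨⟨b, hb⟩, trivial, h'⟩⟩) (h.single_sub_mem_orthCompl hX x)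
  have h3 := h2.2
  simp only [Pi.sub_apply, Pi.smul_apply, single, if_true, if_neg (h.swap_ne x).symm, smul_zero,
    sub_zero] at h3
  have h4 := congrArg QuadraticAlgebra.re h3
  rw [QuadraticAlgebra.re_one, QuadraticAlgebra.re_zero] at h4
  exact one_ne_zero h4

end IsTwoToOne

/-- Both maps are uniquely determined by `P`, so their graphs are definable even though they are
obtained by choice in the ambient logic. -/
theorem exists_isTwoToOne {P : El Z → Set (El X)} (hP : Internal M P)
    (h2 : ∀ z, ∃ x y, x ≠ y ∧ P z = {x, y}) (hd : ∀ z z', z ≠ z' → Disjoint (P z) (P z'))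
    (hs : ∀ x, ∃ z, x ∈ P z) : ∃ (π : El X → El Z) (σ : El X → El X), IsTwoToOne π σ := by
  have hPd : Def M P := Def.of_isInt ⟨hP⟩
  choose π hπ using hs
  have hu : ∀ x z, x ∈ P z ↔ z = π x := by
    refine fun x z => ⟨fun hx => ?_, fun hz => hz ▸ hπ x⟩
    by_contra hne
    exact Set.disjoint_left.1 (hd _ _ hne) hx (hπ x)
  have hπd : Def M π := Def.of_graph (Def.of_iff (P := fun p : El X × El Z => p.1 ∈ P p.2)
    (by fun_prop) fun p => (hu _ _).symm)
  have hσ : ∀ x, ∃ y, y ≠ x ∧ π y = π x ∧ ∀ y', π y' = π x → y' = x ∨ y' = y := by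
    intro x
    obtain ⟨a, b, hab, hz⟩ := h2 (π x)
    have hx : x ∈ ({a, b} : Set (El X)) := hz ▸ hπ x
    have hmem : ∀ y, π y = π x ↔ y = a ∨ y = b := by
      intro y
      rw [eq_comm, ← hu, hz]
      rfl
    rcases hx with rfl | rfl
    · exact ⟨b, hab.symm, (hmem b).2 (Or.inr rfl), fun y' => (hmem y').1⟩
    · exact ⟨a, hab, (hmem a).2 (Or.inl rfl), fun y' hy' => ((hmem y').1 hy').symm⟩
  choose σ h1 h3 h4 using hσ
  refine ⟨π, σ, hπd, Def.of_graph (Def.of_iff (P := fun p : El X × El X => p.2 ≠ p.1 ∧ π p.2 = π p.1)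
    (by fun_prop) fun p => ⟨fun h => ?_, fun h => ?_⟩), h3, h1, h4, fun z => ?_⟩
  · rw [h]
    exact ⟨h1 _, h3 _⟩
  · exact (h4 _ _ h.2).resolve_left h.1
  · obtain ⟨x, y, -, hz⟩ := h2 z
    exact ⟨x, ((hu x z).1 (hz ▸ Or.inl rfl)).symm⟩

end Antisymmetric

/-! ### Arithmetic of the natural numbers of the model -/

namespace NN

variable {M : Type u} [Membership M M] [ZFModel M]

theorem exists_add : ∃ f : NN M → NN M → NN M, Def M (fun p : NN M × NN M => f p.1 p.2) ∧
    (∀ x, f x zero = x) ∧ ∀ x n, f x (succ n) = succ (f x n) :=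
  exists_rec (a := fun x => x) (g := fun _ _ y => succ y) (by fun_prop) (by fun_prop)

noncomputable instance : Zero (NN M) := ⟨zero⟩

noncomputable instance : One (NN M) := ⟨succ zero⟩

noncomputable instance : Add (NN M) := ⟨(exists_add (M := M)).choose⟩

theorem def_add : Def M fun p : NN M × NN M => p.1 + p.2 := (exists_add (M := M)).choose_spec.1

@[fun_prop]
theorem _root_.ZFAnalysis.Def.nadd {α : Type*} [Coded M α] [Rep M α] {f g : α → NN M}
    (hf : Def M f) (hg : Def M g) : Def M fun a => f a + g a := def_add.comp (hf.prodMk hg)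

protected theorem add_zero (n : NN M) : n + 0 = n := (exists_add (M := M)).choose_spec.2.1 n

theorem add_succ (n m : NN M) : n + succ m = succ (n + m) :=
  (exists_add (M := M)).choose_spec.2.2 n m

theorem ind {C : NN M → Prop} (hC : Def M C) (h0 : C 0)
    (hs : ∀ n, C n → C (succ n)) (n : NN M) : C n := induction hC h0 hs n

protected theorem zero_add (n : NN M) : 0 + n = n :=
  ind (C := fun n : NN M => (0 : NN M) + n = n) (by fun_prop) (NN.add_zero 0)
    (fun n ih => by rw [add_succ, ih]) n

theorem succ_add (n m : NN M) : succ n + m = succ (n + m) :=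
  ind (C := fun m => succ n + m = succ (n + m)) (by fun_prop)
    (by rw [NN.add_zero, NN.add_zero]) (fun m ih => by rw [add_succ, ih, add_succ]) m

protected theorem add_comm (n m : NN M) : n + m = m + n :=
  ind (C := fun m => n + m = m + n) (by fun_prop) (by rw [NN.add_zero, NN.zero_add])
    (fun m ih => by rw [add_succ, ih, succ_add]) m

protected theorem add_assoc (n m k : NN M) : n + m + k = n + (m + k) :=
  ind (C := fun k => n + m + k = n + (m + k)) (by fun_prop) (by rw [NN.add_zero, NN.add_zero])
    (fun m ih => by simp only [add_succ, ih]) k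

theorem exists_mul : ∃ f : NN M → NN M → NN M, Def M (fun p : NN M × NN M => f p.1 p.2) ∧
    (∀ x, f x zero = 0) ∧ ∀ x n, f x (succ n) = f x n + x :=
  exists_rec (a := fun x => (0 : NN M)) (g := fun x _ y => y + x) (by fun_prop) (by fun_prop)

noncomputable instance : Mul (NN M) := ⟨(exists_mul (M := M)).choose⟩

theorem def_mul : Def M fun p : NN M × NN M => p.1 * p.2 := (exists_mul (M := M)).choose_spec.1

@[fun_prop]
theorem _root_.ZFAnalysis.Def.nmul {α : Type*} [Coded M α] [Rep M α] {f g : α → NN M}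
    (hf : Def M f) (hg : Def M g) : Def M fun a => f a * g a := def_mul.comp (hf.prodMk hg)

protected theorem mul_zero (n : NN M) : n * 0 = 0 := (exists_mul (M := M)).choose_spec.2.1 n

theorem mul_succ (n m : NN M) : n * succ m = n * m + n :=
  (exists_mul (M := M)).choose_spec.2.2 n m

protected theorem zero_mul (n : NN M) : 0 * n = 0 :=
  ind (C := fun n : NN M => (0 : NN M) * n = (0 : NN M)) (by fun_prop) (NN.mul_zero 0)
    (fun n ih => by rw [mul_succ, ih, NN.add_zero]) n

theorem succ_mul (n m : NN M) : succ n * m = n * m + m :=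
  ind (C := fun m => succ n * m = n * m + m) (by fun_prop)
    (by simp only [NN.mul_zero, NN.add_zero]) (fun m ih => by
      simp only [mul_succ, ih, add_succ, NN.add_assoc]
      rw [NN.add_comm m n]) m

protected theorem mul_comm (n m : NN M) : n * m = m * n :=
  ind (C := fun m => n * m = m * n) (by fun_prop) (by rw [NN.mul_zero, NN.zero_mul])
    (fun m ih => by rw [mul_succ, ih, succ_mul]) m

protected theorem mul_add (n m k : NN M) : n * (m + k) = n * m + n * k :=
  ind (C := fun k => n * (m + k) = n * m + n * k) (by fun_prop)
    (by simp only [NN.mul_zero, NN.add_zero])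
    (fun k ih => by simp only [add_succ, mul_succ, ih, NN.add_assoc]) k

protected theorem mul_assoc (n m k : NN M) : n * m * k = n * (m * k) :=
  ind (C := fun k => n * m * k = n * (m * k)) (by fun_prop) (by simp only [NN.mul_zero])
    (fun k ih => by simp only [mul_succ, ih, NN.mul_add]) k

protected theorem mul_one (n : NN M) : n * 1 = n := by
  have : n * succ 0 = n := by rw [mul_succ, NN.mul_zero, NN.zero_add]
  exact this

noncomputable instance : CommSemiring (NN M) where
  add_assoc := NN.add_assoc
  zero_add := NN.zero_add
  add_zero := NN.add_zero
  add_comm := NN.add_comm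
  nsmul := nsmulRec
  left_distrib := NN.mul_add
  right_distrib a b c := by rw [NN.mul_comm, NN.mul_add, NN.mul_comm c a, NN.mul_comm c b]
  zero_mul := NN.zero_mul
  mul_zero := NN.mul_zero
  mul_assoc := NN.mul_assoc
  one_mul a := by rw [NN.mul_comm, NN.mul_one]
  mul_one := NN.mul_one
  mul_comm := NN.mul_comm

theorem succ_eq (n : NN M) : succ n = n + 1 := by
  have : n + succ 0 = succ n := by rw [add_succ, NN.add_zero]
  exact this.symm

instance : IsCancelAdd (NN M) := by
  have key : ∀ k n m : NN M, n + k = m + k → n = m := by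
    refine fun k => ind (C := fun k => ∀ n m : NN M, n + k = m + k → n = m) (by fun_prop)
      (fun n m h => by simpa using h) (fun k ih n m h => ?_) k
    rw [add_succ, add_succ] at h
    exact ih _ _ (succ_inj h)
  exact { add_left_cancel := fun k n m h => key k n m (by rw [add_comm n, add_comm m]; exact h)
          add_right_cancel := fun k n m h => key k n m h }

theorem eq_zero_or (n : NN M) : n = 0 ∨ ∃ m, n = m + 1 :=
  ind (C := fun n : NN M => n = (0 : NN M) ∨ ∃ m, n = m + 1) (by fun_prop) (Or.inl rfl)
    (fun n _ => Or.inr ⟨n, succ_eq n⟩) n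

theorem add_one_ne_zero (n : NN M) : n + 1 ≠ 0 := by
  rw [← succ_eq]
  exact succ_ne_zero n

theorem eq_zero_of_add {n m : NN M} (h : n + m = 0) : n = 0 := by
  rcases eq_zero_or m with rfl | ⟨k, rfl⟩
  · rwa [add_zero] at h
  · exact (add_one_ne_zero (n + k) (by rw [← h, add_assoc])).elim

theorem eq_zero_or_of_mul {n m : NN M} (h : n * m = 0) : n = 0 ∨ m = 0 := by
  rcases eq_zero_or m with rfl | ⟨k, rfl⟩
  · exact Or.inr rfl
  · left
    rw [mul_add, mul_one, add_comm] at h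
    exact eq_zero_of_add h

theorem exists_add_or (n m : NN M) : ∃ k, n = m + k ∨ m = n + k := by
  refine ind (C := fun n => ∃ k, n = m + k ∨ m = n + k) (by fun_prop) ⟨m, Or.inr (zero_add m).symm⟩
    (fun n ih => ?_) n
  obtain ⟨k, rfl | rfl⟩ := ih
  · exact ⟨k + 1, Or.inl (by rw [succ_eq, add_assoc])⟩
  · rcases eq_zero_or k with rfl | ⟨l, rfl⟩
    · exact ⟨1, Or.inl (by rw [succ_eq, add_zero])⟩
    · exact ⟨l, Or.inr (by rw [succ_eq]; ring)⟩

end NN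

/-! ### Differences and fractions -/

section Differences

variable (N : Type u) [CommSemiring N] [IsCancelAdd N]

/-- Two pairs of elements of a cancellative semiring have the same difference. -/
def diffSetoid : Setoid (N × N) where
  r p q := p.1 + q.2 = q.1 + p.2
  iseqv := by
    refine ⟨fun p => rfl, fun h => h.symm, fun {p q r} h h' => ?_⟩
    refine add_right_cancel (b := q.2) ?_
    calc p.1 + r.2 + q.2 = (p.1 + q.2) + r.2 := by ring
      _ = (q.1 + r.2) + p.2 := by rw [h]; ring
      _ = r.1 + p.2 + q.2 := by rw [h']; ring

/-- The ring of differences of a cancellative semiring. -/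
def DiffRing : Type u := Quotient (diffSetoid N)

variable {N}

namespace DiffRing

/-- The difference of two elements. -/
def diff (a b : N) : DiffRing N := Quotient.mk (diffSetoid N) (a, b)

theorem diff_eq {a b c d : N} : diff a b = diff c d ↔ a + d = c + b := Quotient.eq

theorem ind {P : DiffRing N → Prop} (h : ∀ a b, P (diff a b)) (x : DiffRing N) : P x :=
  Quotient.ind (fun p => h p.1 p.2) x

instance : Add (DiffRing N) := ⟨Quotient.map₂ (fun p q => (p.1 + q.1, p.2 + q.2)) (by
  intro p p' (h : _ + _ = _ + _) q q' (h' : _ + _ = _ + _)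
  change _ + _ = _ + _
  calc p.1 + q.1 + (p'.2 + q'.2) = (p.1 + p'.2) + (q.1 + q'.2) := by ring
    _ = p'.1 + q'.1 + (p.2 + q.2) := by rw [h, h']; ring)⟩

theorem diff_add (a b c d : N) : diff a b + diff c d = diff (a + c) (b + d) := rfl

instance : Mul (DiffRing N) := ⟨Quotient.map₂
  (fun p q => (p.1 * q.1 + p.2 * q.2, p.1 * q.2 + p.2 * q.1)) (by
  intro p p' (h : _ + _ = _ + _) q q' (h' : _ + _ = _ + _)
  change _ + _ = _ + _
  refine add_right_cancel (b := p'.1 * q.2 + p'.2 * q.1) ?_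
  calc p.1 * q.1 + p.2 * q.2 + (p'.1 * q'.2 + p'.2 * q'.1) + (p'.1 * q.2 + p'.2 * q.1) =
      (p.1 + p'.2) * q.1 + (p'.1 + p.2) * q.2 + p'.1 * q'.2 + p'.2 * q'.1 := by ring
    _ = (p'.1 + p.2) * q.1 + (p.1 + p'.2) * q.2 + p'.1 * q'.2 + p'.2 * q'.1 := by rw [h]
    _ = p'.1 * (q.1 + q'.2) + p'.2 * (q'.1 + q.2) + p.2 * q.1 + p.1 * q.2 := by ring
    _ = p'.1 * (q'.1 + q.2) + p'.2 * (q.1 + q'.2) + p.2 * q.1 + p.1 * q.2 := by rw [h']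
    _ = p'.1 * q'.1 + p'.2 * q'.2 + (p.1 * q.2 + p.2 * q.1) + (p'.1 * q.2 + p'.2 * q.1) := by
      ring)⟩

theorem diff_mul (a b c d : N) : diff a b * diff c d = diff (a * c + b * d) (a * d + b * c) := rfl

instance : Neg (DiffRing N) := ⟨Quotient.map (fun p => (p.2, p.1)) (by
  intro p p' (h : _ + _ = _ + _)
  change _ + _ = _ + _
  rw [add_comm, ← h, add_comm])⟩

theorem neg_diff (a b : N) : -diff a b = diff b a := rfl

instance : Zero (DiffRing N) := ⟨diff 0 0⟩

instance : One (DiffRing N) := ⟨diff 1 0⟩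

theorem zero_def : (0 : DiffRing N) = diff 0 0 := rfl

theorem one_def : (1 : DiffRing N) = diff 1 0 := rfl

instance : CommRing (DiffRing N) where
  add_assoc x y z := by
    induction x using ind; induction y using ind; induction z using ind
    simp only [diff_add, diff_eq]; ring
  zero_add x := by
    induction x using ind
    simp only [zero_def, diff_add, diff_eq]; ring
  add_zero x := by
    induction x using ind
    simp only [zero_def, diff_add, diff_eq]; ring
  add_comm x y := by
    induction x using ind; induction y using ind
    simp only [diff_add, diff_eq]; ring
  left_distrib x y z := by
    induction x using ind; induction y using ind; induction z using ind
    simp only [diff_add, diff_mul, diff_eq]; ring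
  right_distrib x y z := by
    induction x using ind; induction y using ind; induction z using ind
    simp only [diff_add, diff_mul, diff_eq]; ring
  zero_mul x := by
    induction x using ind
    simp only [zero_def, diff_mul, diff_eq]; ring
  mul_zero x := by
    induction x using ind
    simp only [zero_def, diff_mul, diff_eq]; ring
  mul_assoc x y z := by
    induction x using ind; induction y using ind; induction z using ind
    simp only [diff_mul, diff_eq]; ring
  one_mul x := by
    induction x using ind
    simp only [one_def, diff_mul, diff_eq]; ring
  mul_one x := by
    induction x using ind
    simp only [one_def, diff_mul, diff_eq]; ring
  mul_comm x y := by
    induction x using ind; induction y using ind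
    simp only [diff_mul, diff_eq]; ring
  neg_add_cancel x := by
    induction x using ind
    simp only [zero_def, neg_diff, diff_add, diff_eq]; ring
  nsmul := nsmulRec
  zsmul := zsmulRec

variable (N) in
/-- The inclusion of a semiring in its ring of differences. -/
def of : N →+* DiffRing N where
  toFun a := diff a 0
  map_one' := rfl
  map_zero' := rfl
  map_add' a b := by simp only [diff_add, diff_eq]; ring
  map_mul' a b := by simp only [diff_mul, diff_eq]; ring

theorem of_injective : Function.Injective (of N) := fun a b h => by
  have : a + 0 = b + 0 := diff_eq.1 h
  simpa using this

theorem diff_eq_sub (a b : N) : diff a b = of N a - of N b := by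
  rw [sub_eq_add_neg]
  change diff a b = diff a 0 + -diff b 0
  simp only [neg_diff, diff_add, add_zero, zero_add]

end DiffRing

end Differences

/-- A set of nonnegative elements turns a domain into a linearly ordered ring. -/
theorem exists_linearOrder {K : Type u} [CommRing K] [IsDomain K] (P : K → Prop)
    (hadd : ∀ x y, P x → P y → P (x + y)) (hmul : ∀ x y, P x → P y → P (x * y))
    (hanti : ∀ x, P x → P (-x) → x = 0) (htot : ∀ x, P x ∨ P (-x)) :
    ∃ _ : LinearOrder K, IsStrictOrderedRing K ∧ ∀ x : K, 0 ≤ x ↔ P x := by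
  classical
  have h0 : P 0 := by simpa using htot 0
  have h1 : P 1 := by
    rcases htot 1 with h | h
    · exact h
    · simpa using hmul _ _ h h
  let C : RingCone K :=
    { carrier := {x | P x}
      add_mem' := fun {x y} => hadd x y
      mul_mem' := fun {x y} => hmul x y
      zero_mem' := h0
      one_mem' := h1
      eq_zero_of_mem_of_neg_mem' := fun {x} => hanti x }
  have : HasMemOrNegMem C := ⟨htot⟩
  let _ : LinearOrder K := LinearOrder.mkOfAddGroupCone C
  have : IsOrderedRing K := IsOrderedRing.mkOfCone C
  refine ⟨inferInstance, IsOrderedRing.toIsStrictOrderedRing K, fun x => ?_⟩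
  change x - 0 ∈ C ↔ P x
  rw [sub_zero]
  rfl

/-- A semiring with the properties of the natural numbers embeds in a linearly ordered field of
fractions of differences. -/
theorem exists_field_of_fractions (N : Type u) [CommSemiring N] [IsCancelAdd N]
    (hdiff : ∀ n m : N, ∃ k, n = m + k ∨ m = n + k) (hadd : ∀ n m : N, n + m = 0 → n = 0)
    (hmul : ∀ n m : N, n * m = 0 → n = 0 ∨ m = 0) (hone : ∀ n : N, n + 1 ≠ 0)
    (hsucc : ∀ n : N, n = 0 ∨ ∃ m, n = m + 1) :
    ∃ (Q : Type u) (_ : Field Q) (_ : LinearOrder Q) (_ : IsStrictOrderedRing Q) (i : N →+* Q),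
      Function.Injective i ∧ (∀ n, 0 ≤ i n) ∧ ∀ x, ∃ a b c, x = (i a - i b) / (i c + 1) := by
  have hpm : ∀ x : DiffRing N, ∃ n, x = DiffRing.of N n ∨ x = -DiffRing.of N n := by
    refine DiffRing.ind fun a b => ?_
    obtain ⟨k, rfl | rfl⟩ := hdiff a b
    · exact ⟨k, Or.inl (by rw [DiffRing.diff_eq_sub, map_add]; ring)⟩
    · exact ⟨k, Or.inr (by rw [DiffRing.diff_eq_sub, map_add]; ring)⟩
  have hof : ∀ n, DiffRing.of N n = 0 → n = 0 := fun n h =>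
    DiffRing.of_injective (h.trans (map_zero _).symm)
  have hnt : Nontrivial (DiffRing N) := ⟨⟨0, 1, fun h => by
    have := DiffRing.of_injective ((map_zero (DiffRing.of N)).trans (h.trans (map_one _).symm))
    exact hone 0 (by rw [zero_add, ← this])⟩⟩
  have hnz : NoZeroDivisors (DiffRing N) := by
    refine ⟨fun {x y} hxy => ?_⟩
    have key : ∀ n m, DiffRing.of N n * DiffRing.of N m = 0 →
        DiffRing.of N n = 0 ∨ DiffRing.of N m = 0 := fun n m h => by
      rw [← map_mul] at h
      rcases hmul n m (hof _ h) with rfl | rfl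
      · exact Or.inl (map_zero _)
      · exact Or.inr (map_zero _)
    obtain ⟨n, rfl | rfl⟩ := hpm x <;> obtain ⟨m, rfl | rfl⟩ := hpm y <;>
    (try simp only [neg_mul, mul_neg, neg_neg, neg_eq_zero] at hxy) <;>
    (try simp only [neg_eq_zero]) <;> exact key n m hxy
  have hdom : IsDomain (DiffRing N) := NoZeroDivisors.to_isDomain _
  obtain ⟨i, hi⟩ : ∃ i : N →+* FractionRing (DiffRing N),
      ∀ n, i n = algebraMap (DiffRing N) _ (DiffRing.of N n) := ⟨(algebraMap _ _).comp (DiffRing.of N),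
        fun _ => rfl⟩
  have hinj : Function.Injective i := fun a b h => by
    rw [hi, hi] at h
    exact DiffRing.of_injective (IsFractionRing.injective _ _ h)
  have hi0 : ∀ n, i n + 1 ≠ 0 := fun n h => hone n (hinj (by rw [map_add, map_one, h, map_zero]))
  -- Writing denominators as `c + 1` removes all side conditions; the elements without the minus
  -- sign form the positive cone.
  have hsur : ∀ x, ∃ n c, x = i n / (i c + 1) ∨ x = -(i n / (i c + 1)) := by
    intro x
    obtain ⟨p, q, hq, rfl⟩ := IsFractionRing.div_surjective (A := DiffRing N) x
    have hq0 : q ≠ 0 := nonZeroDivisors.ne_zero hq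
    obtain ⟨n, hn⟩ := hpm p
    obtain ⟨m, hm⟩ := hpm q
    rcases hsucc m with rfl | ⟨c, rfl⟩
    · exact (hq0 (by simpa using hm)).elim
    refine ⟨n, c, ?_⟩
    have e : algebraMap (DiffRing N) (FractionRing (DiffRing N)) (DiffRing.of N (c + 1)) =
        i c + 1 := by rw [hi, map_add, map_add, map_one, map_one]
    rcases hn with rfl | rfl <;> rcases hm with rfl | rfl <;>
    simp only [map_neg, e, ← hi, neg_div, div_neg, neg_neg, true_or, or_true]
  have hPadd : ∀ x y, (∃ n c, x = i n / (i c + 1)) → (∃ n c, y = i n / (i c + 1)) →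
      ∃ n c, x + y = i n / (i c + 1) := by
    rintro _ _ ⟨n, c, rfl⟩ ⟨m, d, rfl⟩
    -- The common denominator is `(c + 1) (d + 1) = (c d + c + d) + 1`.
    refine ⟨n * (d + 1) + (c + 1) * m, c * d + c + d, ?_⟩
    rw [div_add_div _ _ (hi0 c) (hi0 d)]
    simp only [map_add, map_mul, map_one]
    congr 1
    ring
  have hPmul : ∀ x y, (∃ n c, x = i n / (i c + 1)) → (∃ n c, y = i n / (i c + 1)) →
      ∃ n c, x * y = i n / (i c + 1) := by
    rintro _ _ ⟨n, c, rfl⟩ ⟨m, d, rfl⟩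
    refine ⟨n * m, c * d + c + d, ?_⟩
    rw [div_mul_div_comm]
    simp only [map_add, map_mul]
    congr 1
    ring
  have hPanti : ∀ x, (∃ n c, x = i n / (i c + 1)) → (∃ n c, -x = i n / (i c + 1)) → x = 0 := by
    rintro _ ⟨n, c, rfl⟩ ⟨m, d, h⟩
    have h1 : i m / (i d + 1) + i n / (i c + 1) = 0 := by rw [← h, neg_add_cancel]
    rw [div_add_div _ _ (hi0 d) (hi0 c), div_eq_zero_iff] at h1
    have h2 := h1.resolve_right (mul_ne_zero (hi0 d) (hi0 c))
    have h3 : (d + 1) * n + m * (c + 1) = 0 := hinj (by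
      simp only [map_add, map_mul, map_one, map_zero]
      rw [← h2]
      ring)
    rcases hmul _ _ (hadd _ _ h3) with h4 | h4
    · exact (hone d h4).elim
    · rw [h4, map_zero, zero_div]
  have hPtot : ∀ x, (∃ n c, x = i n / (i c + 1)) ∨ (∃ n c, -x = i n / (i c + 1)) := by
    intro x
    obtain ⟨n, c, rfl | rfl⟩ := hsur x
    · exact Or.inl ⟨n, c, rfl⟩
    · exact Or.inr ⟨n, c, neg_neg _⟩
  obtain ⟨o, ho, hP⟩ := exists_linearOrder _ hPadd hPmul hPanti hPtot
  refine ⟨_, inferInstance, o, ho, i, hinj, fun n => (hP _).2 ⟨n, 0, by simp⟩, fun x => ?_⟩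
  obtain ⟨n, c, rfl | rfl⟩ := hsur x
  · exact ⟨n, 0, c, by simp⟩
  · exact ⟨0, n, c, by simp [neg_div]⟩

/-! ### Quotients of sets of the model -/

section Quotients

variable {M : Type u} [Membership M M] [ZFModel M] {S : Type v} {T : Type w} [Coded M S] [Rep M S]
  [Tot M S] [Sm M S]

/-- The elements of a quotient are coded as equivalence classes. -/
abbrev codedQuotient (M : Type u) [Membership M M] {S : Type v} {T : Type w} [Coded M S]
    (mk : S → T) : Coded M T where
  IsCode t m := IsCode {s | mk s = t} m

theorem def_mk_codedQuotient {mk : S → T} (hk : Def M fun p : S × S => mk p.1 = mk p.2) :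
    @Def M _ S T _ (codedQuotient M mk) mk := by
  have h : Def M fun t : S => {s : S | mk s = mk t} := by
    refine Def.ofPred (P := fun t s => mk s = mk t) ?_
    exact hk.comp (Def.snd'.prodMk Def.fst')
  exact @Def.mk _ _ _ _ _ (codedQuotient M mk) _ h.internal h.graph

theorem tot_codedQuotient {mk : S → T} (hs : Function.Surjective mk)
    (hk : Def M fun p : S × S => mk p.1 = mk p.2) : @Tot M _ T (codedQuotient M mk) :=
  @Tot.mk _ _ _ (codedQuotient M mk) fun t => by
    obtain ⟨s, rfl⟩ := hs t
    exact @Def.internal _ _ S T _ (codedQuotient M mk) mk (def_mk_codedQuotient hk) s (internal s)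

theorem rep_codedQuotient {mk : S → T} (hs : Function.Surjective mk)
    (hk : Def M fun p : S × S => mk p.1 = mk p.2) : @Rep M _ T (codedQuotient M mk) := by
  refine @Rep.mk _ _ _ (codedQuotient M mk) (fun h h' => Rep.unique (α := Set S) h h')
    (fun {a b m} h h' => ?_) ?_
  · have h' : IsCode {s | mk s = b} m := h'
    have := Rep.inj (a := {s | mk s = a}) h h'
    obtain ⟨s, rfl⟩ := hs a
    have h1 : s ∈ {s | mk s = b} := this ▸ rfl
    exact h1
  -- The codes are those of the sets that are the class of some element.
  · have h : Def M fun C : Set S => ∃ s, ∀ t, t ∈ C ↔ mk t = mk s := by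
      have h2 : Def M fun p : (Set S × S) × S => mk p.2 = mk p.1.2 :=
        hk.comp (Def.snd'.prodMk Def.fst'.snd)
      fun_prop
    refine h.d1.of_iff fun m => ?_
    constructor
    · rintro ⟨C, hC, s, hCs⟩
      refine ⟨mk s, ?_⟩
      rwa [show C = {t | mk t = mk s} from Set.ext hCs] at hC
    · rintro ⟨t, ht⟩
      obtain ⟨s, rfl⟩ := hs t
      exact ⟨_, ht, s, fun _ => Iff.rfl⟩

theorem sm_codedQuotient {mk : S → T} (hs : Function.Surjective mk)
    (hk : Def M fun p : S × S => mk p.1 = mk p.2) : @Sm M _ T (codedQuotient M mk) := by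
  obtain ⟨A, hA⟩ := Sm.exists_set (M := M) (α := Set S)
  exact @Sm.of_bound _ _ _ (codedQuotient M mk) _ (rep_codedQuotient hs hk) A
    fun t m h => (hA m).2 ⟨_, h⟩

end Quotients

/-! ### The rational numbers of the model -/

section Rationals

variable (M : Type u) [Membership M M] [ZFModel M]

/-- The natural numbers of the model embed in an archimedean ordered field. -/
theorem exists_rationals : ∃ (Q : Type u) (_ : Field Q) (_ : LinearOrder Q)
    (_ : IsStrictOrderedRing Q) (_ : Coded M Q) (_ : Rep M Q) (_ : Tot M Q) (_ : Sm M Q)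
    (_ : DefField M Q) (i : NN M →+* Q), Def M (fun n => i n) ∧ (∀ n, 0 ≤ i n) ∧
      (∀ n m, i n < i m → i n + 1 ≤ i m) ∧ Function.Injective i ∧ ∀ x, ∃ n, x ≤ i n := by
  obtain ⟨Q, _, _, _, i, hinj, h0, hsur⟩ := exists_field_of_fractions (NN M) NN.exists_add_or
    (fun n m => NN.eq_zero_of_add) (fun n m => NN.eq_zero_or_of_mul) NN.add_one_ne_zero NN.eq_zero_or
  have hpos : ∀ c, 0 < i c + 1 := fun c => by linarith [h0 c]
  have hle : ∀ n m, i n ≤ i m ↔ ∃ k, m = n + k := by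
    intro n m
    constructor
    · intro h
      obtain ⟨k, rfl | rfl⟩ := NN.exists_add_or n m
      · rw [map_add] at h
        have : i k = 0 := le_antisymm (by linarith) (h0 k)
        rw [← map_zero i] at this
        exact ⟨0, by rw [hinj this]; simp⟩
      · exact ⟨k, rfl⟩
    · rintro ⟨k, rfl⟩
      rw [map_add]
      linarith [h0 k]
  -- A fraction is represented by a triple `(a, b, c)` standing for `(a - b)/(c + 1)`. Equality,
  -- order and operations become polynomial conditions on natural numbers, hence definable.
  obtain ⟨mk, hmk⟩ : ∃ mk : NN M × NN M × NN M → Q,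
      ∀ p, mk p = (i p.1 - i p.2.1) / (i p.2.2 + 1) := ⟨_, fun _ => rfl⟩
  have hs : Function.Surjective mk := fun x => by
    obtain ⟨a, b, c, rfl⟩ := hsur x
    exact ⟨(a, b, c), hmk _⟩
  have hk : Def M fun p : (NN M × NN M × NN M) × (NN M × NN M × NN M) => mk p.1 = mk p.2 := by
    refine Def.of_iff (P := fun p : (NN M × NN M × NN M) × (NN M × NN M × NN M) =>
      p.1.1 * (p.2.2.2 + 1) + p.2.2.1 * (p.1.2.2 + 1) =
        p.2.1 * (p.1.2.2 + 1) + p.1.2.1 * (p.2.2.2 + 1)) (by fun_prop) fun p => ?_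
    rw [hmk, hmk, div_eq_div_iff (hpos _).ne' (hpos _).ne', ← hinj.eq_iff]
    simp only [map_add, map_mul, map_one]
    constructor <;> intro h <;> linarith
  let _ := codedQuotient M mk
  have hd : Def M mk := def_mk_codedQuotient hk
  have _ := rep_codedQuotient hs hk
  have _ := tot_codedQuotient hs hk
  have _ := sm_codedQuotient hs hk
  have hf : DefField M Q := by
    refine ⟨Def.of_graph ?_, Def.of_graph ?_, ?_⟩
    · refine Def.of_iff (P := fun p : (Q × Q) × Q => ∃ a b c a' b' c', p.1.1 = mk (a, b, c) ∧
        p.1.2 = mk (a', b', c') ∧ p.2 = mk (a * (c' + 1) + a' * (c + 1),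
          b * (c' + 1) + b' * (c + 1), c * c' + c + c')) (by fun_prop) ?_
      rintro ⟨⟨x, y⟩, z⟩
      have key : ∀ a b c a' b' c', mk (a, b, c) + mk (a', b', c') = mk (a * (c' + 1) + a' * (c + 1),
          b * (c' + 1) + b' * (c + 1), c * c' + c + c') := by
        intro a b c a' b' c'
        simp only [hmk, map_add, map_mul, map_one]
        rw [div_add_div _ _ (hpos _).ne' (hpos _).ne']
        congr 1 <;> ring
      dsimp only
      constructor
      · rintro rfl
        obtain ⟨⟨a, b, c⟩, rfl⟩ := hs x
        obtain ⟨⟨a', b', c'⟩, rfl⟩ := hs y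
        exact ⟨a, b, c, a', b', c', rfl, rfl, key _ _ _ _ _ _⟩
      · rintro ⟨a, b, c, a', b', c', rfl, rfl, h⟩
        exact h.trans (key _ _ _ _ _ _).symm
    · refine Def.of_iff (P := fun p : (Q × Q) × Q => ∃ a b c a' b' c', p.1.1 = mk (a, b, c) ∧
        p.1.2 = mk (a', b', c') ∧ p.2 = mk (a * a' + b * b', a * b' + b * a', c * c' + c + c'))
        (by fun_prop) ?_
      rintro ⟨⟨x, y⟩, z⟩
      have key : ∀ a b c a' b' c', mk (a, b, c) * mk (a', b', c') =
          mk (a * a' + b * b', a * b' + b * a', c * c' + c + c') := by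
        intro a b c a' b' c'
        simp only [hmk, map_add, map_mul]
        rw [div_mul_div_comm]
        congr 1 <;> ring
      dsimp only
      constructor
      · rintro rfl
        obtain ⟨⟨a, b, c⟩, rfl⟩ := hs x
        obtain ⟨⟨a', b', c'⟩, rfl⟩ := hs y
        exact ⟨a, b, c, a', b', c', rfl, rfl, key _ _ _ _ _ _⟩
      · rintro ⟨a, b, c, a', b', c', rfl, rfl, h⟩
        exact h.trans (key _ _ _ _ _ _).symm
    · refine Def.of_iff (P := fun p : Q × Q => ∃ a b c a' b' c', p.1 = mk (a, b, c) ∧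
        p.2 = mk (a', b', c') ∧
          ∃ k, a' * (c + 1) + b * (c' + 1) = a * (c' + 1) + b' * (c + 1) + k) (by fun_prop) ?_
      rintro ⟨x, y⟩
      have key : ∀ a b c a' b' c', mk (a, b, c) ≤ mk (a', b', c') ↔
          ∃ k, a' * (c + 1) + b * (c' + 1) = a * (c' + 1) + b' * (c + 1) + k := by
        intro a b c a' b' c'
        rw [← hle, hmk, hmk, div_le_div_iff₀ (hpos _) (hpos _)]
        simp only [map_add, map_mul, map_one]
        constructor <;> intro h <;> linarith
      constructor
      · intro h
        obtain ⟨⟨a, b, c⟩, rfl⟩ := hs x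
        obtain ⟨⟨a', b', c'⟩, rfl⟩ := hs y
        exact ⟨a, b, c, a', b', c', rfl, rfl, (key _ _ _ _ _ _).1 h⟩
      · rintro ⟨a, b, c, a', b', c', h1, h2, h⟩
        dsimp only at h1 h2 ⊢
        rw [h1, h2]
        exact (key _ _ _ _ _ _).2 h
  refine ⟨Q, _, _, inferInstance, _, inferInstance, inferInstance, inferInstance, hf, i, ?_, h0, ?_,
    hinj, ?_⟩
  · have : Def M fun n : NN M => mk (n, 0, 0) := by fun_prop
    exact this.congr fun n => by simp [hmk]
  · intro n m h
    obtain ⟨k, rfl⟩ := (hle n m).1 h.le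
    rcases NN.eq_zero_or k with rfl | ⟨l, rfl⟩
    · simp at h
    · simp only [map_add, map_one]
      linarith [h0 l]
  · intro x
    obtain ⟨a, b, c, rfl⟩ := hsur x
    -- The archimedean property is relative to the natural numbers of the model; the numerator `a`
    -- is a bound.
    refine ⟨a, (div_le_iff₀ (hpos c)).2 ?_⟩
    nlinarith [h0 a, h0 b, h0 c, mul_nonneg (h0 a) (h0 c)]

end Rationals

/-! ### Cauchy and null sequences -/

section Sequences

variable {N : Type v} {Q : Type u} [Field Q] [LinearOrder Q] [IsStrictOrderedRing Q] {i : N → Q}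

/-- `P` holds from some index on, the indices being ordered by their values under `i`. -/
def Ev (i : N → Q) (P : N → Prop) : Prop := ∃ n, ∀ m, i n ≤ i m → P m

theorem exists_ge_ge (i : N → Q) (n n' : N) : ∃ m, i n ≤ i m ∧ i n' ≤ i m := by
  rcases le_total (i n) (i n') with h | h
  exacts [⟨n', h, le_rfl⟩, ⟨n, le_rfl, h⟩]

theorem Ev.and {P P' : N → Prop} (h : Ev i P) (h' : Ev i P') : Ev i fun m => P m ∧ P' m := by
  obtain ⟨n, hn⟩ := h
  obtain ⟨n', hn'⟩ := h'
  obtain ⟨k, hk, hk'⟩ := exists_ge_ge i n n'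
  exact ⟨k, fun m hm => ⟨hn m (hk.trans hm), hn' m (hk'.trans hm)⟩⟩

theorem Ev.mono {P P' : N → Prop} (h : Ev i P) (hP : ∀ m, P m → P' m) : Ev i P' :=
  h.imp fun _ hn m hm => hP m (hn m hm)

theorem Ev.exists {P : N → Prop} (h : Ev i P) : ∃ m, P m := h.imp fun n hn => hn n le_rfl

/-- Cauchy sequences. -/
def IsCau (i : N → Q) (f : N → Q) : Prop :=
  ∀ ε, 0 < ε → ∃ n, ∀ m k, i n ≤ i m → i n ≤ i k → |f m - f k| ≤ ε

/-- Sequences converging to zero. -/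
def IsNull (i : N → Q) (f : N → Q) : Prop := ∀ ε, 0 < ε → Ev i fun m => |f m| ≤ ε

namespace IsCau

variable {f g : N → Q}

theorem exists_bound (hf : IsCau i f) : ∃ C, 0 < C ∧ Ev i fun m => |f m| ≤ C := by
  obtain ⟨n, hn⟩ := hf 1 one_pos
  refine ⟨|f n| + 1, by positivity, n, fun m hm => ?_⟩
  have h1 := hn m n hm le_rfl
  have h2 := abs_sub_abs_le_abs_sub (f m) (f n)
  linarith

theorem of_le (hf : IsCau i f) {C : Q} (hC : 0 < C)
    (h : ∃ n, ∀ m k, i n ≤ i m → i n ≤ i k → |g m - g k| ≤ C * |f m - f k|) : IsCau i g := by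
  intro ε hε
  obtain ⟨n, hn⟩ := hf (ε / C) (by positivity)
  obtain ⟨n', hn'⟩ := h
  obtain ⟨l, hl, hl'⟩ := exists_ge_ge i n n'
  refine ⟨l, fun m k hm hk => (hn' m k (hl'.trans hm) (hl'.trans hk)).trans ?_⟩
  have := hn m k (hl.trans hm) (hl.trans hk)
  calc C * |f m - f k| ≤ C * (ε / C) := by gcongr
    _ = ε := by field_simp

theorem const (n : N) (c : Q) : IsCau i fun _ => c := fun ε hε => ⟨n, fun m k _ _ => by simpa using hε.le⟩

theorem neg (hf : IsCau i f) : IsCau i (-f) :=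
  hf.of_le one_pos ((hf 1 one_pos).imp fun n _ m k _ _ => by
    rw [one_mul, Pi.neg_apply, Pi.neg_apply, ← abs_neg, neg_sub, sub_neg_eq_add, neg_add_eq_sub])

theorem abs (hf : IsCau i f) : IsCau i fun m => |f m| :=
  hf.of_le one_pos ((hf 1 one_pos).imp fun n _ m k _ _ => by
    rw [one_mul]
    exact abs_abs_sub_abs_le_abs_sub _ _)

theorem add (hf : IsCau i f) (hg : IsCau i g) : IsCau i (f + g) := by
  intro ε hε
  obtain ⟨n, hn⟩ := hf (ε / 2) (by positivity)
  obtain ⟨n', hn'⟩ := hg (ε / 2) (by positivity)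
  obtain ⟨l, hl, hl'⟩ := exists_ge_ge i n n'
  refine ⟨l, fun m k hm hk => ?_⟩
  have h1 := hn m k (hl.trans hm) (hl.trans hk)
  have h2 := hn' m k (hl'.trans hm) (hl'.trans hk)
  have h3 := abs_add_le (f m - f k) (g m - g k)
  rw [show (f + g) m - (f + g) k = f m - f k + (g m - g k) by simp only [Pi.add_apply]; ring]
  linarith

theorem mul (hf : IsCau i f) (hg : IsCau i g) : IsCau i (f * g) := by
  intro ε hε
  obtain ⟨C, hC, n₁, h₁⟩ := hf.exists_bound
  obtain ⟨D, hD, n₂, h₂⟩ := hg.exists_bound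
  obtain ⟨n, hn⟩ := hf (ε / (2 * D)) (by positivity)
  obtain ⟨n', hn'⟩ := hg (ε / (2 * C)) (by positivity)
  obtain ⟨l, hl, hl'⟩ := exists_ge_ge i n n'
  obtain ⟨l₂, hl₁, hl₂⟩ := exists_ge_ge i n₁ n₂
  obtain ⟨l₃, h1, h2⟩ := exists_ge_ge i l l₂
  refine ⟨l₃, fun m k hm hk => ?_⟩
  have e1 := hn m k (hl.trans (h1.trans hm)) (hl.trans (h1.trans hk))
  have e2 := hn' m k (hl'.trans (h1.trans hm)) (hl'.trans (h1.trans hk))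
  have e3 := h₁ m (hl₁.trans (h2.trans hm))
  have e4 := h₂ k (hl₂.trans (h2.trans hk))
  calc |(f * g) m - (f * g) k| = |f m * (g m - g k) + g k * (f m - f k)| := by
        simp only [Pi.mul_apply]
        ring_nf
    _ ≤ |f m| * |g m - g k| + |g k| * |f m - f k| := by
        rw [← abs_mul, ← abs_mul]
        exact abs_add_le _ _
    _ ≤ C * (ε / (2 * C)) + D * (ε / (2 * D)) := by gcongr
    _ = ε := by
        field_simp
        ring

theorem inv (hf : IsCau i f) {δ : Q} (hδ : 0 < δ) (h : Ev i fun m => δ ≤ |f m|) :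
    IsCau i fun m => (f m)⁻¹ := by
  refine hf.of_le (C := (δ * δ)⁻¹) (by positivity) (h.imp fun n hn m k hm hk => ?_)
  have e1 := hn m hm
  have e2 := hn k hk
  have h1 : f m ≠ 0 := fun h => by simp [h] at e1; linarith
  have h2 : f k ≠ 0 := fun h => by simp [h] at e2; linarith
  rw [inv_sub_inv h1 h2, abs_div, abs_mul, abs_sub_comm, div_eq_mul_inv, mul_comm]
  gcongr

/-- A Cauchy sequence that does not converge to zero is bounded away from zero. -/
theorem exists_pos (hf : IsCau i f) (h : ¬ IsNull i f) :
    ∃ δ, 0 < δ ∧ ((Ev i fun m => δ ≤ f m) ∨ Ev i fun m => δ ≤ -f m) := by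
  unfold IsNull Ev at h
  push Not at h
  obtain ⟨ε, hε, h⟩ := h
  obtain ⟨n, hn⟩ := hf (ε / 2) (by positivity)
  obtain ⟨m, hm, hlt⟩ := h n
  refine ⟨ε / 2, by positivity, ?_⟩
  rcases lt_abs.1 hlt with h' | h'
  · refine Or.inl ⟨n, fun k hk => ?_⟩
    have := (abs_le.1 (hn m k hm hk)).2
    linarith
  · refine Or.inr ⟨n, fun k hk => ?_⟩
    have := (abs_le.1 (hn m k hm hk)).1
    linarith

end IsCau

namespace IsNull

variable {f g : N → Q}

theorem mono (hf : IsNull i f) (h : Ev i fun m => |g m| ≤ |f m|) : IsNull i g := fun ε hε =>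
  ((hf ε hε).and h).mono fun _ h => h.2.trans h.1

theorem add (hf : IsNull i f) (hg : IsNull i g) : IsNull i (f + g) := fun ε hε =>
  ((hf (ε / 2) (by positivity)).and (hg (ε / 2) (by positivity))).mono fun m h => by
    have := abs_add_le (f m) (g m)
    rw [Pi.add_apply]
    linarith [h.1, h.2]

theorem mul_left (hf : IsCau i f) (hg : IsNull i g) : IsNull i (f * g) := fun ε hε => by
  obtain ⟨C, hC, h⟩ := hf.exists_bound
  refine (h.and (hg (ε / C) (by positivity))).mono fun m h => ?_
  rw [Pi.mul_apply, abs_mul]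
  calc |f m| * |g m| ≤ C * (ε / C) := by gcongr; exacts [h.1, h.2]
    _ = ε := by field_simp

theorem of_forall_ev (n : N) (h : Ev i fun m => f m = 0) : IsNull i f := fun ε hε =>
  h.mono fun m hm => by simpa [hm] using hε.le

end IsNull

end Sequences

/-! ### Completion by internal Cauchy sequences -/

section Completion

variable {M : Type u} [Membership M M] [ZFModel M] {Q : Type u} [Field Q] [LinearOrder Q]
  [IsStrictOrderedRing Q] [Coded M Q] [Rep M Q] [Tot M Q] [Sm M Q] [DefField M Q]

/-- The Cauchy sequences of the model. -/
def cauchySeq (i : NN M → Q) : Subring (NN M → Q) where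
  carrier := {f | Internal M f ∧ IsCau i f}
  zero_mem' := ⟨(Def.const (0 : Q)).isInt.out, IsCau.const 0 0⟩
  one_mem' := ⟨(Def.const (1 : Q)).isInt.out, IsCau.const 0 1⟩
  add_mem' := fun {f g} hf hg => ⟨((Def.of_isInt ⟨hf.1⟩).radd (Def.of_isInt ⟨hg.1⟩)).isInt.out,
    hf.2.add hg.2⟩
  mul_mem' := fun {f g} hf hg => ⟨((Def.of_isInt ⟨hf.1⟩).rmul (Def.of_isInt ⟨hg.1⟩)).isInt.out,
    hf.2.mul hg.2⟩
  neg_mem' := fun {f} hf => ⟨(Def.of_isInt ⟨hf.1⟩).rneg.isInt.out, hf.2.neg⟩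

variable {i : NN M → Q}

theorem cauchySeq.def (f : cauchySeq i) : Def M f.1 := Def.of_isInt ⟨f.2.1⟩

/-- The Cauchy sequences converging to zero. -/
def nullSeq (i : NN M → Q) : Ideal (cauchySeq i) where
  carrier := {f | IsNull i f.1}
  zero_mem' := IsNull.of_forall_ev 0 ⟨0, fun _ _ => rfl⟩
  add_mem' := fun hf hg => hf.add hg
  smul_mem' := fun c _ hf => hf.mul_left c.2.2

theorem mem_nullSeq {f : cauchySeq i} : f ∈ nullSeq i ↔ IsNull i f.1 := Iff.rfl

theorem isField_quotient_nullSeq (i : NN M → Q) : IsField (cauchySeq i ⧸ nullSeq i) where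
  exists_pair_ne := by
    refine ⟨1, 0, fun h => ?_⟩
    have h1 : (1 : cauchySeq i) ∈ nullSeq i := Ideal.Quotient.eq_zero_iff_mem.1 (by rw [map_one, h])
    obtain ⟨m, hm⟩ := (mem_nullSeq.1 h1 (1 / 2) (by positivity)).exists
    change |(1 : Q)| ≤ 1 / 2 at hm
    norm_num at hm
  mul_comm := mul_comm
  mul_inv_cancel := by
    intro x hx
    obtain ⟨f, rfl⟩ := Ideal.Quotient.mk_surjective x
    have hf : ¬ IsNull i f.1 := fun h => hx (Ideal.Quotient.eq_zero_iff_mem.2 h)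
    obtain ⟨δ, hδ, h⟩ := f.2.2.exists_pos hf
    have h' : Ev i fun m => δ ≤ |f.1 m| := by
      rcases h with h | h
      · exact h.mono fun m h => h.trans (le_abs_self _)
      · exact h.mono fun m h => h.trans (neg_le_abs _)
    -- The inverse takes the default value `0` where `f` vanishes; this affects no index beyond the
    -- one from which `f` is bounded away from zero.
    refine ⟨Ideal.Quotient.mk _ ⟨fun m => (f.1 m)⁻¹, (cauchySeq.def f).rinv.isInt.out,
      f.2.2.inv hδ h'⟩, ?_⟩
    rw [← map_mul, ← map_one (Ideal.Quotient.mk (nullSeq i)), Ideal.Quotient.eq]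
    refine IsNull.of_forall_ev 0 (h'.mono fun m hm => ?_)
    have : f.1 m ≠ 0 := fun h => by simp [h] at hm; linarith
    change f.1 m * (f.1 m)⁻¹ - 1 = 0
    rw [mul_inv_cancel₀ this, sub_self]

theorem exists_completion (i : NN M → Q) : ∃ (K : Type u) (_ : Field K) (mk : cauchySeq i →+* K),
    Function.Surjective mk ∧ ∀ f, mk f = 0 ↔ IsNull i f.1 :=
  ⟨_, (isField_quotient_nullSeq i).toField, Ideal.Quotient.mk (nullSeq i),
    Ideal.Quotient.mk_surjective, fun _ => Ideal.Quotient.eq_zero_iff_mem⟩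

/-- The absolute value of a Cauchy sequence. -/
def absSeq (f : cauchySeq i) : cauchySeq i :=
  ⟨fun m => |f.1 m|, (cauchySeq.def f).rabs.isInt.out, f.2.2.abs⟩

/-- `mk` identifies the ordered field `K` with the Cauchy sequences modulo those converging to
zero. -/
structure IsCompletion {K : Type*} [Field K] [LinearOrder K] (mk : cauchySeq i →+* K) : Prop where
  surj : Function.Surjective mk
  eq_zero_iff : ∀ f, mk f = 0 ↔ IsNull i f.1
  nonneg_iff : ∀ x, 0 ≤ x ↔ ∃ f : cauchySeq i, (∀ m, 0 ≤ f.1 m) ∧ mk f = x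

theorem mk_absSeq {K : Type*} [Field K] {mk : cauchySeq i →+* K}
    (hk : ∀ f, mk f = 0 ↔ IsNull i f.1) {f : cauchySeq i} (hf : Ev i fun m => 0 ≤ f.1 m) :
    mk (absSeq f) = mk f := by
  rw [← sub_eq_zero, ← map_sub, hk]
  refine IsNull.of_forall_ev 0 (hf.mono fun m hm => ?_)
  change |f.1 m| - f.1 m = 0
  rw [abs_of_nonneg hm, sub_self]

theorem exists_isCompletion (i : NN M → Q) : ∃ (K : Type u) (_ : Field K) (_ : LinearOrder K)
    (_ : IsStrictOrderedRing K) (mk : cauchySeq i →+* K), IsCompletion mk := by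
  obtain ⟨K, _, mk, hs, hk⟩ := exists_completion i
  obtain ⟨o, ho, hP⟩ := exists_linearOrder (fun x : K => ∃ f : cauchySeq i, (∀ m, 0 ≤ f.1 m) ∧ mk f = x)
    (by
      rintro _ _ ⟨f, hf, rfl⟩ ⟨g, hg, rfl⟩
      exact ⟨f + g, fun m => add_nonneg (hf m) (hg m), map_add _ _ _⟩)
    (by
      rintro _ _ ⟨f, hf, rfl⟩ ⟨g, hg, rfl⟩
      exact ⟨f * g, fun m => mul_nonneg (hf m) (hg m), map_mul _ _ _⟩)
    (by
      rintro _ ⟨f, hf, rfl⟩ ⟨g, hg, h⟩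
      rw [hk]
      -- Two nonnegative sequences with null sum are null, as `|f| ≤ |f + g|`.
      have h1 : mk (f + g) = 0 := by rw [map_add, h, add_neg_cancel]
      refine ((hk _).1 h1).mono ⟨0, fun m _ => ?_⟩
      change |f.1 m| ≤ |f.1 m + g.1 m|
      rw [abs_of_nonneg (hf m), abs_of_nonneg (add_nonneg (hf m) (hg m))]
      linarith [hg m])
    (by
      intro x
      obtain ⟨f, rfl⟩ := hs x
      by_cases hf : IsNull i f.1
      · rw [(hk f).2 hf]
        exact Or.inl ⟨0, fun m => le_rfl, map_zero _⟩
      · obtain ⟨δ, hδ, h | h⟩ := f.2.2.exists_pos hf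
        · exact Or.inl ⟨absSeq f, fun m => abs_nonneg _, mk_absSeq hk (h.mono fun m hm => hδ.le.trans hm)⟩
        · refine Or.inr ⟨absSeq (-f), fun m => abs_nonneg _, ?_⟩
          rw [mk_absSeq hk (h.mono fun m hm => hδ.le.trans hm), map_neg])
  exact ⟨K, _, o, ho, mk, ⟨hs, hk, hP⟩⟩

end Completion

section Completion

variable {M : Type u} [Membership M M] [ZFModel M] {Q : Type u} [Field Q] [LinearOrder Q]
  [IsStrictOrderedRing Q] [Coded M Q] [Rep M Q] [Tot M Q] [Sm M Q] [DefField M Q]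

/-- The constant sequences. -/
def constSeq (i : NN M → Q) : Q →+* cauchySeq i where
  toFun q := ⟨fun _ => q, (Def.const q).isInt.out, IsCau.const 0 q⟩
  map_one' := rfl
  map_zero' := rfl
  map_add' _ _ := rfl
  map_mul' _ _ := rfl

namespace IsCompletion

variable {i : NN M →+* Q} {K : Type u} [Field K] [LinearOrder K] [IsStrictOrderedRing K]
  {mk : cauchySeq i →+* K}

theorem le_of_ev (h : IsCompletion mk) {f g : cauchySeq i} (hfg : Ev i fun m => f.1 m ≤ g.1 m) :
    mk f ≤ mk g := by
  rw [← sub_nonneg, ← map_sub, h.nonneg_iff]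
  exact ⟨absSeq (g - f), fun m => abs_nonneg _, mk_absSeq h.eq_zero_iff (hfg.mono fun m hm =>
    sub_nonneg.2 hm)⟩

/-- The slack `ε` is unavoidable because representatives matter only up to null sequences. With it,
the order becomes definable on representatives. -/
theorem ev_of_le (h : IsCompletion mk) {f g : cauchySeq i} (hfg : mk f ≤ mk g) {ε : Q}
    (hε : 0 < ε) : Ev i fun m => f.1 m ≤ g.1 m + ε := by
  rw [← sub_nonneg, h.nonneg_iff] at hfg
  obtain ⟨k, hk, hkm⟩ := hfg
  have h1 : mk (g - f - k) = 0 := by rw [map_sub, map_sub, hkm, sub_self]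
  refine ((h.eq_zero_iff _).1 h1 ε hε).mono fun m hm => ?_
  change |g.1 m - f.1 m - k.1 m| ≤ ε at hm
  linarith [(abs_le.1 hm).1, hk m]

variable (mk) in
/-- The constants of the completion. -/
noncomputable def ofConst : Q →+* K := mk.comp (constSeq i)

theorem ofConst_mono (h : IsCompletion mk) {p q : Q} (hpq : p ≤ q) : ofConst mk p ≤ ofConst mk q :=
  h.le_of_ev ⟨0, fun _ _ => hpq⟩

theorem exists_le (h : IsCompletion mk) (hi : ∀ x, ∃ n, x ≤ i n) (x : K) :
    ∃ n, x ≤ ofConst mk (i n) := by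
  obtain ⟨f, rfl⟩ := h.surj x
  obtain ⟨C, -, hC⟩ := f.2.2.exists_bound
  obtain ⟨n, hn⟩ := hi C
  exact ⟨n, h.le_of_ev (hC.mono fun m hm => (le_abs_self _).trans (hm.trans hn))⟩

theorem exists_pos_le (h : IsCompletion mk) (hi : ∀ x, ∃ n, x ≤ i n) {y : K} (hy : 0 < y) :
    ∃ ε, 0 < ε ∧ ofConst mk ε ≤ y := by
  obtain ⟨n, hn⟩ := h.exists_le hi y⁻¹
  have h1 : 0 < ofConst mk (i n) := (inv_pos.2 hy).trans_le hn
  have h2 : 0 < i n := by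
    by_contra! h'
    have := h.ofConst_mono h'
    rw [map_zero] at this
    exact absurd h1 this.not_gt
  refine ⟨(i n)⁻¹, inv_pos.2 h2, ?_⟩
  rw [map_inv₀]
  exact inv_le_of_inv_le₀ hy hn

theorem le_of_forall (h : IsCompletion mk) (hi : ∀ x, ∃ n, x ≤ i n) {x y : K}
    (hxy : ∀ ε, 0 < ε → x ≤ y + ofConst mk ε) : x ≤ y := by
  by_contra! hlt
  obtain ⟨ε, hε, hle⟩ := h.exists_pos_le hi (half_pos (sub_pos.2 hlt))
  linarith [hxy ε hε]

theorem exists_inv_le (hi : ∀ x, ∃ n, x ≤ i n) (h0 : ∀ n, 0 ≤ i n) {ε : Q} (hε : 0 < ε) :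
    ∃ n, ∀ m, i n ≤ i m → (i m + 1)⁻¹ ≤ ε := by
  obtain ⟨n, hn⟩ := hi ε⁻¹
  exact ⟨n, fun m hm => inv_le_of_inv_le₀ hε (by linarith)⟩

/-- An upper bound cannot lie below a number that is not one, so `s n - 1/(n + 1) ≤ s m` for all `m`
and `n`. -/
theorem isCau_of_upperBounds (h : IsCompletion mk) (hi : ∀ x, ∃ n, x ≤ i n) (h0 : ∀ n, 0 ≤ i n)
    {S : Set K} {s : NN M → Q} (h1 : ∀ n, ofConst mk (s n) ∈ upperBounds S)
    (h2 : ∀ n, ofConst mk (s n - (i n + 1)⁻¹) ∉ upperBounds S) : IsCau i s := by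
  have key : ∀ m n, s n - (i n + 1)⁻¹ ≤ s m := by
    intro m n
    by_contra! hlt
    exact h2 n fun x hx => (h1 m hx).trans (h.ofConst_mono hlt.le)
  intro ε hε
  obtain ⟨n, hn⟩ := exists_inv_le hi h0 hε
  refine ⟨n, fun m k hm hk => abs_le.2 ⟨?_, ?_⟩⟩
  · linarith [key m k, hn k hk]
  · linarith [key k m, hn m hm]

/-- The limit is squeezed between the upper bounds `s n` and the numbers `s n - 1/(n + 1)`, which
are not upper bounds. By the archimedean property inequalities need only be proved up to a constant
`ε`. -/
theorem isLUB (h : IsCompletion mk) (hi : ∀ x, ∃ n, x ≤ i n) (h0 : ∀ n, 0 ≤ i n)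
    {S : Set K} {s : cauchySeq i} (h1 : ∀ n, ofConst mk (s.1 n) ∈ upperBounds S)
    (h2 : ∀ n, ofConst mk (s.1 n - (i n + 1)⁻¹) ∉ upperBounds S) : IsLUB S (mk s) := by
  constructor
  · intro x hx
    refine h.le_of_forall hi fun ε hε => ?_
    obtain ⟨n, hn⟩ := s.2.2 ε hε
    refine (h1 n hx).trans ?_
    rw [ofConst, RingHom.comp_apply, RingHom.comp_apply, ← map_add]
    refine h.le_of_ev ⟨n, fun m hm => ?_⟩
    change s.1 n ≤ s.1 m + ε
    linarith [(abs_le.1 (hn n m le_rfl hm)).2]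
  · intro y hy
    refine h.le_of_forall hi fun ε hε => ?_
    obtain ⟨n, hn⟩ := s.2.2 (ε / 2) (by positivity)
    obtain ⟨n', hn'⟩ := exists_inv_le hi h0 (half_pos hε)
    obtain ⟨k, hk, hk'⟩ := exists_ge_ge i n n'
    have e1 : mk s ≤ ofConst mk (s.1 k - (i k + 1)⁻¹) + ofConst mk ε := by
      rw [ofConst, RingHom.comp_apply, RingHom.comp_apply, ← map_add]
      refine h.le_of_ev ⟨n, fun m hm => ?_⟩
      change s.1 m ≤ s.1 k - (i k + 1)⁻¹ + ε
      linarith [(abs_le.1 (hn m k hm hk)).2, hn' k hk']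
    refine e1.trans (add_le_add_left ?_ _)
    by_contra! hlt
    exact h2 k fun x hx => (hy hx).trans hlt.le

end IsCompletion

variable (M) in
/-- There is a complete ordered field whose elements are objects of the model. -/
theorem exists_complete_field : ∃ (K : Type u) (_ : Field K) (_ : LinearOrder K)
    (_ : IsStrictOrderedRing K) (_ : Coded M K) (_ : Rep M K) (_ : Tot M K) (_ : Sm M K),
    DefField M K ∧
      ∀ S : Set K, Internal M S → S.Nonempty → BddAbove S → ∃ s, IsLUB S s := by
  obtain ⟨Q, _, _, _, _, _, _, _, _, i, hid, h0, hdisc, hinj, hi⟩ := exists_rationals M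
  obtain ⟨K, _, _, _, mk, h⟩ := exists_isCompletion (M := M) (Q := Q) i
  have hSi : IsInt M {f : NN M → Q | Internal M f ∧ IsCau i f} := by
    simp only [IsCau, imp_iff_not_or]
    exact isInt_ofPred_internal (by fun_prop)
  have _ : Rep M (cauchySeq (M := M) i) :=
    inferInstanceAs (Rep M {f : NN M → Q | Internal M f ∧ IsCau i f})
  have _ : Tot M (cauchySeq (M := M) i) :=
    inferInstanceAs (Tot M {f : NN M → Q | Internal M f ∧ IsCau i f})
  have _ : Sm M (cauchySeq (M := M) i) :=
    inferInstanceAs (Sm M {f : NN M → Q | Internal M f ∧ IsCau i f})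
  have hker : Def M fun p : cauchySeq (M := M) i × cauchySeq (M := M) i => mk p.1 = mk p.2 := by
    refine Def.of_iff (P := fun p : cauchySeq (M := M) i × cauchySeq (M := M) i => ∀ ε : Q, 0 < ε →
      ∃ n, ∀ m, i n ≤ i m → |p.1.1 m - p.2.1 m| ≤ ε)
      (by simp only [imp_iff_not_or]; fun_prop) fun p => ?_
    rw [← sub_eq_zero, ← map_sub, h.eq_zero_iff]
    rfl
  let _ := codedQuotient M mk
  have hd : Def M mk := def_mk_codedQuotient hker
  have _ := rep_codedQuotient h.surj hker
  have _ := tot_codedQuotient h.surj hker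
  have _ := sm_codedQuotient h.surj hker
  have hsadd : Def M fun p : cauchySeq (M := M) i × cauchySeq (M := M) i => p.1 + p.2 :=
    Def.of_val (Def.lam (f := fun (p : cauchySeq (M := M) i × cauchySeq (M := M) i) n =>
      p.1.1 n + p.2.1 n) (by fun_prop))
  have hsmul : Def M fun p : cauchySeq (M := M) i × cauchySeq (M := M) i => p.1 * p.2 :=
    Def.of_val (Def.lam (f := fun (p : cauchySeq (M := M) i × cauchySeq (M := M) i) n =>
      p.1.1 n * p.2.1 n) (by fun_prop))
  have hc : Def M (IsCompletion.ofConst mk) :=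
    hd.comp (Def.of_val (Def.lam (f := fun (q : Q) (n : NN M) => q) (by fun_prop)))
  have hf : DefField M K := by
    refine ⟨Def.of_graph ?_, Def.of_graph ?_, ?_⟩
    · refine Def.of_iff (P := fun p : (K × K) × K => ∃ f g : cauchySeq (M := M) i,
        p.1 = (mk f, mk g) ∧ p.2 = mk (f + g)) ?_ ?_
      · have := hd.comp (hsadd.comp (Def.fst'.snd.prodMk Def.snd' :
          Def M fun q : (((K × K) × K) × cauchySeq (M := M) i) × cauchySeq (M := M) i => (q.1.2, q.2)))
        fun_prop
      · rintro ⟨⟨x, y⟩, z⟩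
        simp only [Prod.mk.injEq]
        constructor
        · rintro rfl
          obtain ⟨f, rfl⟩ := h.surj x
          obtain ⟨g, rfl⟩ := h.surj y
          exact ⟨f, g, ⟨rfl, rfl⟩, (map_add _ _ _).symm⟩
        · rintro ⟨f, g, ⟨rfl, rfl⟩, rfl⟩
          exact map_add _ _ _
    · refine Def.of_iff (P := fun p : (K × K) × K => ∃ f g : cauchySeq (M := M) i,
        p.1 = (mk f, mk g) ∧ p.2 = mk (f * g)) ?_ ?_
      · have := hd.comp (hsmul.comp (Def.fst'.snd.prodMk Def.snd' :
          Def M fun q : (((K × K) × K) × cauchySeq (M := M) i) × cauchySeq (M := M) i => (q.1.2, q.2)))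
        fun_prop
      · rintro ⟨⟨x, y⟩, z⟩
        simp only [Prod.mk.injEq]
        constructor
        · rintro rfl
          obtain ⟨f, rfl⟩ := h.surj x
          obtain ⟨g, rfl⟩ := h.surj y
          exact ⟨f, g, ⟨rfl, rfl⟩, (map_mul _ _ _).symm⟩
        · rintro ⟨f, g, ⟨rfl, rfl⟩, rfl⟩
          exact map_mul _ _ _
    · refine Def.of_iff (P := fun p : K × K => ∃ f g : cauchySeq (M := M) i,
        p = (mk f, mk g) ∧ ∀ ε : Q, 0 < ε → ∃ n, ∀ m, i n ≤ i m → f.1 m ≤ g.1 m + ε)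
        (by simp only [imp_iff_not_or]; fun_prop) ?_
      rintro ⟨x, y⟩
      simp only [Prod.mk.injEq]
      constructor
      · intro hxy
        obtain ⟨f, rfl⟩ := h.surj x
        obtain ⟨g, rfl⟩ := h.surj y
        exact ⟨f, g, ⟨rfl, rfl⟩, fun ε hε => h.ev_of_le hxy hε⟩
      · rintro ⟨f, g, ⟨rfl, rfl⟩, hfg⟩
        refine h.le_of_forall hi fun ε hε => ?_
        rw [IsCompletion.ofConst, RingHom.comp_apply, ← map_add]
        exact h.le_of_ev (hfg ε hε)
  refine ⟨K, _, _, inferInstance, _, inferInstance, inferInstance, inferInstance, hf, ?_⟩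
  rintro S hS ⟨x₀, hx₀⟩ ⟨b, hb⟩
  have hSint : IsInt M S := ⟨hS⟩
  -- The bound `1 - x₀ ≤ a` makes `-a` strictly smaller than `x₀`. The grid of mesh `1/(n + 1)`
  -- starting at `-a` thus begins below an element of `S`, and at index `(a + d)(n + 1)` it reaches
  -- the upper bound `d`.
  obtain ⟨a, ha⟩ := h.exists_le hi (1 - x₀)
  obtain ⟨d, hdb⟩ := h.exists_le hi b
  obtain ⟨t, ht⟩ : ∃ t : NN M → NN M → Q, ∀ n j, t n j = i j * (i n + 1)⁻¹ - i a :=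
    ⟨_, fun _ _ => rfl⟩
  have htd : Def M fun p : NN M × NN M => t p.1 p.2 := by
    simp only [ht]
    fun_prop
  have hpos : ∀ n, 0 < i n + 1 := fun n => by linarith [h0 n]
  obtain ⟨C, hC⟩ : ∃ C : NN M → NN M → Prop,
      ∀ n j, C n j ↔ ∀ x, x ∈ S → x ≤ IsCompletion.ofConst mk (t n j) := ⟨_, fun _ _ => Iff.rfl⟩
  have hCd : Def M fun p : NN M × NN M => C p.1 p.2 := by
    simp only [hC]
    fun_prop
  have hC0 : ∀ n, ¬ C n 0 := by
    intro n hn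
    have := (hC n 0).1 hn x₀ hx₀
    rw [ht, map_zero, zero_mul, zero_sub, map_neg] at this
    linarith
  have hCb : ∀ n, C n ((a + d) * (n + 1)) := by
    refine fun n => (hC _ _).2 fun x hx => (hb hx).trans (hdb.trans (h.ofConst_mono ?_))
    rw [ht, map_mul, map_add, map_add, map_one, mul_assoc, mul_inv_cancel₀ (hpos n).ne']
    linarith
  have hCm : ∀ n j k, i j ≤ i k → C n j → C n k := by
    intro n j k hjk hj
    refine (hC _ _).2 fun x hx => ((hC _ _).1 hj x hx).trans (h.ofConst_mono ?_)
    rw [ht, ht]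
    have := inv_pos.2 (hpos n)
    gcongr
  -- Induction inside the model finds the place where the grid passes from non-bounds to upper
  -- bounds. It is unique, so `j` is definable and the resulting sequence belongs to the model.
  have hex : ∀ n, ∃ j, ¬ C n j ∧ C n (j + 1) := by
    intro n
    by_contra! hne
    refine NN.ind (C := fun j => ¬ C n j) (by fun_prop) (hC0 n) (fun j hj => ?_) _ (hCb n)
    rw [NN.succ_eq]
    exact hne j hj
  choose j hj hj' using hex
  have hju : ∀ n k, ¬ C n k ∧ C n (k + 1) → k = j n := by
    have key : ∀ n k l, ¬ C n k → C n (l + 1) → i k ≤ i l := by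
      intro n k l hk hl
      by_contra! hlt
      refine hk (hCm n (l + 1) k ?_ hl)
      rw [map_add, map_one]
      exact hdisc _ _ hlt
    exact fun n k hk => hinj (le_antisymm (key n _ _ hk.1 (hj' n)) (key n _ _ (hj n) hk.2))
  have hjd : Def M j := Def.of_graph (Def.of_iff
    (P := fun p : NN M × NN M => ¬ C p.1 p.2 ∧ C p.1 (p.2 + 1)) (by fun_prop)
    fun p => ⟨fun hp => by rw [hp]; exact ⟨hj _, hj' _⟩, hju _ _⟩)
  have hsd : Def M fun n => t n (j n + 1) := by fun_prop
  have h1 : ∀ n, IsCompletion.ofConst mk (t n (j n + 1)) ∈ upperBounds S :=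
    fun n x hx => (hC _ _).1 (hj' n) x hx
  have h2 : ∀ n, IsCompletion.ofConst mk (t n (j n + 1) - (i n + 1)⁻¹) ∉ upperBounds S := by
    intro n hn
    refine hj n ((hC _ _).2 fun x hx => ?_)
    have : t n (j n) = t n (j n + 1) - (i n + 1)⁻¹ := by
      rw [ht, ht, map_add, map_one]
      ring
    rw [this]
    exact hn hx
  exact ⟨mk ⟨fun n => t n (j n + 1), hsd.isInt.out, h.isCau_of_upperBounds hi h0 h1 h2⟩,
    h.isLUB hi h0 h1 h2⟩

end Completion

/-! ### Transport of the real field to a set of the model -/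

section Transport

variable {M : Type u} [Membership M M] [ZFModel M]

/-- A small type all of whose elements are objects of the model is a set of the model. -/
theorem exists_equiv_el (K : Type u) [Coded M K] [Rep M K] [Tot M K] [Sm M K] :
    ∃ (R : M) (e : El R ≃ K), Def M (fun x => e x) := by
  obtain ⟨R, hR⟩ := Sm.exists_set (M := M) (α := K)
  choose f hf using fun x : El R => (hR x.1).1 x.2
  have hb : Function.Bijective f := by
    refine ⟨fun x y hxy => Subtype.ext (Rep.unique (hf x) (hxy ▸ hf y)), fun a => ?_⟩
    obtain ⟨m, hm⟩ := internal (M := M) a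
    exact ⟨⟨m, (hR m).2 ⟨a, hm⟩⟩, Rep.inj (hf _) hm⟩
  refine ⟨R, Equiv.ofBijective f hb, fun _ _ => internal _, ?_⟩
  have : D2 fun s t : M => s ∈ R ∧ t = s := by
    unfold D2
    exact (RDef.mem_const _ _).and (RDef.eq _ _)
  refine this.of_iff fun s t => ?_
  constructor
  · rintro ⟨hs, rfl⟩
    exact ⟨⟨_, hs⟩, rfl, hf _⟩
  · rintro ⟨x, hx, ht⟩
    rw [isCode_el.1 hx]
    exact ⟨x.2, Rep.unique ht (hf x)⟩

variable (M) in
/-- In every model of ZF there is a field of real numbers. -/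
theorem exists_realField : ∃ R : M, Nonempty (RealField R) := by
  obtain ⟨K, _, _, _, _, _, _, _, hK, hlub⟩ := exists_complete_field M
  obtain ⟨R, e, he⟩ := exists_equiv_el (M := M) K
  have hes : Def M (fun a => e.symm a) := Def.of_graph (Def.of_iff
    (P := fun p : K × El R => e p.2 = p.1) (by fun_prop) fun p => e.eq_symm_apply)
  -- All structure is carried over along the definable bijection `e`, so the operations and the
  -- order are objects of the model.
  let F : Field (El R) := e.field
  let O : LinearOrder (El R) := LinearOrder.lift' e e.injective
  have hle : ∀ x y : El R, x ≤ y ↔ e x ≤ e y := fun _ _ => Iff.rfl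
  have hadd : ∀ x y : El R, x + y = e.symm (e x + e y) := fun _ _ => rfl
  have hmul : ∀ x y : El R, x * y = e.symm (e x * e y) := fun _ _ => rfl
  have hS : IsStrictOrderedRing (El R) :=
    Function.Injective.isStrictOrderedRing e e.ringEquiv.map_zero e.ringEquiv.map_one
      e.ringEquiv.map_add e.ringEquiv.map_mul Iff.rfl Iff.rfl
  refine ⟨R, ⟨{ F, O, hS with
    internal_add := ?_
    internal_mul := ?_
    internal_le := ?_
    exists_isLUB := ?_ }⟩⟩
  · exact (show Def M fun p : El R × El R => e.symm (e p.1 + e p.2) by fun_prop).isInt.out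
  · exact (show Def M fun p : El R × El R => e.symm (e p.1 * e p.2) by fun_prop).isInt.out
  · exact (Def.isInt_ofPred (show Def M fun p : El R × El R => e p.1 ≤ e p.2 by fun_prop)).out
  · rintro S hS ⟨x, hx⟩ ⟨b, hb⟩
    have hSi : IsInt M S := ⟨hS⟩
    have hT : IsInt M {a : K | e.symm a ∈ S} := Def.isInt_ofPred (by fun_prop)
    have hub : ∀ b, b ∈ upperBounds S ↔ e b ∈ upperBounds {a : K | e.symm a ∈ S} := by
      refine fun b => ⟨fun h a ha => ?_, fun h a ha => ?_⟩
      · have := (hle _ _).1 (h ha)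
        rwa [e.apply_symm_apply] at this
      · exact (hle _ _).2 (h (show e.symm (e a) ∈ S by rwa [e.symm_apply_apply]))
    obtain ⟨s, hs, hs'⟩ := hlub {a : K | e.symm a ∈ S} hT.out
      ⟨e x, show e.symm (e x) ∈ S by rwa [e.symm_apply_apply]⟩ ⟨e b, (hub b).1 hb⟩
    refine ⟨e.symm s, (hub _).2 (by rwa [e.apply_symm_apply]), fun c hc => (hle _ _).2 ?_⟩
    rw [e.apply_symm_apply]
    exact hs' ((hub c).1 hc)

end Transport

end ZFAnalysis

theorem theoremL {M : Type*} [Membership M M] [ZFModel M] :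
    (∃ R : M, Nonempty (RealField R)) ∧
    ∀ (R : M) [RealField R] (X Z : M) (P : El Z → Set (El X)),
      IsAmorphous X → IsStronglyAmorphous Z →
      Internal M P → (∀ z, ∃ x y, x ≠ y ∧ P z = {x, y}) →
      (∀ z z', z ≠ z' → Disjoint (P z) (P z')) → (∀ x, ∃ z, x ∈ P z) →
      (∃ Y : Set (El X → Cplx R),
        IsClosedSubspace Y ∧ IsIsomorphic (ell2 R Z) Y ∧
        (¬ ∃ B, IsOrthonormalBasis (orthCompl Y) B) ∧
        (∀ B, IsOrthonormal B → B ⊆ orthCompl Y → IsFin M B)) ∧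
      ¬ ∃ f : El Z → El X, Internal M f ∧ Function.Injective f := by
  refine ⟨exists_realField M, fun R _ X Z P hX hZ hP h2 hd hs => ?_⟩
  obtain ⟨π, σ, h⟩ := exists_isTwoToOne hP h2 hd hs
  exact ⟨⟨IsTwoToOne.symm R σ, h.isClosedSubspace_symm hX, h.isIsomorphic hX hZ.1,
    h.not_exists_isOrthonormalBasis hX hZ, fun B => h.isFin_of_isOrthonormal hX hZ⟩,
    fun ⟨f, hf, hinj⟩ => h.not_exists_injective hX hZ (Def.of_isInt ⟨hf⟩) hinj⟩
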